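/- **Setting.** Let $d_x\ge 1$ and $d_y\ge 0$ be dimensions, $f(\cdot\mid x):\mathbb R^{d_y}\to\mathbb R$ (jointly measurable in $(x,y)$) with $\int e^{-f(y\mid x)}\,dy=1$ for every $x\in\mathbb R^{d_x}$, and $\mathcal R:\mathbb R^{d_x}\to\mathbb R$ with $\int e^{-\mathcal R}<\infty$. The data $\mathcal D=\{(x_i,y_i)\}_{i\le n}$ are i.i.d. with $x_i\sim e^{-\mathcal R(x)}dx/\int e^{-\mathcal R}$ and $y_i\mid x_i\sim e^{-f(y\mid x_i)}dy$. Put $g(y)=\arg\min_x\,[f(y\mid x)+\mathcal R(x)]$ and, for a step size $\gamma>0$ and a starting point $x^{(0)}$, $F_y(x)=\mathrm{Prox}^{\gamma\mathcal R}(x-\gamma\nabla_xf(y\mid x))$, where $\mathrm{Prox}^{\gamma\mathcal R}(x)=\arg\min_u[\gamma\mathcal R(u)+\tfrac12\|u-x\|_2^2]$. Powers of maps denote composition. A *network class* $\{H_W\}$ on $\mathbb R^{d_x}$ is given by a depth $D\ge1$, layer sizes $p_0=d_x,p_1,\dots,p_D=d_x$ and maps $a_\ell:\mathbb R^{p_\ell}\to\mathbb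 R^{p_\ell}$ that are 1-Lipschitz with $a_\ell(0)=0$; for $W=(W_D,\dots,W_1)$ with $W_\ell\in\mathbb R^{p_\ell\times p_{\ell-1}}$, $H_W=\Psi_D\circ\cdots\circ\Psi_1$ with $\Psi_\ell(z)=a_\ell(W_\ell z)$. It has $q=\sum_\ell p_\ell p_{\ell-1}$ parameters. Put $F_{y,W}(x)=H_W(x-\gamma\nabla_xf(y\mid x))$. The gradient descent network (GDN) unrolled at depth $D'\ge 1$ is $g_W(y)=F_{y,W}^{D'}(x^{(0)})$. For $\sigma>0$, $\mathsf u\ge1$, $\rho_0>0$, the spike-and-slab posterior on pairs $(\Lambda,W)$, $\Lambda\in\{0,1\}^q$, $W\in\mathbb R^q$, is $$\Pi(\Lambda,W\mid\mathcal D)\propto q^{-(\mathsf u+1)\|\Lambda\|_0}\prod_{k:\Lambda_k=1}\tfrac{1}{\sqrt{2\pi}}e^{-W_k^2/2}\prod_{k:\Lambda_k=0}\sqrt{\tfrac{\rho_0}{2\pi}}\,e^{-\rho_0W_k^2/2}\;\exp\Big(-\tfrac1{2\sigma^2}\sum_{i=1}^n\|x_i-g_{\Lambda\odot W}(y_i)\|_2^2\Big).$$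 Finally $\|h\|_n^2=\frac1n\sum_{i=1}^n\|h(y_i)\|_2^2$. **Assumptions.** (H1) For a.e. $y$, the conditional law of $\xi_i=x_i-g(y_i)$ given $y_i=y$ has mean $0$ and sub-Gaussian norm at most $\bar\sigma$, that is $\mathbb E[e^{\langle v,\xi_i\rangle}\mid y_i=y]\le e^{\bar\sigma^2\|v\|_2^2/2}$ for all $v$; here $0<\bar\sigma<\infty$. (H2) $\mathcal R$ is convex; for some $L\ge 0$ and all $y$, $f(y\mid\cdot)$ is convex and differentiable with $L$-Lipschitz gradient; $\gamma>0$ and $\gamma L\le1$; $g(y)$ is the unique minimizer for every $y$. With a constant $R_0$ and $\varrho_n\in[0,1)$, the design satisfies $\max_{i\le n}\|F_{y_i}^k(x^{(0)})-g(y_i)\|_2\le R_0\varrho_n^k$ for all $k\ge1$. (H3) There are $\beta_1,\beta_2\ge0$ and constants $D_0,N_0,s_0,R_1$ such that for every $\epsilon\in(0,1/2]$ there is a network $H_{W_\epsilon}$ as above with depth at most $D_0\log(\sqrt{d_x}/\epsilon)$, layer sizes at most $N_0(\sqrt{d_x}/\epsilon)^{\beta_1}$, entries of $W_\epsilon$ bounded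 by $1$ in absolute value, at most $s_0(\sqrt{d_x}/\epsilon)^{\beta_2}$ non-zero entries, and $\|H_{W_\epsilon}(x)-\mathrm{Prox}^{\gamma\mathcal R}(x)\|_2\le\epsilon$ for all $x\in\mathbb R^{d_x}$; moreover the design satisfies $\max_{j\ge1}\max_{i\le n}\|F^j_{y_i,W_\epsilon}(x^{(0)})\|_2\le R_1$. **Theorem.** There are absolute constants $c_1>0$ and $q_0$ with the following property. Let (H1)–(H3) hold, $\sigma\ge\bar\sigma$ and $\mathsf u\ge1$. There are constants $C,K>0$, depending on the problem $(d_x,d_y,f,\mathcal R,\gamma,x^{(0)})$, on $L,\sigma,\bar\sigma,\mathsf u$ and on the constants $D_0,N_0,s_0,\beta_1,\beta_2,R_0,R_1$, but not on $n$, $\varrho_n$, $D'$, $q$, $\rho_0$ or the networks of (H3), such that for all $n\ge2$ and every unrolling depth $D'\ge1$ with $$D'\ \ge\ C\,\frac{\log n}{-\log\varrho_n}$$ (no constraint beyond $D'\ge1$ if $\varrho_n=0$) the following holds. Let $\{H_W\}$ be the network class to which the network of (H3) of accuracy $\epsilon=\frac{1}{2D'}n^{-1/(2+\beta_2)}$ belongs,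 and let $q$ be its number of parameters. If $q\ge q_0$ and $n\ge\sigma^2\log q$, then for every $\rho_0>0$, with probability at least $1-e^{-c_1n}-\frac{c_1}{q}$, $$\Pi\Big(\|g_{\Lambda\odot W}-g\|_n>M\bar\sigma\,\frac{(D')^{1+\beta_2/2}}{n^{1/(2+\beta_2)}}\ \Big|\ \mathcal D\Big)\le\frac{12}{q},\qquad M=K(\log q)^{1/(2+\beta_2)}(\log n)^{3/2}.$$ The probability statement is meant conditionally on the design: for every measurable set $B\subseteq(\mathbb R^{d_y})^n$ of designs $(y_1,\dots,y_n)$ that satisfy the conditions on the design in (H2) and (H3), the probability that $(y_1,\dots,y_n)\in B$ and the displayed inequality fails is at most $\big(e^{-c_1n}+\frac{c_1}{q}\big)\,\mathbb P\big((y_1,\dots,y_n)\in B\big)$. -/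

import Mathlib

open MeasureTheory

noncomputable section

namespace Unrolling

/-- Euclidean space `ℝᵈ`, with the Euclidean norm. -/
abbrev E (d : ℕ) : Type := EuclideanSpace ℝ (Fin d)

/-- A minimizer of `φ` over the whole space (an arbitrary one if there are several; meaningful
only when a minimizer exists). -/
def argmin {d : ℕ} (φ : E d → ℝ) : E d :=
  Classical.epsilon fun a => ∀ z, φ a ≤ φ z

/-- The proximal map of `φ`: `x ↦ argmin_u φ(u) + ‖u - x‖² / 2`. -/
def prox {d : ℕ} (φ : E d → ℝ) (x : E d) : E d :=
  argmin fun u => φ u + ‖u - x‖ ^ 2 / 2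

/-! ### Inverse problems -/

/-- The data of an inverse problem and of proximal gradient descent for it.
`f y x` is the negative log-density of the observation `y` given the latent `x`; `R` is, up to an
additive constant, the negative log-density of `x`; `γ` is the step size and `x₀` the
starting point. -/
structure InverseProblem (dx dy : ℕ) where
  f : E dy → E dx → ℝ
  R : E dx → ℝ
  γ : ℝ
  x₀ : E dx

namespace InverseProblem

variable {dx dy : ℕ} (P : InverseProblem dx dy)

/-- The regression map `g(y) = argmin_x f(y | x) + R(x)`. -/
def g (y : E dy) : E dx := argmin fun x => P.f y x + P.R x

/-- The gradient step `x ↦ x - γ ∇ₓ f(y | x)`. -/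
def gradStep (y : E dy) (x : E dx) : E dx := x - P.γ • gradient (P.f y) x

/-- The proximal gradient map `F_y(x) = Prox^{γR}(x - γ ∇ₓ f(y | x))`. -/
def proxStep (y : E dy) (x : E dx) : E dx := prox (fun u => P.γ * P.R u) (P.gradStep y x)

/-- The joint law of `(x, y)`: `x` has density `e^{-R(x)} / ∫ e^{-R}`, and `y` given `x` has
density `e^{-f(y | x)}`. -/
def jointLaw : Measure (E dx × E dy) :=
  (volume : Measure (E dx × E dy)).withDensity fun z =>
    ENNReal.ofReal (Real.exp (-P.R z.1) / (∫ x, Real.exp (-P.R x)) * Real.exp (-P.f z.2 z.1))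

/-- The conditional law of `x` given `y`, proportional to `exp(-R(x) - f(y | x)) dx`. -/
def condLaw (y : E dy) : Measure (E dx) :=
  (∫⁻ x, ENNReal.ofReal (Real.exp (-P.R x - P.f y x)))⁻¹ •
    (volume : Measure (E dx)).withDensity fun x => ENNReal.ofReal (Real.exp (-P.R x - P.f y x))

end InverseProblem

/-- The sub-Gaussian norm of the probability measure `ν` (centred at its mean) is at most `c`. -/
def SubGaussianNormLE {d : ℕ} (ν : Measure (E d)) (c : ℝ) : Prop :=
  ∀ u : E d, ∫⁻ z, ENNReal.ofReal (Real.exp (inner ℝ u (z - ∫ w, w ∂ν))) ∂ν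
    ≤ ENNReal.ofReal (Real.exp (c ^ 2 * ‖u‖ ^ 2 / 2))

/-- The statistical model: `e^{-R}` is normalizable, every `e^{-f(· | x)}` is a probability
density, and the error `ξ = x - g(y)` has conditional mean zero and conditional sub-Gaussian norm
at most `σbar` given `y`. -/
structure InverseProblem.ErrorModel {dx dy : ℕ} (P : InverseProblem dx dy) (σbar : ℝ) :
    Prop where
  measurable_f : Measurable (Function.uncurry P.f)
  integrable_R : Integrable (fun x => Real.exp (-P.R x)) volume
  density_f : ∀ x, ∫⁻ y, ENNReal.ofReal (Real.exp (-P.f y x)) = 1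
  mean_eq : ∀ᵐ y ∂P.jointLaw.snd,
    Integrable (fun x => x) (P.condLaw y) ∧ ∫ x, x ∂(P.condLaw y) = P.g y
  subGaussian : ∀ᵐ y ∂P.jointLaw.snd, SubGaussianNormLE (P.condLaw y) σbar

/-- The convexity and step-size conditions; `L` is the Lipschitz constant of the gradients. The
condition `γ ≤ 1 / L` is written `γ * L ≤ 1`, so that `L = 0` imposes nothing on `γ`. -/
structure InverseProblem.ConvexModel {dx dy : ℕ} (P : InverseProblem dx dy) (L : ℝ) : Prop where
  convex_R : ConvexOn ℝ Set.univ P.R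
  convex_f : ∀ y, ConvexOn ℝ Set.univ (P.f y)
  differentiable_f : ∀ y, Differentiable ℝ (P.f y)
  lipschitz_grad : ∀ y x x', ‖gradient (P.f y) x - gradient (P.f y) x'‖ ≤ L * ‖x - x'‖
  step_pos : 0 < P.γ
  step_le : P.γ * L ≤ 1
  unique_g : ∀ y, ∃! x, ∀ z, P.f y x + P.R x ≤ P.f y z + P.R z

/-- Linear convergence of proximal gradient descent at the design points `y₁, …, yₙ`. -/
def InverseProblem.LinearRate {dx dy n : ℕ} (P : InverseProblem dx dy) (R₀ ϱ : ℝ)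
    (y : Fin n → E dy) : Prop :=
  ∀ k : ℕ, 1 ≤ k → ∀ i, ‖(P.proxStep (y i))^[k] P.x₀ - P.g (y i)‖ ≤ R₀ * ϱ ^ k

/-! ### Feed-forward networks -/

/-- A feed-forward architecture `ℝᵈ → ℝᵈ`, that is a class `{H_W}` of networks: `depth` layers of
sizes `width 0 = d, …, width depth = d`, and for each layer an activation map that is
non-expansive and fixes `0`. (Only `act 1, …, act depth` are used.) -/
structure Network (d : ℕ) where
  depth : ℕ
  one_le_depth : 1 ≤ depth
  width : ℕ → ℕ
  width_zero : width 0 = d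
  width_depth : width depth = d
  act : ∀ ℓ, E (width ℓ) → E (width ℓ)
  act_zero : ∀ ℓ, act ℓ 0 = 0
  act_lipschitz : ∀ ℓ z z', ‖act ℓ z - act ℓ z'‖ ≤ ‖z - z'‖

namespace Network

variable {d : ℕ} (𝒩 : Network d)

/-- Index set of the parameters: `⟨ℓ, i, j⟩` is the entry `(i, j)` of the matrix of layer
`ℓ + 1`. -/
abbrev Idx : Type :=
  (ℓ : Fin 𝒩.depth) × (Fin (𝒩.width (ℓ.1 + 1)) × Fin (𝒩.width ℓ.1))

/-- The parameters `W`, that is the weight matrices of all the layers, as one vector. -/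
abbrev Param : Type := 𝒩.Idx → ℝ

/-- The number `q = ∑ p_ℓ p_{ℓ-1}` of parameters. -/
def numParams : ℕ := ∑ ℓ ∈ Finset.range 𝒩.depth, 𝒩.width (ℓ + 1) * 𝒩.width ℓ

/-- The weight matrix of layer `ℓ + 1`. -/
def weight (W : 𝒩.Param) (ℓ : Fin 𝒩.depth) :
    Matrix (Fin (𝒩.width (ℓ.1 + 1))) (Fin (𝒩.width ℓ.1)) ℝ :=
  Matrix.of fun i j => W ⟨ℓ, i, j⟩

/-- The output of layer `ℓ` (layer `0` is the input). -/
def layer (W : 𝒩.Param) (x : E d) : (ℓ : ℕ) → E (𝒩.width ℓ)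
  | 0 => WithLp.toLp 2 fun i => x (Fin.cast 𝒩.width_zero i)
  | ℓ + 1 =>
    if h : ℓ < 𝒩.depth then
      𝒩.act (ℓ + 1) (WithLp.toLp 2 ((𝒩.weight W ⟨ℓ, h⟩).mulVec (layer W x ℓ)))
    else 0

/-- The network function `H_W : ℝᵈ → ℝᵈ`. -/
def eval (W : 𝒩.Param) (x : E d) : E d :=
  WithLp.toLp 2 fun i => 𝒩.layer W x 𝒩.depth (Fin.cast 𝒩.width_depth.symm i)

/-- The number of non-zero entries of `W`. -/
def sparsity (W : 𝒩.Param) : ℕ := by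
  classical exact (Finset.univ.filter fun k => W k ≠ 0).card

/-- `H_W` approximates the proximal map of `γ R` on all of `ℝᵈ` with accuracy `ε`, within the
budgets on depth, layer sizes, sparsity and size of the parameters that are allowed at
accuracy `ε`. -/
structure Approximates {dy : ℕ} (W : 𝒩.Param) (P : InverseProblem d dy)
    (D₀ N₀ s₀ β₁ β₂ ε : ℝ) : Prop where
  depth_le : (𝒩.depth : ℝ) ≤ D₀ * Real.log (√d / ε)
  width_le : ∀ ℓ ≤ 𝒩.depth, (𝒩.width ℓ : ℝ) ≤ N₀ * (√d / ε) ^ β₁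
  abs_le : ∀ k, |W k| ≤ 1
  sparsity_le : (𝒩.sparsity W : ℝ) ≤ s₀ * (√d / ε) ^ β₂
  approx : ∀ x, ‖𝒩.eval W x - prox (fun u => P.γ * P.R u) x‖ ≤ ε

variable {dy n : ℕ}

/-- The learned step `F_{y,W}(x) = H_W(x - γ ∇ₓ f(y | x))`. -/
def step (P : InverseProblem d dy) (W : 𝒩.Param) (y : E dy) (x : E d) : E d :=
  𝒩.eval W (P.gradStep y x)

/-- The iterates of the learned step at the design points `y₁, …, yₙ` stay in the ball of
radius `R₁`. -/
def StableIterates (P : InverseProblem d dy) (W : 𝒩.Param) (R₁ : ℝ) (y : Fin n → E dy) : Prop :=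
  ∀ j : ℕ, 1 ≤ j → ∀ i, ‖(𝒩.step P W (y i))^[j] P.x₀‖ ≤ R₁

/-- The gradient descent network `g_W`, unrolled `T` times. -/
def gdn (P : InverseProblem d dy) (T : ℕ) (W : 𝒩.Param) (y : E dy) : E d :=
  (𝒩.step P W y)^[T] P.x₀

/-! ### The spike-and-slab posterior -/

/-- The parameter space `Θ` of pairs `(Λ, W)`: a support and a weight vector. -/
abbrev Theta : Type := (𝒩.Idx → Bool) × 𝒩.Param

/-- The component-wise product `Λ ⊙ W`. -/
def mask (θ : 𝒩.Theta) : 𝒩.Param := fun k => if θ.1 k then θ.2 k else 0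

/-- The centred Gaussian density on `ℝ` with precision `ρ`. -/
def gaussDensity (ρ t : ℝ) : ℝ := √(ρ / (2 * Real.pi)) * Real.exp (-(ρ / 2 * t ^ 2))

/-- The spike-and-slab prior density on `Θ`, up to normalization: the support `Λ` has weight
`(1 / q)^{(u + 1) ‖Λ‖₀}`, and given `Λ` the entries of `W` are independent centred Gaussians with
precision `1` on the support and `ρ₀` off the support. -/
def priorDensity (u ρ₀ : ℝ) (θ : 𝒩.Theta) : ℝ :=
  (1 / (𝒩.numParams : ℝ)) ^ ((u + 1) * ((Finset.univ.filter fun k => θ.1 k = true).card : ℝ)) *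
    ∏ k, gaussDensity (if θ.1 k then 1 else ρ₀) (θ.2 k)

/-- The posterior density on `Θ` given the data `(xᵢ, yᵢ)`, up to normalization. -/
def postDensity (P : InverseProblem d dy) (T : ℕ) (σ u ρ₀ : ℝ) (D : Fin n → E d × E dy)
    (θ : 𝒩.Theta) : ℝ :=
  𝒩.priorDensity u ρ₀ θ *
    Real.exp (-(1 / (2 * σ ^ 2) * ∑ i, ‖(D i).1 - 𝒩.gdn P T (𝒩.mask θ) (D i).2‖ ^ 2))

/-- The reference measure on `Θ`: counting measure on supports times Lebesgue measure. -/
def refMeasure : Measure 𝒩.Theta :=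
  (Measure.count : Measure (𝒩.Idx → Bool)).prod (volume : Measure 𝒩.Param)

/-- The posterior distribution `Π(· | D)` on `Θ`. -/
def posterior (P : InverseProblem d dy) (T : ℕ) (σ u ρ₀ : ℝ) (D : Fin n → E d × E dy) :
    Measure 𝒩.Theta :=
  (∫⁻ θ, ENNReal.ofReal (𝒩.postDensity P T σ u ρ₀ D θ) ∂𝒩.refMeasure)⁻¹ •
    𝒩.refMeasure.withDensity fun θ => ENNReal.ofReal (𝒩.postDensity P T σ u ρ₀ D θ)

end Network

/-- The empirical norm `‖h‖ₙ` over the design points `y₁, …, yₙ`. -/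
def empNorm {dx dy n : ℕ} (y : Fin n → E dy) (h : E dy → E dx) : ℝ :=
  √((1 / (n : ℝ)) * ∑ i, ‖h (y i)‖ ^ 2)

/-- The accuracy with which the network that defines the class approximates the proximal map,
at sample size `n` and unrolling depth `T`. -/
def accuracy (β₂ : ℝ) (n T : ℕ) : ℝ := 1 / (2 * (T : ℝ) * (n : ℝ) ^ (1 / (2 + β₂)))

end Unrolling

end

open Unrolling

/-!
The posterior compares the likelihoods of unrolled networks with that of the conditional mean
`E[x | y]`, which is `g(y)` almost surely. Writing `h_θ` for the deviation of the network with
parameters `θ` from `g` at the design points, and `ξ` for the errors, the logarithm of the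
likelihood ratio is `(⟨h_θ, ξ⟩ - ‖h_θ‖² / 2) / σ²`. Given the design the errors are jointly
sub-Gaussian (`InverseProblem.ErrorModel.setLIntegral_exp_inner_le`), and since `σ ≥ σbar` each
likelihood ratio has mean at most `1`. Contraction is then a comparison of prior masses
(`measure_posterior_gt_le`).

*Denominator.* Let `W` be the network of accuracy `1 / (2 T n ^ (1 / (2 + β₂)))` for the proximal
map. Proximal gradient steps are non-expansive, so that unrolling `W` costs a factor `T`
(`Network.norm_gdn_sub_proxStep_le`), and with the linear convergence of proximal gradient descent
its output is within `O(n ^ (-1 / (2 + β₂)))` of `g`. Unrolled networks are Lipschitz in the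
parameters, with a constant `exp (O(T log n log q))` (`Network.norm_gdn_sub_le`). The parameters
with the support of `W` that are close to `W` have therefore prior mass at least `exp (-V)` with
`V` of order `T ^ (1 + β₂) n ^ (β₂ / (2 + β₂)) log n log q`. A bound on the average of the *inverse*
likelihood ratio over this neighbourhood bounds the normalizing constant from below
(`measure_le_mul_setLIntegral`).

*Numerator.* The prior puts mass at most `exp (-V) / q ^ 5`, up to a constant, outside of a sieve of
sparse and bounded parameters (`Network.priorMeasure_compl_sieve_le`), and there the expected
likelihood ratio is at most the prior mass. The sieve is covered by a grid so fine that, by the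
Lipschitz bound, outputs vary by at most `1 / n` within its cells. A union bound over the grid
controls the noise `⟨h, ξ⟩` in terms of `‖h‖² + r` (`SubGaussianErrors.measure_inner_gt_le`), so
that all likelihood ratios with `‖h_θ‖² > r` are at most `exp (-r / (8 σ²))` once `r` exceeds a
multiple of the entropy of the grid and of `V`. Both are of the order of the squared rate
(`Network.exists_contraction_of_lt`). The Lipschitz bound needs bounded gradient steps on the
design. They follow from the convergence and stability of the iterates, which bound `g(y)` and hence
the gradient there, which is minus a subgradient of `R` (`Network.exists_gradStep_bound`).

The entropy bound requires `log T = O(log n)`. For `T ≥ n` the radius `√r` exceeds a multiple of the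
total size of the noise, and no covering is needed (`Network.exists_contraction_of_le`).
-/

namespace Unrolling

open scoped ENNReal

/-! ### Convexity and gradient steps -/

section Convex

variable {F : Type*} [NormedAddCommGroup F] [InnerProductSpace ℝ F]

/-- Letting `t → 0` in `a ≤ b + t c`. -/
theorem le_of_forall_small_mul {a b c : ℝ} (h : ∀ t : ℝ, 0 < t → t ≤ 1 → a ≤ b + t * c) :
    a ≤ b := by
  by_contra hab
  push Not at hab
  have hc : 0 < |c| + 1 := by positivity
  set t := min 1 ((a - b) / (2 * (|c| + 1))) with ht
  have ht0 : 0 < t := lt_min one_pos (div_pos (by linarith) (by linarith))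
  have h1 := h t ht0 (min_le_left _ _)
  have h2 : t * (|c| + 1) ≤ (a - b) / 2 := by
    have : t ≤ (a - b) / (2 * (|c| + 1)) := min_le_right _ _
    rw [le_div_iff₀ (by linarith)] at this
    linarith
  nlinarith [le_abs_self c]

theorem ConvexOn.segment_le {φ : F → ℝ} (hφ : ConvexOn ℝ Set.univ φ) (x v : F) {t : ℝ}
    (h0 : 0 ≤ t) (h1 : t ≤ 1) : φ (x + t • v) ≤ φ x + t * (φ (x + v) - φ x) := by
  have := hφ.2 (Set.mem_univ x) (Set.mem_univ (x + v)) (sub_nonneg.2 h1) h0 (by ring)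
  have e : (1 - t) • x + t • (x + v) = x + t • v := by module
  rw [e] at this
  simp only [smul_eq_mul] at this
  linarith

variable [CompleteSpace F]

/-- An upper bound for a directional derivative. No convexity of `φ` is needed, so that the lemma
also applies to the negative of a convex function. -/
theorem inner_gradient_le_of_segment {φ : F → ℝ} {x v : F} (hd : DifferentiableAt ℝ φ x) {m : ℝ}
    (h : ∀ t : ℝ, 0 < t → t ≤ 1 → φ (x + t • v) ≤ φ x + t * m) :
    inner ℝ (gradient φ x) v ≤ m := by
  rw [inner_gradient_left]
  have h1 : HasDerivAt (fun t : ℝ => φ (x + t • v)) (fderiv ℝ φ x v) 0 := by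
    have hl : HasDerivAt (fun t : ℝ => x + t • v) v 0 := by
      simpa using ((hasDerivAt_id (0 : ℝ)).smul_const v).const_add x
    have hf : HasFDerivAt φ (fderiv ℝ φ x) (x + (0 : ℝ) • v) := by
      simpa using hd.hasFDerivAt
    exact hf.comp_hasDerivAt (0 : ℝ) hl
  have h2 := h1.hasDerivWithinAt (s := Set.Ioi 0)
  rw [hasDerivWithinAt_iff_tendsto_slope' (by simp)] at h2
  refine le_of_tendsto h2 ?_
  filter_upwards [Ioc_mem_nhdsGT (zero_lt_one' ℝ)] with t ht
  rw [slope_def_field, sub_zero, zero_smul, add_zero, div_le_iff₀ ht.1]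
  linarith [h t ht.1 ht.2]

/-- The first order characterization of convexity, for a differentiable convex function. -/
theorem ConvexOn.add_inner_gradient_le {φ : F → ℝ} (hφ : ConvexOn ℝ Set.univ φ)
    (hd : Differentiable ℝ φ) (x z : F) : φ x + inner ℝ (gradient φ x) (z - x) ≤ φ z := by
  have := inner_gradient_le_of_segment (hd x) (v := z - x) (m := φ z - φ x) fun t h0 h1 => by
    have := ConvexOn.segment_le hφ x (z - x) h0.le h1
    rwa [add_sub_cancel] at this
  linarith

/-- Descent after a gradient step for the convex function `φ - ⟨∇φ(x), ·⟩`, which is minimal at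
`x`. -/
theorem ConvexOn.gradient_descent {φ : F → ℝ} (hφ : ConvexOn ℝ Set.univ φ)
    (hd : Differentiable ℝ φ) {L : ℝ} (hL : 0 < L)
    (hlip : ∀ x x', ‖gradient φ x - gradient φ x'‖ ≤ L * ‖x - x'‖) (x y : F) :
    φ x + inner ℝ (gradient φ x) (y - x) + ‖gradient φ y - gradient φ x‖ ^ 2 / (4 * L) ≤ φ y := by
  set Δ := gradient φ y - gradient φ x with hΔ
  set z := y - (1 / (2 * L)) • Δ with hz
  have h1 := ConvexOn.add_inner_gradient_le hφ hd x z
  have h2 := ConvexOn.add_inner_gradient_le hφ hd z y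
  have h3 : inner ℝ (gradient φ y - gradient φ z) ((1 / (2 * L)) • Δ) ≤
      L * ‖(1 / (2 * L)) • Δ‖ ^ 2 := by
    refine (real_inner_le_norm _ _).trans ?_
    have := hlip y z
    rw [hz, sub_sub_cancel, ← hz] at this
    nlinarith [norm_nonneg ((1 / (2 * L)) • Δ)]
  have e1 : y - z = (1 / (2 * L)) • Δ := by rw [hz, sub_sub_cancel]
  have e2 : z - x = (y - x) - (1 / (2 * L)) • Δ := by rw [hz]; abel
  rw [e1] at h2
  rw [e2, inner_sub_right] at h1
  have h4 : inner ℝ Δ ((1 / (2 * L)) • Δ) = 1 / (2 * L) * ‖Δ‖ ^ 2 := by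
    rw [real_inner_smul_right, real_inner_self_eq_norm_sq]
  have h5 : L * ‖(1 / (2 * L)) • Δ‖ ^ 2 = ‖Δ‖ ^ 2 / (4 * L) := by
    rw [norm_smul, Real.norm_of_nonneg (by positivity)]; field_simp; ring
  have h6 : 1 / (2 * L) * ‖Δ‖ ^ 2 = ‖Δ‖ ^ 2 / (4 * L) + ‖Δ‖ ^ 2 / (4 * L) := by
    field_simp; ring
  rw [hΔ, inner_sub_left, ← hΔ] at h4
  rw [inner_sub_left] at h3
  linarith

/-- Gradient steps are non-expansive for step sizes up to `1 / L` (a form of the Baillon–Haddad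
theorem). -/
theorem ConvexOn.gradient_step_nonexpansive {φ : F → ℝ} (hφ : ConvexOn ℝ Set.univ φ)
    (hd : Differentiable ℝ φ) {L γ : ℝ}
    (hlip : ∀ x x', ‖gradient φ x - gradient φ x'‖ ≤ L * ‖x - x'‖) (hγ : 0 < γ) (hγL : γ * L ≤ 1)
    (x y : F) : ‖(x - γ • gradient φ x) - (y - γ • gradient φ y)‖ ≤ ‖x - y‖ := by
  -- a positive Lipschitz constant that is still compatible with the step size
  have hlip' : ∀ x x', ‖gradient φ x - gradient φ x'‖ ≤ (1 / γ) * ‖x - x'‖ := fun x x' =>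
    (hlip x x').trans (mul_le_mul_of_nonneg_right (by rw [le_div_iff₀ hγ]; linarith)
      (norm_nonneg _))
  have h1 := ConvexOn.gradient_descent hφ hd (by positivity) hlip' x y
  have h2 := ConvexOn.gradient_descent hφ hd (by positivity) hlip' y x
  set Δ := gradient φ x - gradient φ y with hΔ
  have e0 : (x - γ • gradient φ x) - (y - γ • gradient φ y) = (x - y) - γ • Δ := by
    rw [hΔ]; module
  have e1 : ‖gradient φ y - gradient φ x‖ = ‖Δ‖ := norm_sub_rev _ _
  have e2 : inner ℝ (gradient φ x) (y - x) = - inner ℝ (gradient φ x) (x - y) := by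
    rw [← inner_neg_right, neg_sub]
  have e3 : inner ℝ (x - y) Δ =
      inner ℝ (gradient φ x) (x - y) - inner ℝ (gradient φ y) (x - y) := by
    rw [real_inner_comm, ← inner_sub_left]
  have e4 : ‖Δ‖ ^ 2 / (4 * (1 / γ)) = γ * ‖Δ‖ ^ 2 / 4 := by field_simp
  rw [e1, e4, e2] at h1
  rw [e4] at h2
  have h3 : γ * ‖Δ‖ ^ 2 / 2 ≤ inner ℝ (x - y) Δ := by rw [e3]; linarith
  have h4 : ‖(x - y) - γ • Δ‖ ^ 2 ≤ ‖x - y‖ ^ 2 := by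
    rw [norm_sub_sq_real, real_inner_smul_right, norm_smul, Real.norm_of_nonneg hγ.le]
    nlinarith
  rw [e0]
  exact (sq_le_sq₀ (norm_nonneg _) (norm_nonneg _)).1 h4

end Convex

/-! ### The proximal map and the proximal gradient map -/

theorem argmin_spec {d : ℕ} {φ : E d → ℝ} (h : ∃ a, ∀ z, φ a ≤ φ z) (z : E d) :
    φ (argmin φ) ≤ φ z :=
  Classical.epsilon_spec h z

/-- A finite convex function is bounded below by a function of linear growth. -/
theorem exists_linear_lower_bound {d : ℕ} {φ : E d → ℝ} (hφ : ConvexOn ℝ Set.univ φ) :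
    ∃ M : ℝ, 0 ≤ M ∧ ∀ u, -M * (1 + ‖u‖) ≤ φ u := by
  have hc : Continuous φ := hφ.locallyLipschitz.continuous
  obtain ⟨M, hM⟩ := (isCompact_closedBall (0 : E d) 1).exists_bound_of_continuousOn hc.continuousOn
  have hM0 := (norm_nonneg _).trans (hM 0 (by simp))
  refine ⟨2 * M, by linarith, fun u => ?_⟩
  have h0 := abs_le.1 (hM 0 (by simp))
  rcases le_or_gt ‖u‖ 1 with hu | hu
  · have := abs_le.1 (hM u (by simpa using hu))
    nlinarith [norm_nonneg u]
  · have hpos : 0 < ‖u‖ := by linarith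
    have hb := abs_le.1 (hM (‖u‖⁻¹ • u) (by
      simp [norm_smul, inv_mul_cancel₀ hpos.ne']))
    have := ConvexOn.segment_le hφ 0 u (t := ‖u‖⁻¹) (by positivity) (inv_le_one_of_one_le₀ hu.le)
    rw [zero_add, zero_add] at this
    have h2 : ‖u‖ * φ (‖u‖⁻¹ • u) ≤ ‖u‖ * (φ 0 + ‖u‖⁻¹ * (φ u - φ 0)) :=
      mul_le_mul_of_nonneg_left this hpos.le
    have h3 : ‖u‖ * (φ 0 + ‖u‖⁻¹ * (φ u - φ 0)) = ‖u‖ * φ 0 + (φ u - φ 0) := by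
      field_simp
    nlinarith

theorem prox_le {d : ℕ} {φ : E d → ℝ} (hφ : ConvexOn ℝ Set.univ φ) (x u : E d) :
    φ (prox φ x) + ‖prox φ x - x‖ ^ 2 / 2 ≤ φ u + ‖u - x‖ ^ 2 / 2 := by
  refine argmin_spec (φ := fun u => φ u + ‖u - x‖ ^ 2 / 2) ?_ u
  have hc : Continuous φ := hφ.locallyLipschitz.continuous
  refine Continuous.exists_forall_le (by fun_prop) ?_
  obtain ⟨M, hM0, hM⟩ := exists_linear_lower_bound hφ
  have hq : Filter.Tendsto (fun u : E d => (‖u‖ - ‖x‖ - M) ^ 2 / 2)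
      (Filter.cocompact _) Filter.atTop := by
    have h1 : Filter.Tendsto (fun u : E d => ‖u‖ - ‖x‖ - M) (Filter.cocompact _)
        Filter.atTop := by
      simp only [sub_eq_add_neg]
      exact Filter.tendsto_atTop_add_const_right _ _ (Filter.tendsto_atTop_add_const_right _ _
        (tendsto_norm_cocompact_atTop (E := E d)))
    exact ((Filter.tendsto_pow_atTop two_ne_zero).comp h1).atTop_div_const two_pos
  refine Filter.tendsto_atTop_mono (fun u => ?_)
    (Filter.tendsto_atTop_add_const_right _ (-(M ^ 2 / 2 + M * ‖x‖ + M)) hq)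
  have h1 := hM u
  have h2 : (‖u‖ - ‖x‖) ^ 2 ≤ ‖u - x‖ ^ 2 :=
    sq_le_sq' (by linarith [neg_le_of_abs_le (abs_norm_sub_norm_le u x)])
      (le_of_abs_le (abs_norm_sub_norm_le u x))
  nlinarith

/-- The residual `x - prox φ x` is a subgradient of `φ` at `prox φ x`. -/
theorem prox_variational {d : ℕ} {φ : E d → ℝ} (hφ : ConvexOn ℝ Set.univ φ) (x u : E d) :
    inner ℝ (x - prox φ x) (u - prox φ x) ≤ φ u - φ (prox φ x) := by
  set p := prox φ x with hp
  refine le_of_forall_small_mul (c := ‖u - p‖ ^ 2 / 2) fun t h0 h1 => ?_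
  have hm := prox_le hφ x (p + t • (u - p))
  rw [← hp] at hm
  have hs := ConvexOn.segment_le hφ p (u - p) h0.le h1
  rw [add_sub_cancel] at hs
  have e : ‖p + t • (u - p) - x‖ ^ 2 =
      ‖p - x‖ ^ 2 - 2 * (t * inner ℝ (x - p) (u - p)) + t ^ 2 * ‖u - p‖ ^ 2 := by
    have : p + t • (u - p) - x = t • (u - p) - (x - p) := by abel
    rw [this, norm_sub_sq_real, real_inner_smul_left, norm_smul, Real.norm_of_nonneg h0.le,
      norm_sub_rev x p, real_inner_comm]
    ring
  rw [e] at hm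
  have : t * inner ℝ (x - p) (u - p) ≤ t * (φ u - φ p + t * (‖u - p‖ ^ 2 / 2)) := by nlinarith
  exact le_of_mul_le_mul_left this h0

theorem prox_nonexpansive {d : ℕ} {φ : E d → ℝ} (hφ : ConvexOn ℝ Set.univ φ) (x x' : E d) :
    ‖prox φ x - prox φ x'‖ ≤ ‖x - x'‖ := by
  have h1 := prox_variational hφ x (prox φ x')
  have h2 := prox_variational hφ x' (prox φ x)
  set p := prox φ x
  set p' := prox φ x'
  have h3 : ‖p - p'‖ ^ 2 ≤ inner ℝ (x - x') (p - p') := by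
    have e : inner ℝ (x - p) (p' - p) = - inner ℝ (x - p) (p - p') := by
      rw [← inner_neg_right, neg_sub]
    rw [e] at h1
    have e2 : inner ℝ (x - x') (p - p') - ‖p - p'‖ ^ 2 =
        inner ℝ (x - p) (p - p') - inner ℝ (x' - p') (p - p') := by
      rw [← real_inner_self_eq_norm_sq, ← inner_sub_left, ← inner_sub_left]; congr 1; abel
    linarith
  have h4 := h3.trans (real_inner_le_norm _ _)
  by_contra! hlt
  nlinarith [norm_nonneg (x - x'), norm_nonneg (p - p')]

namespace InverseProblem

variable {dx dy : ℕ} {P : InverseProblem dx dy} {L : ℝ}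

theorem ConvexModel.convex_scaled_R (hP : P.ConvexModel L) :
    ConvexOn ℝ Set.univ fun u => P.γ * P.R u := by
  simpa [smul_eq_mul] using hP.convex_R.smul hP.step_pos.le

theorem ConvexModel.gradStep_nonexpansive (hP : P.ConvexModel L) (y : E dy) (x x' : E dx) :
    ‖P.gradStep y x - P.gradStep y x'‖ ≤ ‖x - x'‖ :=
  ConvexOn.gradient_step_nonexpansive (hP.convex_f y) (hP.differentiable_f y)
    (hP.lipschitz_grad y) hP.step_pos hP.step_le x x'

theorem ConvexModel.g_le (hP : P.ConvexModel L) (y : E dy) (x : E dx) :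
    P.f y (P.g y) + P.R (P.g y) ≤ P.f y x + P.R x :=
  argmin_spec (φ := fun x => P.f y x + P.R x) (hP.unique_g y).exists x

/-- At a minimizer of `f(y | ·) + R`, the gradient of `f(y | ·)` is minus a subgradient of `R`, and
is thus bounded in terms of `R` and of the norm of the minimizer only. -/
theorem ConvexModel.exists_gradient_bound (hP : P.ConvexModel L) (r : ℝ) :
    ∃ M : ℝ, 0 ≤ M ∧ ∀ y, ‖P.g y‖ ≤ r → ‖gradient (P.f y) (P.g y)‖ ≤ M := by
  have hc : Continuous P.R := hP.convex_R.locallyLipschitz.continuous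
  obtain ⟨M, hM⟩ := (isCompact_closedBall (0 : E dx) (r + 1)).exists_bound_of_continuousOn
    hc.continuousOn
  refine ⟨2 * |M|, by positivity, fun y hy => ?_⟩
  set a := P.g y
  set w := gradient (P.f y) a with hw
  rcases eq_or_ne w 0 with h0 | h0
  · rw [h0, norm_zero]; positivity
  have hwpos : 0 < ‖w‖ := norm_pos_iff.2 h0
  set v : E dx := -(‖w‖⁻¹ • w) with hv
  have hvn : ‖v‖ = 1 := by rw [hv, norm_neg, norm_smul]; simp [hwpos.ne']
  have ha := abs_le.1 (hM a (by simp; linarith))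
  have hav := abs_le.1 (hM (a + v) (by
    have := norm_add_le a v
    simp; linarith))
  have hn : DifferentiableAt ℝ (fun x => -P.f y x) a := (hP.differentiable_f y a).neg
  have key := inner_gradient_le_of_segment (φ := fun x => -P.f y x) (v := v) (m := 2 * M) hn
    fun t h0 h1 => by
      have h2 := hP.g_le y (a + t • v)
      have h3 := ConvexOn.segment_le hP.convex_R a v h0.le h1
      have : t * (P.R (a + v) - P.R a) ≤ t * (2 * M) :=
        mul_le_mul_of_nonneg_left (by linarith) h0.le
      change -P.f y (a + t • v) ≤ -P.f y a + t * (2 * M)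
      change P.f y a + P.R a ≤ _ at h2
      linarith
  rw [inner_gradient_left, fderiv_fun_neg, neg_apply, ← inner_gradient_left,
    ← hw, hv, inner_neg_right, neg_neg, real_inner_smul_right, real_inner_self_eq_norm_sq] at key
  have e : ‖w‖⁻¹ * ‖w‖ ^ 2 = ‖w‖ := by field_simp
  rw [e] at key
  linarith [le_abs_self M]

theorem ConvexModel.proxStep_nonexpansive (hP : P.ConvexModel L) (y : E dy) (x x' : E dx) :
    ‖P.proxStep y x - P.proxStep y x'‖ ≤ ‖x - x'‖ :=
  (prox_nonexpansive hP.convex_scaled_R _ _).trans (hP.gradStep_nonexpansive y x x')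

end InverseProblem

/-! ### Lipschitz bounds for networks and their unrollings -/

theorem norm_toLp_le_sum {m : ℕ} (v : Fin m → ℝ) :
    ‖(WithLp.toLp 2 v : E m)‖ ≤ ∑ i, |v i| := by
  rw [EuclideanSpace.norm_eq]
  refine Real.sqrt_le_iff.2 ⟨by positivity, ?_⟩
  simpa using Finset.sum_sq_le_sq_sum_of_nonneg (s := Finset.univ) (f := fun i => |v i|)
    (fun i _ => abs_nonneg _)

theorem abs_apply_le_norm {m : ℕ} (v : E m) (i : Fin m) : |v i| ≤ ‖v‖ := by
  simpa using PiLp.norm_apply_le v i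

theorem norm_mulVec_le {m p : ℕ} (A : Matrix (Fin m) (Fin p) ℝ) (z : E p) {b : ℝ}
    (hA : ∀ i j, |A i j| ≤ b) :
    ‖(WithLp.toLp 2 (A.mulVec z) : E m)‖ ≤ ((m * p : ℕ) : ℝ) * b * ‖z‖ := by
  refine (norm_toLp_le_sum _).trans ?_
  have h : ∀ i, |A.mulVec z i| ≤ p * b * ‖z‖ := fun i => by
    simp only [Matrix.mulVec, dotProduct]
    refine (Finset.abs_sum_le_sum_abs _ _).trans ?_
    refine (Finset.sum_le_sum (g := fun _ => b * ‖z‖) fun j _ => ?_).trans (by simp [mul_assoc])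
    rw [abs_mul]
    exact mul_le_mul (hA i j) (abs_apply_le_norm z j) (abs_nonneg _)
      ((abs_nonneg _).trans (hA i j))
  refine (Finset.sum_le_sum fun i _ => h i).trans ?_
  simp [mul_assoc]

theorem norm_toLp_cast {m p : ℕ} (h : m = p) (x : E p) :
    ‖(WithLp.toLp 2 fun i => x (Fin.cast h i) : E m)‖ = ‖x‖ := by
  subst h; rfl

namespace Network

variable {d : ℕ} (𝒩 : Network d)

theorem width_mul_width_le_numParams {ℓ : ℕ} (h : ℓ < 𝒩.depth) :
    𝒩.width (ℓ + 1) * 𝒩.width ℓ ≤ 𝒩.numParams :=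
  Finset.single_le_sum (f := fun ℓ => 𝒩.width (ℓ + 1) * 𝒩.width ℓ) (fun _ _ => Nat.zero_le _)
    (Finset.mem_range.2 h)

theorem card_idx : Fintype.card 𝒩.Idx = 𝒩.numParams := by
  rw [Fintype.card_sigma, numParams, Finset.sum_range]
  simp

theorem layer_succ (W : 𝒩.Param) (x : E d) {ℓ : ℕ} (h : ℓ < 𝒩.depth) :
    𝒩.layer W x (ℓ + 1) =
      𝒩.act (ℓ + 1) (WithLp.toLp 2 ((𝒩.weight W ⟨ℓ, h⟩).mulVec (𝒩.layer W x ℓ))) := by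
  simp only [layer, h, dif_pos]

variable {𝒩}

theorem norm_weight_mulVec_le {W : 𝒩.Param} {b : ℝ} (hb : 0 ≤ b) (hW : ∀ k, |W k| ≤ b) {ℓ : ℕ}
    (h : ℓ < 𝒩.depth) (z : E (𝒩.width ℓ)) :
    ‖(WithLp.toLp 2 ((𝒩.weight W ⟨ℓ, h⟩).mulVec z) : E (𝒩.width (ℓ + 1)))‖ ≤
      𝒩.numParams * b * ‖z‖ := by
  refine (norm_mulVec_le (𝒩.weight W ⟨ℓ, h⟩) z (b := b) fun i j => hW _).trans ?_
  gcongr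
  exact_mod_cast 𝒩.width_mul_width_le_numParams h

theorem norm_layer_le {W : 𝒩.Param} {b : ℝ} (hb : 0 ≤ b) (hW : ∀ k, |W k| ≤ b) (x : E d) :
    ∀ ℓ ≤ 𝒩.depth, ‖𝒩.layer W x ℓ‖ ≤ (𝒩.numParams * b) ^ ℓ * ‖x‖
  | 0, _ => by simp only [layer, pow_zero, one_mul]; exact (norm_toLp_cast 𝒩.width_zero x).le
  | ℓ + 1, h => by
    rw [layer_succ _ _ _ h]
    have h1 := 𝒩.act_lipschitz (ℓ + 1)
      (WithLp.toLp 2 ((𝒩.weight W ⟨ℓ, h⟩).mulVec (𝒩.layer W x ℓ))) 0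
    rw [𝒩.act_zero, sub_zero, sub_zero] at h1
    refine h1.trans ((norm_weight_mulVec_le hb hW h _).trans ?_)
    rw [pow_succ', mul_assoc (_ * b)]
    gcongr
    exact norm_layer_le hb hW x ℓ (by omega)

theorem norm_layer_sub_le {W W' : 𝒩.Param} {b η : ℝ} (hb : 1 ≤ b) (hη : 0 ≤ η)
    (hW : ∀ k, |W k| ≤ b) (hW' : ∀ k, |W' k| ≤ b) (hWW' : ∀ k, |W k - W' k| ≤ η) (x x' : E d) :
    ∀ ℓ ≤ 𝒩.depth, ‖𝒩.layer W x ℓ - 𝒩.layer W' x' ℓ‖ ≤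
      (𝒩.numParams * b) ^ ℓ * (‖x - x'‖ + ℓ * η * ‖x'‖)
  | 0, _ => by
    have := (norm_toLp_cast 𝒩.width_zero (x - x')).le
    simp only [pow_zero, one_mul, Nat.cast_zero, zero_mul, add_zero]
    exact this
  | ℓ + 1, h => by
    have hb0 : 0 ≤ b := zero_le_one.trans hb
    rw [layer_succ _ _ _ h, layer_succ _ _ _ h]
    refine (𝒩.act_lipschitz _ _ _).trans ?_
    have e : (WithLp.toLp 2 ((𝒩.weight W ⟨ℓ, h⟩).mulVec (𝒩.layer W x ℓ)) -
        WithLp.toLp 2 ((𝒩.weight W' ⟨ℓ, h⟩).mulVec (𝒩.layer W' x' ℓ)) : E (𝒩.width (ℓ + 1))) =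
        WithLp.toLp 2 ((𝒩.weight W ⟨ℓ, h⟩).mulVec (𝒩.layer W x ℓ - 𝒩.layer W' x' ℓ : E _)) +
        WithLp.toLp 2 ((𝒩.weight (W - W') ⟨ℓ, h⟩).mulVec (𝒩.layer W' x' ℓ)) := by
      have ew : 𝒩.weight (W - W') ⟨ℓ, h⟩ = 𝒩.weight W ⟨ℓ, h⟩ - 𝒩.weight W' ⟨ℓ, h⟩ := rfl
      rw [ew, Matrix.sub_mulVec, WithLp.ofLp_sub, Matrix.mulVec_sub, ← WithLp.toLp_sub,
        ← WithLp.toLp_add]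
      congr 1; abel
    rw [e]
    refine (norm_add_le _ _).trans ?_
    have h1 := norm_weight_mulVec_le hb0 hW h (𝒩.layer W x ℓ - 𝒩.layer W' x' ℓ)
    have h2 := norm_weight_mulVec_le (W := W - W') hη (fun k => hWW' k) h (𝒩.layer W' x' ℓ)
    have h3 := norm_layer_sub_le hb hη hW hW' hWW' x x' ℓ (by omega)
    have h4 := norm_layer_le hb0 hW' x' ℓ (by omega)
    set q : ℝ := (𝒩.numParams : ℝ) with hq
    have hq0 : 0 ≤ q := Nat.cast_nonneg _
    calc _ ≤ q * b * ((q * b) ^ ℓ * (‖x - x'‖ + ℓ * η * ‖x'‖)) +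
          q * b * η * ((q * b) ^ ℓ * ‖x'‖) := by
          refine add_le_add (h1.trans ?_) (h2.trans ?_)
          · gcongr
          · have : q * η ≤ q * b * η := by
              refine mul_le_mul_of_nonneg_right ?_ hη
              nlinarith
            gcongr
      _ = _ := by push_cast; ring

theorem norm_eval_le {W : 𝒩.Param} {b : ℝ} (hb : 0 ≤ b) (hW : ∀ k, |W k| ≤ b) (x : E d) :
    ‖𝒩.eval W x‖ ≤ (𝒩.numParams * b) ^ 𝒩.depth * ‖x‖ :=
  (norm_toLp_cast 𝒩.width_depth.symm _).le.trans (norm_layer_le hb hW x _ le_rfl)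

/-- Networks are Lipschitz in the input and in the parameters. -/
theorem norm_eval_sub_le {W W' : 𝒩.Param} {b η : ℝ} (hb : 1 ≤ b) (hη : 0 ≤ η)
    (hW : ∀ k, |W k| ≤ b) (hW' : ∀ k, |W' k| ≤ b) (hWW' : ∀ k, |W k - W' k| ≤ η) (x x' : E d) :
    ‖𝒩.eval W x - 𝒩.eval W' x'‖ ≤
      (𝒩.numParams * b) ^ 𝒩.depth * (‖x - x'‖ + 𝒩.depth * η * ‖x'‖) :=
  (norm_toLp_cast 𝒩.width_depth.symm
    (𝒩.layer W x 𝒩.depth - 𝒩.layer W' x' 𝒩.depth)).le.trans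
      (norm_layer_sub_le hb hη hW hW' hWW' x x' _ le_rfl)

section Gdn

variable {dy : ℕ} {P : InverseProblem d dy} {L : ℝ}

theorem gdn_succ (T : ℕ) (W : 𝒩.Param) (y : E dy) :
    𝒩.gdn P (T + 1) W y = 𝒩.eval W (P.gradStep y (𝒩.gdn P T W y)) := by
  rw [gdn, Function.iterate_succ_apply']; rfl

/-- Unrolled networks are Lipschitz in the parameters. The constant is exponential in the unrolling
depth and in the depth of the network, since nothing is known on the stability of the iterates for
general parameters. -/
theorem norm_gdn_sub_le (hP : P.ConvexModel L) {W W' : 𝒩.Param} {b η c : ℝ} (hb : 1 ≤ b)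
    (hη : 0 ≤ η) (hq : 1 ≤ 𝒩.numParams)
    (hW : ∀ k, |W k| ≤ b) (hW' : ∀ k, |W' k| ≤ b) (hWW' : ∀ k, |W k - W' k| ≤ η) {y : E dy}
    (hc : ‖P.gradStep y 0‖ ≤ c) (T : ℕ) :
    ‖𝒩.gdn P T W y - 𝒩.gdn P T W' y‖ ≤
      T * 𝒩.depth * η * (2 * (𝒩.numParams * b) ^ 𝒩.depth) ^ T * (‖P.x₀‖ + c) := by
  set M : ℝ := (𝒩.numParams * b) ^ 𝒩.depth with hM
  have hq' : (1 : ℝ) ≤ 𝒩.numParams := by exact_mod_cast hq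
  have hM1 : 1 ≤ M := one_le_pow₀ (by nlinarith)
  have hc0 : 0 ≤ c := (norm_nonneg _).trans hc
  have hb0 : 0 ≤ b := by linarith
  have hG : ∀ x, ‖P.gradStep y x‖ ≤ ‖x‖ + c := fun x => by
    have h1 := hP.gradStep_nonexpansive y x 0
    have h2 := norm_add_le (P.gradStep y x - P.gradStep y 0) (P.gradStep y 0)
    rw [sub_add_cancel] at h2
    rw [sub_zero] at h1
    linarith
  have hz : ∀ t, ‖𝒩.gdn P t W' y‖ + c ≤ (2 * M) ^ t * (‖P.x₀‖ + c) := by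
    intro t
    induction t with
    | zero => simp [gdn]
    | succ t ih =>
      rw [gdn_succ]
      have h1 := norm_eval_le hb0 hW' (P.gradStep y (𝒩.gdn P t W' y))
      rw [← hM] at h1
      have h2 := hG (𝒩.gdn P t W' y)
      have h3 := norm_nonneg (𝒩.gdn P t W' y)
      calc _ ≤ M * (‖𝒩.gdn P t W' y‖ + c) + M * (‖𝒩.gdn P t W' y‖ + c) := by
            refine add_le_add (h1.trans (by gcongr)) ?_
            nlinarith
        _ = 2 * M * (‖𝒩.gdn P t W' y‖ + c) := by ring
        _ ≤ 2 * M * ((2 * M) ^ t * (‖P.x₀‖ + c)) := by gcongr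
        _ = _ := by ring
  induction T with
  | zero => simp [gdn]
  | succ t ih =>
    rw [gdn_succ, gdn_succ]
    refine (norm_eval_sub_le hb hη hW hW' hWW' _ _).trans ?_
    rw [← hM]
    have h1 := hP.gradStep_nonexpansive y (𝒩.gdn P t W y) (𝒩.gdn P t W' y)
    have h2 := (hG (𝒩.gdn P t W' y)).trans (hz t)
    have hx : 0 ≤ ‖P.x₀‖ + c := by positivity
    calc _ ≤ M * (t * 𝒩.depth * η * (2 * M) ^ t * (‖P.x₀‖ + c) +
          𝒩.depth * η * ((2 * M) ^ t * (‖P.x₀‖ + c))) := by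
          gcongr
          exact h1.trans ih
      _ = M * ((t + 1) * 𝒩.depth * η * (2 * M) ^ t * (‖P.x₀‖ + c)) := by ring
      _ ≤ 2 * M * ((t + 1) * 𝒩.depth * η * (2 * M) ^ t * (‖P.x₀‖ + c)) := by
          gcongr; linarith
      _ = _ := by push_cast; ring

/-- Unrolling an `ε`-approximation of the proximal map costs an error `T ε`, since the proximal
gradient map is non-expansive. -/
theorem norm_gdn_sub_proxStep_le (hP : P.ConvexModel L) {W : 𝒩.Param} {ε : ℝ}
    (hW : ∀ x, ‖𝒩.eval W x - prox (fun u => P.γ * P.R u) x‖ ≤ ε) (y : E dy) (T : ℕ) :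
    ‖𝒩.gdn P T W y - (P.proxStep y)^[T] P.x₀‖ ≤ T * ε := by
  induction T with
  | zero => simp [gdn]
  | succ t ih =>
    rw [gdn_succ, Function.iterate_succ_apply']
    have h1 := hW (P.gradStep y (𝒩.gdn P t W y))
    have h2 := hP.proxStep_nonexpansive y (𝒩.gdn P t W y) ((P.proxStep y)^[t] P.x₀)
    have h3 := norm_add_le
      (𝒩.eval W (P.gradStep y (𝒩.gdn P t W y)) - P.proxStep y (𝒩.gdn P t W y))
      (P.proxStep y (𝒩.gdn P t W y) - P.proxStep y ((P.proxStep y)^[t] P.x₀))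
    rw [sub_add_sub_cancel] at h3
    change ‖𝒩.eval W (P.gradStep y (𝒩.gdn P t W y)) - P.proxStep y (𝒩.gdn P t W y)‖ ≤ ε at h1
    push_cast
    linarith

/-- The gradient steps from `0` are bounded uniformly over all the designs allowed by the
convergence and stability assumptions: these bound `g(y)`, hence the gradient at `g(y)`. -/
theorem exists_gradStep_bound (hP : P.ConvexModel L) (R₀ R₁ : ℝ) :
    ∃ c : ℝ, 0 ≤ c ∧ ∀ (𝒩 : Network d) (W : 𝒩.Param) (ε : ℝ), ε ≤ 1 →
      (∀ x, ‖𝒩.eval W x - prox (fun u => P.γ * P.R u) x‖ ≤ ε) →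
      ∀ (n : ℕ) (y : Fin n → E dy) (ϱ : ℝ), 0 ≤ ϱ → ϱ < 1 → P.LinearRate R₀ ϱ y →
        𝒩.StableIterates P W R₁ y → ∀ i, ‖P.gradStep (y i) 0‖ ≤ c := by
  set r : ℝ := |R₀| + |R₁| + 1 with hr
  obtain ⟨M, hM0, hM⟩ := hP.exists_gradient_bound r
  refine ⟨2 * r + P.γ * M, by have := hP.step_pos; positivity, ?_⟩
  intro 𝒩 W ε hε hW n y ϱ h0 h1 hlin hstab i
  have a1 := hlin 1 le_rfl i
  have a2 := hstab 1 le_rfl i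
  have a3 := norm_gdn_sub_proxStep_le hP hW (y i) 1
  simp only [Function.iterate_one, pow_one, gdn, Nat.cast_one, one_mul] at a1 a2 a3
  have a4 : R₀ * ϱ ≤ |R₀| := by nlinarith [le_abs_self R₀, abs_nonneg R₀]
  have a5 : ‖P.g (y i)‖ ≤ r := by
    have b1 := norm_sub_rev (P.proxStep (y i) P.x₀) (P.g (y i))
    have b2 := norm_sub_rev (P.proxStep (y i) P.x₀) (𝒩.step P W (y i) P.x₀)
    have b3 := norm_add_le (P.g (y i) - P.proxStep (y i) P.x₀) (P.proxStep (y i) P.x₀)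
    have b4 := norm_add_le (P.proxStep (y i) P.x₀ - 𝒩.step P W (y i) P.x₀)
      (𝒩.step P W (y i) P.x₀)
    rw [sub_add_cancel] at b3 b4
    linarith [le_abs_self R₁]
  have a6 := hM _ a5
  have a7 := hP.gradStep_nonexpansive (y i) 0 (P.g (y i))
  rw [zero_sub, norm_neg] at a7
  have a8 : ‖P.gradStep (y i) (P.g (y i))‖ ≤ r + P.γ * M := by
    refine (norm_sub_le _ _).trans (add_le_add a5 ?_)
    rw [norm_smul, Real.norm_of_nonneg hP.step_pos.le]
    exact mul_le_mul_of_nonneg_left a6 hP.step_pos.le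
  have a9 := norm_add_le (P.gradStep (y i) 0 - P.gradStep (y i) (P.g (y i)))
    (P.gradStep (y i) (P.g (y i)))
  rw [sub_add_cancel] at a9
  linarith

end Gdn

/-! ### Measurability -/

theorem continuous_layer (ℓ : ℕ) (hℓ : ℓ ≤ 𝒩.depth) :
    Continuous fun p : 𝒩.Param × E d => 𝒩.layer p.1 p.2 ℓ := by
  induction ℓ with
  | zero =>
    simp only [layer]
    fun_prop
  | succ ℓ ih =>
    have h : ℓ < 𝒩.depth := hℓ
    have hact : Continuous (𝒩.act (ℓ + 1)) :=
      (LipschitzWith.of_dist_le_mul (K := 1) fun z z' => by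
        simpa [dist_eq_norm] using 𝒩.act_lipschitz (ℓ + 1) z z').continuous
    have e : (fun p : 𝒩.Param × E d => 𝒩.layer p.1 p.2 (ℓ + 1)) = fun p =>
        𝒩.act (ℓ + 1) (WithLp.toLp 2 ((𝒩.weight p.1 ⟨ℓ, h⟩).mulVec (𝒩.layer p.1 p.2 ℓ))) :=
      funext fun p => 𝒩.layer_succ p.1 p.2 h
    rw [e]
    have ih' := ih h.le
    refine hact.comp ?_
    refine (PiLp.continuous_toLp 2 _).comp (Continuous.matrix_mulVec ?_ ?_)
    · exact continuous_matrix fun i j =>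
        (continuous_apply (⟨⟨ℓ, h⟩, i, j⟩ : 𝒩.Idx)).comp continuous_fst
    · exact (PiLp.continuous_ofLp 2 _).comp ih'

theorem continuous_eval : Continuous fun p : 𝒩.Param × E d => 𝒩.eval p.1 p.2 := by
  have := continuous_layer (𝒩 := 𝒩) 𝒩.depth le_rfl
  unfold eval
  fun_prop

theorem measurable_gradient {dy : ℕ} {f : E dy → E d → ℝ} (hf : Measurable (Function.uncurry f))
    (hd : ∀ y, Differentiable ℝ (f y)) :
    Measurable fun p : E dy × E d => gradient (f p.1) p.2 := by
  have hcoord : ∀ i : Fin d, Measurable fun p : E dy × E d =>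
      fderiv ℝ (f p.1) p.2 (EuclideanSpace.single i 1) := by
    intro i
    -- the partial derivatives are limits of difference quotients
    refine measurable_of_tendsto_metrizable (f := fun (k : ℕ) (p : E dy × E d) =>
      ((k : ℝ) + 1) * (f p.1 (p.2 + ((k : ℝ) + 1)⁻¹ • EuclideanSpace.single i 1) - f p.1 p.2))
      (fun k => ?_) ?_
    · refine Measurable.const_mul (Measurable.sub ?_ hf) _
      exact hf.comp (measurable_fst.prodMk (measurable_snd.add_const _))
    · rw [tendsto_pi_nhds]
      intro p
      have h1 := ((hd p.1) p.2).hasFDerivAt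
      have h2 : Filter.Tendsto (fun k : ℕ => ((k : ℝ) + 1)) Filter.atTop Filter.atTop :=
        Filter.tendsto_atTop_add_const_right _ _ tendsto_natCast_atTop_atTop
      have h3 := h1.lim (EuclideanSpace.single i (1 : ℝ)) (l := Filter.atTop)
        (c := fun k : ℕ => ((k : ℝ) + 1))
        (tendsto_norm_atTop_atTop.comp h2)
      simpa using h3
  have e : (fun p : E dy × E d => gradient (f p.1) p.2) = fun p =>
      WithLp.toLp 2 fun i => fderiv ℝ (f p.1) p.2 (EuclideanSpace.single i 1) := by
    funext p
    ext i
    have h1 : inner ℝ (gradient (f p.1) p.2) (EuclideanSpace.single i 1) =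
        gradient (f p.1) p.2 i := by
      rw [EuclideanSpace.inner_single_right]; simp
    rw [← h1, inner_gradient_left]
  rw [e]
  exact (WithLp.measurable_toLp 2 _).comp (measurable_pi_lambda _ hcoord)

theorem measurable_gdn {dy : ℕ} {P : InverseProblem d dy} (hf : Measurable (Function.uncurry P.f))
    (hd : ∀ y, Differentiable ℝ (P.f y)) (T : ℕ) :
    Measurable fun p : 𝒩.Param × E dy => 𝒩.gdn P T p.1 p.2 := by
  induction T with
  | zero => simp only [gdn, Function.iterate_zero, id]; exact measurable_const
  | succ T ih =>
    simp only [gdn_succ]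
    have h1 : Measurable fun p : 𝒩.Param × E dy => P.gradStep p.2 (𝒩.gdn P T p.1 p.2) :=
      ih.sub (((measurable_gradient hf hd).comp (measurable_snd.prodMk ih)).const_smul P.γ)
    exact continuous_eval.measurable.comp (measurable_fst.prodMk h1)

end Network

/-! ### The law of the sample -/

/-- Tonelli's theorem for a product of functions of one coordinate each, on `Fin n`. -/
theorem lintegral_fin_prod_eq_prod {n : ℕ} {X : Fin n → Type*} [∀ i, MeasurableSpace (X i)]
    (μ : (i : Fin n) → Measure (X i)) [∀ i, SigmaFinite (μ i)] (f : (i : Fin n) → X i → ℝ≥0∞)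
    (hf : ∀ i, Measurable (f i)) :
    ∫⁻ x, ∏ i, f i (x i) ∂(Measure.pi μ) = ∏ i, ∫⁻ x, f i x ∂(μ i) := by
  induction n with
  | zero => simp
  | succ n ih =>
    have hm := (measurePreserving_piFinSuccAbove μ 0).symm
    rw [← hm.lintegral_comp_emb (MeasurableEquiv.measurableEmbedding _)]
    simp_rw [MeasurableEquiv.piFinSuccAbove_symm_apply, Fin.insertNthEquiv, Fin.prod_univ_succ,
      Fin.insertNth_zero, Equiv.coe_fn_mk, Fin.cons_succ, Fin.cons_zero]
    have h2 := ih (fun i => μ i.succ) (fun i => f i.succ) (fun i => hf _)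
    rw [← h2]
    refine lintegral_prod_mul (μ := μ 0) (ν := Measure.pi fun i => μ (Fin.succ i)) (f := f 0)
      (g := fun x => ∏ i, f (Fin.succ i) (x i)) (hf 0).aemeasurable (Measurable.aemeasurable ?_)
    exact Finset.measurable_prod _ fun i _ => (hf i.succ).comp (measurable_pi_apply i)

theorem lintegral_fintype_prod_eq_prod {ι : Type*} [Fintype ι] {X : ι → Type*}
    [∀ i, MeasurableSpace (X i)]
    (μ : (i : ι) → Measure (X i)) [∀ i, SigmaFinite (μ i)] (f : (i : ι) → X i → ℝ≥0∞)
    (hf : ∀ i, Measurable (f i)) :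
    ∫⁻ x, ∏ i, f i (x i) ∂(Measure.pi μ) = ∏ i, ∫⁻ x, f i x ∂(μ i) := by
  let e := (Fintype.equivFin ι).symm
  rw [← (measurePreserving_piCongrLeft μ e).lintegral_comp_emb
    (MeasurableEquiv.measurableEmbedding _)]
  simp_rw [← e.prod_comp, MeasurableEquiv.coe_piCongrLeft, Equiv.piCongrLeft_apply_apply]
  exact lintegral_fin_prod_eq_prod _ _ fun i => hf _

theorem pi_withDensity {ι : Type*} [Fintype ι] {X : ι → Type*} [∀ i, MeasurableSpace (X i)]
    (μ : (i : ι) → Measure (X i)) [∀ i, SigmaFinite (μ i)] (f : (i : ι) → X i → ℝ≥0∞)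
    (hf : ∀ i, Measurable (f i)) [∀ i, SigmaFinite ((μ i).withDensity (f i))] :
    Measure.pi (fun i => (μ i).withDensity (f i)) =
      (Measure.pi μ).withDensity fun x => ∏ i, f i (x i) := by
  refine Measure.pi_eq fun s hs => ?_
  rw [withDensity_apply _ (MeasurableSet.univ_pi hs), Measure.restrict_pi_pi,
    lintegral_fintype_prod_eq_prod _ _ hf]
  exact Finset.prod_congr rfl fun i _ => (withDensity_apply _ (hs i)).symm

namespace InverseProblem

variable {dx dy : ℕ} (P : InverseProblem dx dy)

/-- The density of the joint law of `(x, y)`. -/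
noncomputable def jointDensity (z : E dx × E dy) : ℝ≥0∞ :=
  ENNReal.ofReal (Real.exp (-P.R z.1) / (∫ x, Real.exp (-P.R x)) * Real.exp (-P.f z.2 z.1))

/-- The regression function `y ↦ E[x | y]`. It agrees with `g` almost surely, and unlike `g` it is
visibly measurable. -/
noncomputable def condMean (y : E dy) : E dx := ∫ x, x ∂(P.condLaw y)

variable {P}

theorem measurable_jointDensity (hR : Measurable P.R) (hf : Measurable (Function.uncurry P.f)) :
    Measurable P.jointDensity := by
  have h : Measurable fun z : E dx × E dy => P.f z.2 z.1 := hf.comp measurable_swap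
  unfold jointDensity
  fun_prop

theorem measurable_unnormalized (hR : Measurable P.R) (hf : Measurable (Function.uncurry P.f)) :
    Measurable fun z : E dx × E dy => Real.exp (-P.R z.1 - P.f z.2 z.1) := by
  have h : Measurable fun z : E dx × E dy => P.f z.2 z.1 := hf.comp measurable_swap
  fun_prop

theorem jointLaw_eq : P.jointLaw = (volume : Measure (E dx × E dy)).withDensity P.jointDensity :=
  rfl

instance : SigmaFinite P.jointLaw := SigmaFinite.withDensity_ofReal _

theorem snd_jointLaw (hR : Measurable P.R) (hf : Measurable (Function.uncurry P.f)) :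
    P.jointLaw.snd =
      (volume : Measure (E dy)).withDensity fun y => ∫⁻ x, P.jointDensity (x, y) := by
  ext s hs
  have hp := measurable_jointDensity hR hf
  rw [Measure.snd_apply hs, jointLaw_eq, withDensity_apply _ (measurable_snd hs),
    withDensity_apply _ hs, ← lintegral_indicator (measurable_snd hs), ← lintegral_indicator hs,
    Measure.volume_eq_prod, lintegral_prod_symm' _ (hp.indicator (measurable_snd hs))]
  refine lintegral_congr fun y => ?_
  by_cases hy : y ∈ s
  · rw [Set.indicator_of_mem hy]
    exact lintegral_congr fun x => Set.indicator_of_mem (by exact hy) _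
  · rw [Set.indicator_of_notMem hy]
    refine (lintegral_congr fun x => Set.indicator_of_notMem (by exact hy) _).trans ?_
    simp

theorem ErrorModel.isProbabilityMeasure_jointLaw {σbar : ℝ} (hE : P.ErrorModel σbar)
    (hR : Measurable P.R) : IsProbabilityMeasure P.jointLaw := by
  have hp := measurable_jointDensity hR hE.measurable_f
  have hI : 0 < ∫ x, Real.exp (-P.R x) := integral_exp_pos hE.integrable_R
  constructor
  rw [jointLaw_eq, withDensity_apply _ MeasurableSet.univ, Measure.restrict_univ,
    Measure.volume_eq_prod, lintegral_prod _ hp.aemeasurable]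
  have h1 : ∀ x, ∫⁻ y, P.jointDensity (x, y) =
      ENNReal.ofReal (Real.exp (-P.R x) / ∫ x, Real.exp (-P.R x)) := fun x => by
    have hm : Measurable fun y => ENNReal.ofReal (Real.exp (-P.f y x)) := by
      have : Measurable fun y => P.f y x := hE.measurable_f.comp measurable_prodMk_right
      fun_prop
    simp only [jointDensity]
    simp_rw [ENNReal.ofReal_mul (div_nonneg (Real.exp_nonneg _) hI.le)]
    rw [lintegral_const_mul _ hm, hE.density_f, mul_one]
  simp_rw [h1]
  rw [← ofReal_integral_eq_lintegral_ofReal (hE.integrable_R.div_const _)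
    (Filter.Eventually.of_forall fun x => div_nonneg (Real.exp_nonneg _) hI.le),
    integral_div, div_self hI.ne', ENNReal.ofReal_one]

theorem measurable_condMean (hR : Measurable P.R) (hf : Measurable (Function.uncurry P.f)) :
    Measurable P.condMean := by
  have hm := measurable_unnormalized hR hf
  have e : P.condMean = fun y =>
      ((∫⁻ x, ENNReal.ofReal (Real.exp (-P.R x - P.f y x)))⁻¹).toReal •
        ∫ x, Real.exp (-P.R x - P.f y x) • x := by
    funext y
    have hy : Measurable fun x => ENNReal.ofReal (Real.exp (-P.R x - P.f y x)) :=
      (hm.comp (measurable_prodMk_right (y := y))).ennreal_ofReal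
    rw [condMean, condLaw, integral_smul_measure,
      integral_withDensity_eq_integral_toReal_smul hy (by simp)]
    simp [Real.exp_nonneg]
  rw [e]
  have h1 : Measurable fun y =>
      ((∫⁻ x, ENNReal.ofReal (Real.exp (-P.R x - P.f y x)))⁻¹).toReal :=
    (Measurable.inv (Measurable.lintegral_prod_left hm.ennreal_ofReal)).ennreal_toReal
  have h2 : Measurable fun y => ∫ x, Real.exp (-P.R x - P.f y x) • x :=
    (StronglyMeasurable.integral_prod_left (f := fun x y => Real.exp (-P.R x - P.f y x) • x)
      (hm.smul measurable_fst).stronglyMeasurable).measurable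
  exact h1.smul h2

theorem ErrorModel.condMean_eq {σbar : ℝ} (hE : P.ErrorModel σbar) (n : ℕ) :
    ∀ᵐ D ∂Measure.pi (fun _ : Fin n => P.jointLaw), ∀ i, P.g (D i).2 = P.condMean (D i).2 := by
  rw [ae_all_iff]
  intro i
  have h1 : ∀ᵐ z ∂P.jointLaw, P.g z.2 = P.condMean z.2 :=
    ae_of_ae_map measurable_snd.aemeasurable (hE.mean_eq.mono fun y hy => hy.2.symm)
  exact (Measure.quasiMeasurePreserving_eval (fun _ : Fin n => P.jointLaw) i).ae h1

/-- The conditional sub-Gaussian bound, as an inequality between unnormalized integrals that is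
meaningful for almost every `y` whether or not `y` has positive density. -/
theorem ErrorModel.lintegral_exp_inner_le {σbar : ℝ} (hE : P.ErrorModel σbar)
    (hR : Measurable P.R) :
    ∀ᵐ y : E dy, ∀ v : E dx, ∫⁻ x, P.jointDensity (x, y) *
      ENNReal.ofReal (Real.exp (inner ℝ v (x - P.condMean y) - σbar ^ 2 / 2 * ‖v‖ ^ 2)) ≤
        ∫⁻ x, P.jointDensity (x, y) := by
  have h1 := hE.subGaussian
  have hp := measurable_jointDensity hR hE.measurable_f
  rw [snd_jointLaw hR hE.measurable_f, ae_withDensity_iff hp.lintegral_prod_left'] at h1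
  filter_upwards [h1] with y hy v
  by_cases h0 : ∫⁻ x, P.jointDensity (x, y) = 0
  · have hpy : Measurable fun x => P.jointDensity (x, y) := hp.comp measurable_prodMk_right
    rw [h0, nonpos_iff_eq_zero]
    rw [lintegral_eq_zero_iff hpy] at h0
    rw [lintegral_congr_ae (g := fun _ => 0) (h0.mono fun x hx => by
      simp only [Pi.zero_apply] at hx
      simp [hx])]
    simp
  have hI : 0 < ∫ x, Real.exp (-P.R x) := integral_exp_pos hE.integrable_R
  set c := ENNReal.ofReal (1 / ∫ x, Real.exp (-P.R x)) with hc
  have hc0 : c ≠ 0 := by rw [hc]; simpa using hI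
  have hct : c ≠ ∞ := ENNReal.ofReal_ne_top
  have hpe : ∀ x, P.jointDensity (x, y) =
      c * ENNReal.ofReal (Real.exp (-P.R x - P.f y x)) := fun x => by
    rw [hc, ← ENNReal.ofReal_mul (by positivity), jointDensity, sub_eq_add_neg, Real.exp_add]
    congr 1; ring
  have hm : Measurable fun x => ENNReal.ofReal (Real.exp (-P.R x - P.f y x)) :=
    ((measurable_unnormalized hR hE.measurable_f).comp
      (measurable_prodMk_right (y := y))).ennreal_ofReal
  have hm2 : Measurable fun x : E dx =>
      ENNReal.ofReal (Real.exp (inner ℝ v (x - P.condMean y))) := by fun_prop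
  have hv := hy h0 v
  simp_rw [hpe] at h0 ⊢
  rw [lintegral_const_mul _ hm] at h0 ⊢
  set J := ∫⁻ x, ENNReal.ofReal (Real.exp (-P.R x - P.f y x)) with hJ
  have hJ0 : J ≠ 0 := fun h => h0 (by rw [h, mul_zero])
  by_cases hJt : J = ∞
  · rw [hJt, ENNReal.mul_top hc0]; exact le_top
  have e : ∀ x : E dx, c * ENNReal.ofReal (Real.exp (-P.R x - P.f y x)) *
      ENNReal.ofReal (Real.exp (inner ℝ v (x - P.condMean y) - σbar ^ 2 / 2 * ‖v‖ ^ 2)) =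
      c * ENNReal.ofReal (Real.exp (-(σbar ^ 2 / 2 * ‖v‖ ^ 2))) *
      (ENNReal.ofReal (Real.exp (-P.R x - P.f y x)) *
        ENNReal.ofReal (Real.exp (inner ℝ v (x - P.condMean y)))) := fun x => by
    rw [sub_eq_add_neg (inner ℝ v _), Real.exp_add, ENNReal.ofReal_mul (Real.exp_nonneg _)]
    ring
  simp_rw [e]
  have hmm : Measurable fun x => ENNReal.ofReal (Real.exp (-P.R x - P.f y x)) *
      ENNReal.ofReal (Real.exp (inner ℝ v (x - P.condMean y))) := hm.mul hm2
  rw [lintegral_const_mul _ hmm]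
  change ∫⁻ z, ENNReal.ofReal (Real.exp (inner ℝ v (z - P.condMean y))) ∂(P.condLaw y) ≤ _ at hv
  rw [condLaw, lintegral_smul_measure, lintegral_withDensity_eq_lintegral_mul _ hm hm2,
    smul_eq_mul] at hv
  change J⁻¹ * ∫⁻ x, ENNReal.ofReal (Real.exp (-P.R x - P.f y x)) *
        ENNReal.ofReal (Real.exp (inner ℝ v (x - P.condMean y))) ≤ _ at hv
  rw [ENNReal.inv_mul_le_iff hJ0 hJt] at hv
  refine (mul_le_mul_right hv _).trans (le_of_eq ?_)
  have e2 : ENNReal.ofReal (Real.exp (-(σbar ^ 2 / 2 * ‖v‖ ^ 2))) *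
      ENNReal.ofReal (Real.exp (σbar ^ 2 * ‖v‖ ^ 2 / 2)) = 1 := by
    rw [← ENNReal.ofReal_mul (Real.exp_nonneg _), ← Real.exp_add]
    ring_nf; simp
  calc _ = c * J * (ENNReal.ofReal (Real.exp (-(σbar ^ 2 / 2 * ‖v‖ ^ 2))) *
      ENNReal.ofReal (Real.exp (σbar ^ 2 * ‖v‖ ^ 2 / 2))) := by ring
    _ = _ := by rw [e2, mul_one]

/-- Disintegration of the law of `n` independent pairs along the design. -/
theorem setLIntegral_pi_jointLaw {n : ℕ} (hR : Measurable P.R)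
    (hf : Measurable (Function.uncurry P.f)) {B : Set (Fin n → E dy)} (hB : MeasurableSet B)
    (ψ : Fin n → (Fin n → E dy) → E dx → ℝ≥0∞) (hψ : ∀ i, Measurable (Function.uncurry (ψ i))) :
    ∫⁻ D in {D | (fun i => (D i).2) ∈ B}, ∏ i, ψ i (fun i => (D i).2) (D i).1
        ∂Measure.pi (fun _ : Fin n => P.jointLaw) =
      ∫⁻ y in B, ∏ i, ∫⁻ x, P.jointDensity (x, y i) * ψ i y x := by
  have hp := measurable_jointDensity hR hf
  have hy : Measurable fun D : Fin n → E dx × E dy => fun i => (D i).2 := by fun_prop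
  have hB' : MeasurableSet {D : Fin n → E dx × E dy | (fun i => (D i).2) ∈ B} := hy hB
  have hsf : SigmaFinite ((volume : Measure (E dx × E dy)).withDensity P.jointDensity) :=
    inferInstanceAs (SigmaFinite P.jointLaw)
  have hpi : Measure.pi (fun _ : Fin n => P.jointLaw) =
      (Measure.pi fun _ : Fin n => (volume : Measure (E dx × E dy))).withDensity
        fun D => ∏ i, P.jointDensity (D i) :=
    pi_withDensity (fun _ : Fin n => (volume : Measure (E dx × E dy)))
      (fun _ => P.jointDensity) (fun _ => hp)
  have hm1 : Measurable fun D : Fin n → E dx × E dy => ∏ i, P.jointDensity (D i) :=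
    Finset.measurable_prod _ fun i _ => hp.comp (measurable_pi_apply i)
  have hm2 : Measurable fun D : Fin n → E dx × E dy => ∏ i, ψ i (fun i => (D i).2) (D i).1 :=
    Finset.measurable_prod _ fun i _ =>
      (hψ i).comp (hy.prodMk (measurable_fst.comp (measurable_pi_apply i)))
  have hvol : (Measure.pi fun _ : Fin n => (volume : Measure (E dx × E dy))) =
      Measure.pi fun _ : Fin n => (volume : Measure (E dx)).prod (volume : Measure (E dy)) := rfl
  rw [hpi, ← lintegral_indicator hB', lintegral_withDensity_eq_lintegral_mul _ hm1
    (hm2.indicator hB'), hvol, ← ((measurePreserving_arrowProdEquivProdArrow (E dx) (E dy) (Fin n)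
      (fun _ => volume) (fun _ => volume)).symm).lintegral_comp_emb
        (MeasurableEquiv.measurableEmbedding _)]
  have hm3 : Measurable fun a => ((fun D : Fin n → E dx × E dy => ∏ i, P.jointDensity (D i)) *
      {D : Fin n → E dx × E dy | (fun i => (D i).2) ∈ B}.indicator
        fun D : Fin n → E dx × E dy => ∏ i, ψ i (fun i => (D i).2) (D i).1)
        ((MeasurableEquiv.arrowProdEquivProdArrow (E dx) (E dy) (Fin n)).symm a) :=
    (hm1.mul (hm2.indicator hB')).comp
    (MeasurableEquiv.arrowProdEquivProdArrow (E dx) (E dy) (Fin n)).symm.measurable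
  rw [lintegral_prod_symm' _ hm3, ← lintegral_indicator hB]
  refine lintegral_congr fun y => ?_
  change ∫⁻ x : Fin n → E dx, (∏ i, P.jointDensity (x i, y i)) *
    Set.indicator {D : Fin n → E dx × E dy | (fun i => (D i).2) ∈ B}
      (fun D => ∏ i, ψ i (fun i => (D i).2) (D i).1) (fun i => (x i, y i))
        ∂(Measure.pi fun _ => volume) = _
  by_cases hyB : y ∈ B
  · rw [Set.indicator_of_mem hyB, ← lintegral_fintype_prod_eq_prod
      (fun _ : Fin n => (volume : Measure (E dx)))
      (fun i x => P.jointDensity (x, y i) * ψ i y x)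
      fun i => (hp.comp measurable_prodMk_right).mul ((hψ i).comp measurable_prodMk_left)]
    refine lintegral_congr fun x => ?_
    rw [Set.indicator_of_mem (by exact hyB), ← Finset.prod_mul_distrib]
  · rw [Set.indicator_of_notMem hyB]
    refine (lintegral_congr fun x => ?_).trans lintegral_zero
    rw [Set.indicator_of_notMem (by exact hyB), mul_zero]

/-- Conditionally on the design, the errors `x - E[x | y]` are jointly sub-Gaussian; the direction
`v` may depend on the design. -/
theorem ErrorModel.setLIntegral_exp_inner_le {n : ℕ} {σbar : ℝ} (hE : P.ErrorModel σbar)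
    (hR : Measurable P.R) {B : Set (Fin n → E dy)} (hB : MeasurableSet B)
    {v : (Fin n → E dy) → Fin n → E dx} (hv : Measurable v) :
    ∫⁻ D in {D | (fun i => (D i).2) ∈ B}, ENNReal.ofReal (Real.exp
        (∑ i, inner ℝ (v (fun i => (D i).2) i) ((D i).1 - P.condMean (D i).2) -
          σbar ^ 2 / 2 * ∑ i, ‖v (fun i => (D i).2) i‖ ^ 2))
        ∂Measure.pi (fun _ : Fin n => P.jointLaw) ≤
      Measure.pi (fun _ : Fin n => P.jointLaw) {D | (fun i => (D i).2) ∈ B} := by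
  have hG := measurable_condMean hR hE.measurable_f
  set ψ : Fin n → (Fin n → E dy) → E dx → ℝ≥0∞ := fun i y x =>
    ENNReal.ofReal (Real.exp (inner ℝ (v y i) (x - P.condMean (y i)) -
      σbar ^ 2 / 2 * ‖v y i‖ ^ 2)) with hψ
  have hψm : ∀ i, Measurable (Function.uncurry (ψ i)) := fun i => by
    have h1 : Measurable fun p : (Fin n → E dy) × E dx => v p.1 i :=
      (measurable_pi_apply i).comp (hv.comp measurable_fst)
    have h2 : Measurable fun p : (Fin n → E dy) × E dx => P.condMean (p.1 i) :=
      hG.comp ((measurable_pi_apply i).comp measurable_fst)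
    simp only [hψ, Function.uncurry_def]
    fun_prop
  have e1 : ∀ D : Fin n → E dx × E dy, ENNReal.ofReal (Real.exp
        (∑ i, inner ℝ (v (fun i => (D i).2) i) ((D i).1 - P.condMean (D i).2) -
          σbar ^ 2 / 2 * ∑ i, ‖v (fun i => (D i).2) i‖ ^ 2)) =
      ∏ i, ψ i (fun i => (D i).2) (D i).1 := fun D => by
    rw [Finset.mul_sum, ← Finset.sum_sub_distrib, Real.exp_sum,
      ENNReal.ofReal_prod_of_nonneg fun i _ => Real.exp_nonneg _]
  have e2 : Measure.pi (fun _ : Fin n => P.jointLaw) {D | (fun i => (D i).2) ∈ B} =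
      ∫⁻ y in B, ∏ i, ∫⁻ x, P.jointDensity (x, y i) := by
    have := setLIntegral_pi_jointLaw hR hE.measurable_f hB (fun _ _ _ => 1)
      (fun _ => measurable_const)
    simpa using this
  simp_rw [e1]
  rw [setLIntegral_pi_jointLaw hR hE.measurable_f hB ψ hψm, e2]
  refine lintegral_mono_ae (ae_restrict_of_ae ?_)
  have h1 : ∀ᵐ y : Fin n → E dy, ∀ i, ∀ w : E dx, ∫⁻ x, P.jointDensity (x, y i) *
      ENNReal.ofReal (Real.exp (inner ℝ w (x - P.condMean (y i)) - σbar ^ 2 / 2 * ‖w‖ ^ 2)) ≤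
        ∫⁻ x, P.jointDensity (x, y i) := by
    rw [ae_all_iff]
    intro i
    exact (Measure.quasiMeasurePreserving_eval (fun _ : Fin n => (volume : Measure (E dy))) i).ae
      (hE.lintegral_exp_inner_le hR)
  filter_upwards [h1] with y hy
  exact Finset.prod_le_prod' fun i _ => hy i _

end InverseProblem

/-! ### Likelihood ratios under sub-Gaussian errors -/

/-- The errors `ξ₁, …, ξₙ` are jointly sub-Gaussian with parameter `s` given the design `Y`: the
exponential moment bound holds for all directions `v` that are functions of the design. -/
def SubGaussianErrors {Ω 𝒴 : Type*} [MeasurableSpace Ω] [MeasurableSpace 𝒴] {n d : ℕ}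
    (P : Measure Ω) (Y : Ω → 𝒴) (ξ : Ω → Fin n → E d) (s : ℝ) : Prop :=
  ∀ v : 𝒴 → Fin n → E d, Measurable v →
    ∫⁻ ω, ENNReal.ofReal (Real.exp (∑ i, inner ℝ (v (Y ω) i) (ξ ω i) -
      s ^ 2 / 2 * ∑ i, ‖v (Y ω) i‖ ^ 2)) ∂P ≤ P Set.univ

/-- The Gaussian log-likelihood ratio between the regression vector displaced by `h` and the true
one, when the errors are `ξ`. -/
noncomputable def logRatio {n d : ℕ} (σ : ℝ) (h ξ : Fin n → E d) : ℝ :=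
  (∑ i, inner ℝ (h i) (ξ i) - (∑ i, ‖h i‖ ^ 2) / 2) / σ ^ 2

theorem measurable_logRatio {α : Type*} [MeasurableSpace α] {n d : ℕ} {σ : ℝ}
    {h ξ : α → Fin n → E d} (hh : Measurable h) (hξ : Measurable ξ) :
    Measurable fun a => logRatio σ (h a) (ξ a) := by
  unfold logRatio
  fun_prop

theorem measure_lt_le_of_lintegral_le {Ω : Type*} [MeasurableSpace Ω] {P : Measure Ω}
    {Φ : Ω → ℝ≥0∞} (hΦ : Measurable Φ) {c t : ℝ≥0∞} (h : ∫⁻ ω, Φ ω ∂P ≤ c) (h0 : t ≠ 0)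
    (ht : t ≠ ∞) : P {ω | t < Φ ω} ≤ c / t :=
  (measure_mono (t := {ω | t ≤ Φ ω}) fun _ (hω : t < Φ _) => hω.le).trans
    ((meas_ge_le_lintegral_div hΦ.aemeasurable h0 ht).trans (ENNReal.div_le_div_right h _))

namespace SubGaussianErrors

variable {Ω 𝒴 : Type*} [MeasurableSpace Ω] [MeasurableSpace 𝒴] {n d : ℕ}
  {P : Measure Ω} {Y : Ω → 𝒴} {ξ : Ω → Fin n → E d} {s : ℝ}

theorem lintegral_exp_smul_le (hS : SubGaussianErrors P Y ξ s) {v : 𝒴 → Fin n → E d}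
    (hv : Measurable v) (c : ℝ) {𝓑 : Set 𝒴} (h𝓑 : ∀ᵐ ω ∂P, Y ω ∈ 𝓑) {φ : Ω → ℝ} {a : ℝ}
    (hφ : ∀ ω, Y ω ∈ 𝓑 → φ ω ≤ c * ∑ i, inner ℝ (v (Y ω) i) (ξ ω i) -
      s ^ 2 / 2 * (c ^ 2 * ∑ i, ‖v (Y ω) i‖ ^ 2) + a) :
    ∫⁻ ω, ENNReal.ofReal (Real.exp (φ ω)) ∂P ≤ ENNReal.ofReal (Real.exp a) * P Set.univ := by
  have h1 := hS (fun y => c • v y) (hv.const_smul c)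
  refine le_trans ?_ (mul_le_mul_right h1 _)
  rw [← lintegral_const_mul' _ _ ENNReal.ofReal_ne_top]
  refine lintegral_mono_ae ?_
  filter_upwards [h𝓑] with ω hω
  rw [← ENNReal.ofReal_mul (Real.exp_nonneg _), ← Real.exp_add]
  refine ENNReal.ofReal_le_ofReal (Real.exp_le_exp.2 ((hφ ω hω).trans (le_of_eq ?_)))
  simp only [Pi.smul_apply, real_inner_smul_left, norm_smul, mul_pow, Real.norm_eq_abs, sq_abs,
    ← Finset.mul_sum]
  ring

/-- The likelihood ratio has mean at most `1`. This is where the scale `σ` of the pseudo-likelihood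
has to be at least the sub-Gaussian norm of the errors. -/
theorem lintegral_exp_logRatio_le (hS : SubGaussianErrors P Y ξ s) {v : 𝒴 → Fin n → E d}
    (hv : Measurable v) {σ : ℝ} (hs : 0 < s) (hσ : s ≤ σ) :
    ∫⁻ ω, ENNReal.ofReal (Real.exp (logRatio σ (v (Y ω)) (ξ ω))) ∂P ≤ P Set.univ := by
  have hσ0 : 0 < σ := hs.trans_le hσ
  refine (hS.lintegral_exp_smul_le hv (1 / σ ^ 2) (𝓑 := Set.univ) (by simp) (a := 0)
    fun ω _ => ?_).trans (by simp)
  set N := ∑ i, ‖v (Y ω) i‖ ^ 2 with hN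
  have hN0 : 0 ≤ N := Finset.sum_nonneg fun _ _ => by positivity
  have h1 : s ^ 2 / 2 * ((1 / σ ^ 2) ^ 2 * N) ≤ N / 2 / σ ^ 2 := by
    have : s ^ 2 ≤ σ ^ 2 := by gcongr
    calc _ ≤ σ ^ 2 / 2 * ((1 / σ ^ 2) ^ 2 * N) := by gcongr
      _ = _ := by field_simp
  rw [logRatio, ← hN, sub_div, div_eq_mul_one_div (∑ i, _) (σ ^ 2)]
  linarith

theorem lintegral_exp_neg_logRatio_le (hS : SubGaussianErrors P Y ξ s) {v : 𝒴 → Fin n → E d}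
    (hv : Measurable v) {σ : ℝ} (hs : 0 < s) (hσ : s ≤ σ) {𝓑 : Set 𝒴}
    (h𝓑 : ∀ᵐ ω ∂P, Y ω ∈ 𝓑) {a : ℝ} (ha : ∀ y ∈ 𝓑, ∑ i, ‖v y i‖ ^ 2 ≤ a) :
    ∫⁻ ω, ENNReal.ofReal (Real.exp (-logRatio σ (v (Y ω)) (ξ ω))) ∂P ≤
      ENNReal.ofReal (Real.exp (a / σ ^ 2)) * P Set.univ := by
  have hσ0 : 0 < σ := hs.trans_le hσ
  refine hS.lintegral_exp_smul_le hv (-(1 / σ ^ 2)) h𝓑 fun ω hω => ?_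
  have h2 := ha _ hω
  set N := ∑ i, ‖v (Y ω) i‖ ^ 2 with hN
  have hN0 : 0 ≤ N := Finset.sum_nonneg fun _ _ => by positivity
  have h1 : s ^ 2 / 2 * ((-(1 / σ ^ 2)) ^ 2 * N) ≤ N / 2 / σ ^ 2 := by
    have : s ^ 2 ≤ σ ^ 2 := by gcongr
    calc _ ≤ σ ^ 2 / 2 * ((-(1 / σ ^ 2)) ^ 2 * N) := by gcongr
      _ = _ := by field_simp
  have h3 : N / 2 / σ ^ 2 + N / 2 / σ ^ 2 ≤ a / σ ^ 2 := by
    rw [← add_div, add_halves]; gcongr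
  rw [logRatio, ← hN, sub_div, div_eq_mul_one_div (∑ i, _) (σ ^ 2)]
  linarith

/-- Deviations of a linear functional of the errors. The threshold `(‖v‖² + r) / 16` is such that
the bound does not depend on `v`. -/
theorem measure_inner_gt_le (hS : SubGaussianErrors P Y ξ s) {v : 𝒴 → Fin n → E d}
    (hv : Measurable v) (hξ : Measurable ξ) (hY : Measurable Y) (hs : 0 < s) (r : ℝ) :
    P {ω | (∑ i, ‖v (Y ω) i‖ ^ 2 + r) / 16 < ∑ i, inner ℝ (v (Y ω) i) (ξ ω i)} ≤
      ENNReal.ofReal (Real.exp (-(r / (128 * s ^ 2)))) * P Set.univ := by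
  have h1 := hS.lintegral_exp_smul_le hv (1 / (8 * s ^ 2)) (𝓑 := Set.univ) (by simp)
    (a := -(r / (128 * s ^ 2))) (φ := fun ω => (∑ i, inner ℝ (v (Y ω) i) (ξ ω i) -
      (∑ i, ‖v (Y ω) i‖ ^ 2 + r) / 16) / (8 * s ^ 2)) fun ω _ => le_of_eq (by
        field_simp
        ring)
  have hvY : Measurable fun ω => v (Y ω) := hv.comp hY
  have h2 := measure_lt_le_of_lintegral_le (t := 1) (by fun_prop) h1 one_ne_zero ENNReal.one_ne_top
  rw [div_one] at h2
  refine (measure_mono fun ω hω => ?_).trans h2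
  rw [Set.mem_ofPred_eq, ← ENNReal.ofReal_one]
  refine (ENNReal.ofReal_lt_ofReal_iff (Real.exp_pos _)).2 (Real.one_lt_exp_iff.2 ?_)
  exact div_pos (sub_pos.2 hω) (by positivity)

/-- The exponential of the norm in terms of exponentials of linear functionals, since the largest
coordinate of `z` is at least `‖z‖ / √d`. -/
theorem exp_norm_le_sum (z : E d) (hd : 1 ≤ d) : Real.exp ‖z‖ ≤
    ∑ k : Fin d × Bool, Real.exp (inner ℝ
      (EuclideanSpace.single k.1 (if k.2 then √d else -√d) : E d) z) := by
  have hne : (Finset.univ : Finset (Fin d)).Nonempty := ⟨⟨0, hd⟩, Finset.mem_univ _⟩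
  obtain ⟨k, -, hk⟩ := Finset.exists_max_image Finset.univ (fun k => |z k|) hne
  have h1 : ‖z‖ ≤ √d * |z k| := by
    rw [EuclideanSpace.norm_eq]
    refine Real.sqrt_le_iff.2 ⟨by positivity, ?_⟩
    rw [mul_pow, Real.sq_sqrt (Nat.cast_nonneg _)]
    refine (Finset.sum_le_sum (g := fun _ => |z k| ^ 2) fun i _ => ?_).trans (by simp)
    exact pow_le_pow_left₀ (norm_nonneg _) (hk i (Finset.mem_univ _)) 2
  have h2 : ∃ b : Bool, √d * |z k| = inner ℝ
      (EuclideanSpace.single k (if b then √d else -√d) : E d) z := by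
    rcases abs_choice (z k) with h | h
    · exact ⟨true, by rw [h]; simp [EuclideanSpace.inner_single_left]⟩
    · exact ⟨false, by rw [h]; simp [EuclideanSpace.inner_single_left]⟩
  obtain ⟨b, hb⟩ := h2
  refine (Real.exp_le_exp.2 (h1.trans hb.le)).trans ?_
  exact Finset.single_le_sum (f := fun k : Fin d × Bool => Real.exp (inner ℝ
      (EuclideanSpace.single k.1 (if k.2 then √d else -√d) : E d) z))
      (fun _ _ => Real.exp_nonneg _) (Finset.mem_univ (k, b))

/-- An upper bound for the exponential moment of the norm of one error. -/
noncomputable def expMomentBound (d : ℕ) (s : ℝ) : ℝ := 2 * d * Real.exp (s ^ 2 / 2 * d)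

theorem lintegral_exp_sum_norm_le (hS : SubGaussianErrors P Y ξ s) (hξ : Measurable ξ)
    (hd : 1 ≤ d) :
    ∫⁻ ω, ENNReal.ofReal (Real.exp (∑ i, ‖ξ ω i‖)) ∂P ≤
      ENNReal.ofReal (expMomentBound d s ^ n) * P Set.univ := by
  classical
  -- expand the product of the sums in `exp_norm_le_sum`: a sum over choices of one signed
  -- coordinate direction for each error
  set w : (Fin n → Fin d × Bool) → Fin n → E d := fun k i =>
    EuclideanSpace.single (k i).1 (if (k i).2 then √d else -√d) with hw
  have hwn : ∀ k, ∑ i, ‖w k i‖ ^ 2 = n * d := fun k => by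
    have : ∀ i, ‖w k i‖ ^ 2 = d := fun i => by
      simp only [hw, PiLp.norm_single]
      split_ifs <;> simp
    simp [this]
  have h1 : ∀ ω, Real.exp (∑ i, ‖ξ ω i‖) ≤ ∑ k, Real.exp (∑ i, inner ℝ (w k i) (ξ ω i)) := by
    intro ω
    rw [Real.exp_sum]
    refine (Finset.prod_le_prod (fun _ _ => Real.exp_nonneg _)
      fun i _ => exp_norm_le_sum (ξ ω i) hd).trans (le_of_eq ?_)
    rw [Finset.prod_univ_sum, Fintype.piFinset_univ]
    exact Finset.sum_congr rfl fun k _ => (Real.exp_sum _ _).symm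
  calc ∫⁻ ω, ENNReal.ofReal (Real.exp (∑ i, ‖ξ ω i‖)) ∂P
      ≤ ∫⁻ ω, ∑ k, ENNReal.ofReal (Real.exp (∑ i, inner ℝ (w k i) (ξ ω i))) ∂P := by
        refine lintegral_mono fun ω => ?_
        rw [← ENNReal.ofReal_sum_of_nonneg fun _ _ => Real.exp_nonneg _]
        exact ENNReal.ofReal_le_ofReal (h1 ω)
    _ = ∑ k, ∫⁻ ω, ENNReal.ofReal (Real.exp (∑ i, inner ℝ (w k i) (ξ ω i))) ∂P :=
        lintegral_finsetSum _ fun k _ => by fun_prop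
    _ ≤ ∑ _k : Fin n → Fin d × Bool,
          ENNReal.ofReal (Real.exp (s ^ 2 / 2 * (n * d))) * P Set.univ := by
        refine Finset.sum_le_sum fun k _ => ?_
        refine hS.lintegral_exp_smul_le (v := fun _ => w k) measurable_const 1 (𝓑 := Set.univ)
          (by simp) fun ω _ => le_of_eq ?_
        rw [hwn]; ring
    _ = _ := by
        rw [Finset.sum_const, Finset.card_univ, nsmul_eq_mul, ← mul_assoc]
        congr 1
        rw [← ENNReal.ofReal_natCast, ← ENNReal.ofReal_mul (Nat.cast_nonneg _), expMomentBound,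
          mul_pow, ← Real.exp_nat_mul]
        congr 1
        simp only [Fintype.card_pi, Fintype.card_prod, Fintype.card_fin, Fintype.card_bool,
          Finset.prod_const, Finset.card_univ]
        push_cast
        ring_nf

theorem measure_sum_norm_gt_le (hS : SubGaussianErrors P Y ξ s) (hξ : Measurable ξ)
    (hd : 1 ≤ d) (t : ℝ) :
    P {ω | t < ∑ i, ‖ξ ω i‖} ≤
      ENNReal.ofReal (expMomentBound d s ^ n * Real.exp (-t)) * P Set.univ := by
  have h2 := measure_lt_le_of_lintegral_le (t := ENNReal.ofReal (Real.exp t)) (by fun_prop)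
    (hS.lintegral_exp_sum_norm_le hξ hd) (by simp [Real.exp_pos]) ENNReal.ofReal_ne_top
  refine (measure_mono fun ω hω => ?_).trans (h2.trans (le_of_eq ?_))
  · exact (ENNReal.ofReal_lt_ofReal_iff (Real.exp_pos _)).2 (Real.exp_lt_exp.2 hω)
  · rw [ENNReal.mul_div_right_comm, ← ENNReal.ofReal_div_of_pos (Real.exp_pos _), Real.exp_neg,
      div_eq_mul_inv]

end SubGaussianErrors

/-! ### Contraction of pseudo-posteriors -/

section Posterior

variable {Ω 𝒴 Θ : Type*} [MeasurableSpace Ω] [MeasurableSpace 𝒴] [MeasurableSpace Θ] {n d : ℕ}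

/-- If the inverse of a positive function has mean at most `c` over `A`, then the function has mean
at least `1 / c`. -/
theorem measure_le_mul_setLIntegral {π : Measure Θ} {A : Set Θ}
    (hA : π A ≠ ∞) {ℓ : Θ → ℝ} (hℓ : Measurable ℓ) {c : ℝ} (hc : 0 < c)
    (h : ∫⁻ θ in A, ENNReal.ofReal (Real.exp (-ℓ θ)) ∂π ≤ ENNReal.ofReal c * π A) :
    π A ≤ ENNReal.ofReal c * ∫⁻ θ in A, ENNReal.ofReal (Real.exp (ℓ θ)) ∂π := by
  have key : ∀ θ, (2 : ℝ≥0∞) ≤ ENNReal.ofReal c * ENNReal.ofReal (Real.exp (ℓ θ)) +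
      ENNReal.ofReal c⁻¹ * ENNReal.ofReal (Real.exp (-ℓ θ)) := fun θ => by
    rw [← ENNReal.ofReal_mul hc.le, ← ENNReal.ofReal_mul (inv_nonneg.2 hc.le),
      ← ENNReal.ofReal_add (by positivity) (by positivity), ← ENNReal.ofReal_ofNat]
    refine ENNReal.ofReal_le_ofReal ?_
    have hx : 0 < c * Real.exp (ℓ θ) := by positivity
    rw [Real.exp_neg, ← mul_inv]
    have : (c * Real.exp (ℓ θ)) * (c * Real.exp (ℓ θ))⁻¹ = 1 := mul_inv_cancel₀ hx.ne'
    have h' : 0 < (c * Real.exp (ℓ θ))⁻¹ := inv_pos.2 hx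
    nlinarith [sq_nonneg (c * Real.exp (ℓ θ) - (c * Real.exp (ℓ θ))⁻¹)]
  have h1 : 2 * π A ≤ ENNReal.ofReal c * ∫⁻ θ in A, ENNReal.ofReal (Real.exp (ℓ θ)) ∂π + π A := by
    calc 2 * π A = ∫⁻ _ in A, 2 ∂π := by simp
      _ ≤ ∫⁻ θ in A, (ENNReal.ofReal c * ENNReal.ofReal (Real.exp (ℓ θ)) +
          ENNReal.ofReal c⁻¹ * ENNReal.ofReal (Real.exp (-ℓ θ))) ∂π := lintegral_mono key
      _ = ENNReal.ofReal c * ∫⁻ θ in A, ENNReal.ofReal (Real.exp (ℓ θ)) ∂π +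
          ENNReal.ofReal c⁻¹ * ∫⁻ θ in A, ENNReal.ofReal (Real.exp (-ℓ θ)) ∂π := by
          rw [lintegral_add_left (by fun_prop), lintegral_const_mul _ (by fun_prop),
            lintegral_const_mul _ (by fun_prop)]
      _ ≤ _ := by
          gcongr
          refine (mul_le_mul_right h _).trans (le_of_eq ?_)
          rw [← mul_assoc, ← ENNReal.ofReal_mul (inv_nonneg.2 hc.le), inv_mul_cancel₀ hc.ne',
            ENNReal.ofReal_one, one_mul]
  rw [two_mul] at h1
  exact (ENNReal.add_le_add_iff_right hA).1 h1

/-- Posterior contraction for a Gaussian pseudo-likelihood under sub-Gaussian errors. Here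
`h (θ, y)` is the deviation of the regression vector of the parameter `θ` from the true one at the
design `y`. The prior puts mass on `A`, where the deviation is at most `√a`, and mass at most `m₀`
outside of `Θ₀`; on `Θ₀`, but for an event `E₀` of small probability, the likelihood ratio is small
wherever the deviation exceeds `√r`. -/
theorem measure_posterior_gt_le {P : Measure Ω} [IsFiniteMeasure P] {Y : Ω → 𝒴}
    (hY : Measurable Y) {ξ : Ω → Fin n → E d} (hξ : Measurable ξ) {s σ : ℝ}
    (hS : SubGaussianErrors P Y ξ s) (hs : 0 < s) (hσ : s ≤ σ)
    {π : Measure Θ} [IsFiniteMeasure π] {h : Θ × 𝒴 → Fin n → E d} (hh : Measurable h)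
    {𝓑 : Set 𝒴} (h𝓑 : ∀ᵐ ω ∂P, Y ω ∈ 𝓑) {A : Set Θ} (hA : MeasurableSet A) (hA0 : π A ≠ 0)
    {a : ℝ} (ha : ∀ θ ∈ A, ∀ y ∈ 𝓑, ∑ i, ‖h (θ, y) i‖ ^ 2 ≤ a)
    {Θ₀ : Set Θ} (hΘ₀ : MeasurableSet Θ₀) {m₀ : ℝ≥0∞} (hm₀ : m₀ ≠ 0) (hm₀' : m₀ ≠ ∞)
    (hΘm : π Θ₀ᶜ ≤ m₀)
    {r w : ℝ} {E₀ : Set Ω} {δ : ℝ≥0∞} (hE₀ : P E₀ ≤ δ * P Set.univ)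
    (hE : ∀ ω ∉ E₀, Y ω ∈ 𝓑 → ∀ θ ∈ Θ₀, r < ∑ i, ‖h (θ, Y ω) i‖ ^ 2 →
      logRatio σ (h (θ, Y ω)) (ξ ω) ≤ -w)
    {ρ : ℝ} (hρ : 0 < ρ) {κ : ℝ≥0∞}
    (hκ : ENNReal.ofReal (ρ * Real.exp (a / σ ^ 2)) *
      (ENNReal.ofReal ρ * m₀ + ENNReal.ofReal (Real.exp (-w)) * π Set.univ) ≤ κ * π A) :
    P {ω | κ < (∫⁻ θ, ENNReal.ofReal (Real.exp (logRatio σ (h (θ, Y ω)) (ξ ω))) ∂π)⁻¹ *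
        ∫⁻ θ in {θ | r < ∑ i, ‖h (θ, Y ω) i‖ ^ 2},
          ENNReal.ofReal (Real.exp (logRatio σ (h (θ, Y ω)) (ξ ω))) ∂π} ≤
      (2 * ENNReal.ofReal ρ⁻¹ + δ) * P Set.univ := by
  have hm : Measurable fun p : Ω × Θ => logRatio σ (h (p.2, Y p.1)) (ξ p.1) :=
    measurable_logRatio (hh.comp (measurable_snd.prodMk (hY.comp measurable_fst)))
      (hξ.comp measurable_fst)
  have hmZ : Measurable fun p : Ω × Θ =>
      ENNReal.ofReal (Real.exp (logRatio σ (h (p.2, Y p.1)) (ξ p.1))) := by fun_prop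
  have hmZ' : Measurable fun p : Ω × Θ =>
      ENNReal.ofReal (Real.exp (-logRatio σ (h (p.2, Y p.1)) (ξ p.1))) := by fun_prop
  have hhθ : ∀ θ, Measurable fun y => h (θ, y) := fun θ => hh.comp measurable_prodMk_left
  set c := ρ * Real.exp (a / σ ^ 2) with hc
  have hc0 : 0 < c := by positivity
  have hAt : π A ≠ ∞ := measure_ne_top _ _
  -- the average over `A` of the inverse likelihood ratio
  let G₁ : Set Ω := {ω | ENNReal.ofReal c * π A <
      ∫⁻ θ in A, ENNReal.ofReal (Real.exp (-logRatio σ (h (θ, Y ω)) (ξ ω))) ∂π}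
  have hG1 : P G₁ ≤ ENNReal.ofReal ρ⁻¹ * P Set.univ := by
    have h1 : ∫⁻ ω, ∫⁻ θ in A, ENNReal.ofReal (Real.exp (-logRatio σ (h (θ, Y ω)) (ξ ω))) ∂π ∂P ≤
        ENNReal.ofReal (Real.exp (a / σ ^ 2)) * P Set.univ * π A := by
      rw [lintegral_lintegral_swap hmZ'.aemeasurable]
      refine (setLIntegral_mono' hA fun θ hθ =>
        hS.lintegral_exp_neg_logRatio_le (hhθ θ) hs hσ h𝓑 (ha θ hθ)).trans (le_of_eq ?_)
      rw [setLIntegral_const]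
    have hΦ : Measurable fun ω =>
        ∫⁻ θ in A, ENNReal.ofReal (Real.exp (-logRatio σ (h (θ, Y ω)) (ξ ω))) ∂π :=
      Measurable.lintegral_prod_right' (ν := π.restrict A) hmZ'
    refine (measure_lt_le_of_lintegral_le hΦ h1
      (mul_ne_zero (by simpa using hc0) hA0)
      (ENNReal.mul_ne_top ENNReal.ofReal_ne_top hAt)).trans ?_
    rw [ENNReal.mul_div_mul_right _ _ hA0 hAt, hc, mul_comm ρ,
      ENNReal.ofReal_mul (Real.exp_nonneg _), ENNReal.mul_div_mul_left _ _
        (by simp [Real.exp_pos]) ENNReal.ofReal_ne_top, ENNReal.ofReal_inv_of_pos hρ,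
        ENNReal.div_eq_inv_mul]
  -- the contribution of the parameters outside of `Θ₀`
  let G₂ : Set Ω := {ω | ENNReal.ofReal ρ * m₀ <
      ∫⁻ θ in Θ₀ᶜ, ENNReal.ofReal (Real.exp (logRatio σ (h (θ, Y ω)) (ξ ω))) ∂π}
  have hG4 : P G₂ ≤ ENNReal.ofReal ρ⁻¹ * P Set.univ := by
    have h1 : ∫⁻ ω, ∫⁻ θ in Θ₀ᶜ, ENNReal.ofReal (Real.exp (logRatio σ (h (θ, Y ω)) (ξ ω))) ∂π ∂P ≤
        P Set.univ * m₀ := by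
      rw [lintegral_lintegral_swap hmZ.aemeasurable]
      refine le_trans ?_ (mul_le_mul_right hΘm _)
      refine (setLIntegral_mono' hΘ₀.compl fun θ _ =>
        hS.lintegral_exp_logRatio_le (hhθ θ) hs hσ).trans (le_of_eq ?_)
      rw [setLIntegral_const]
    have hΦ : Measurable fun ω =>
        ∫⁻ θ in Θ₀ᶜ, ENNReal.ofReal (Real.exp (logRatio σ (h (θ, Y ω)) (ξ ω))) ∂π :=
      Measurable.lintegral_prod_right' (ν := π.restrict Θ₀ᶜ) hmZ
    refine (measure_lt_le_of_lintegral_le hΦ h1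
      (mul_ne_zero (by simpa using hρ) hm₀)
      (ENNReal.mul_ne_top ENNReal.ofReal_ne_top hm₀')).trans ?_
    rw [ENNReal.mul_div_mul_right _ _ hm₀ hm₀', ENNReal.ofReal_inv_of_pos hρ,
        ENNReal.div_eq_inv_mul]
  have hU : P (G₁ ∪ G₂ ∪ E₀) ≤ (2 * ENNReal.ofReal ρ⁻¹ + δ) * P Set.univ := by
    refine (measure_union_le _ _).trans ((add_le_add ((measure_union_le _ _).trans
      (add_le_add hG1 hG4)) hE₀).trans (le_of_eq ?_))
    ring
  have hN : P {ω | Y ω ∉ 𝓑} = 0 := ae_iff.1 h𝓑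
  replace hU : P (G₁ ∪ G₂ ∪ E₀ ∪ {ω | Y ω ∉ 𝓑}) ≤ (2 * ENNReal.ofReal ρ⁻¹ + δ) * P Set.univ :=
    (measure_union_le _ _).trans (by rwa [hN, add_zero])
  refine le_trans (measure_mono fun ω hbad => ?_) hU
  refine or_iff_not_imp_right.2 fun hω => ?_
  simp only [Set.mem_ofPred_eq, not_not] at hbad hω
  by_contra hgood
  obtain ⟨hg, hgE⟩ := not_or.1 hgood
  obtain ⟨hg1, hg4⟩ := not_or.1 hg
  simp only [G₁, G₂, Set.mem_ofPred_eq, not_lt] at hg1 hg4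
  refine absurd hbad (not_lt.2 ?_)
  have hmθ : Measurable fun θ => logRatio σ (h (θ, Y ω)) (ξ ω) :=
    measurable_logRatio (hh.comp measurable_prodMk_right) measurable_const
  have hden := measure_le_mul_setLIntegral hAt hmθ hc0 hg1
  set Z := fun θ => ENNReal.ofReal (Real.exp (logRatio σ (h (θ, Y ω)) (ξ ω))) with hZ
  set bad := {θ | r < ∑ i, ‖h (θ, Y ω) i‖ ^ 2} with hbadset
  have hbadm : MeasurableSet bad := by
    have : Measurable fun θ => h (θ, Y ω) := hh.comp measurable_prodMk_right
    exact measurableSet_lt measurable_const (by fun_prop)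
  have hnum : ∫⁻ θ in bad, Z θ ∂π ≤
      ENNReal.ofReal ρ * m₀ + ENNReal.ofReal (Real.exp (-w)) * π Set.univ := by
    calc ∫⁻ θ in bad, Z θ ∂π ≤ ∫⁻ θ in Θ₀ᶜ ∪ (bad ∩ Θ₀), Z θ ∂π := by
          refine lintegral_mono_set fun θ hθ => ?_
          by_cases h0 : θ ∈ Θ₀
          · exact Or.inr ⟨hθ, h0⟩
          · exact Or.inl h0
      _ ≤ _ := (lintegral_union_le _ _ _).trans (add_le_add hg4 ?_)
    calc ∫⁻ θ in bad ∩ Θ₀, Z θ ∂π ≤ ∫⁻ _ in bad ∩ Θ₀, ENNReal.ofReal (Real.exp (-w)) ∂π :=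
          setLIntegral_mono' (hbadm.inter hΘ₀) fun θ hθ =>
            ENNReal.ofReal_le_ofReal (Real.exp_le_exp.2 (hE ω hgE hω θ hθ.2 hθ.1))
      _ ≤ _ := by
        rw [setLIntegral_const]
        exact mul_le_mul_right (measure_mono (Set.subset_univ _)) _
  have hden' : π A ≤ ENNReal.ofReal c * ∫⁻ θ, Z θ ∂π :=
    hden.trans (mul_le_mul_right (setLIntegral_le_lintegral _ _) _)
  set I := ∫⁻ θ, Z θ ∂π with hI
  have hI0 : I ≠ 0 := fun h0 => hA0 (by rw [h0, mul_zero] at hden'; exact nonpos_iff_eq_zero.1 hden')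
  change I⁻¹ * ∫⁻ θ in bad, Z θ ∂π ≤ κ
  by_cases hIt : I = ∞
  · rw [hIt]; simp
  rw [ENNReal.inv_mul_le_iff hI0 hIt]
  have hcne : ENNReal.ofReal c ≠ 0 := by simpa using hc0
  refine hnum.trans ((ENNReal.mul_le_mul_iff_right hcne ENNReal.ofReal_ne_top).1 (hκ.trans ?_))
  calc κ * π A ≤ κ * (ENNReal.ofReal c * I) := mul_le_mul_right hden' _
    _ = _ := by ring

end Posterior

/-! ### Pointwise bounds for the likelihood ratio -/

section NumeratorBounds

variable {n d : ℕ}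

theorem sum_inner_le_sum_norm_mul {h ξ : Fin n → E d} {b : ℝ} (hb : ∀ i, ‖h i‖ ≤ b) :
    ∑ i, inner ℝ (h i) (ξ i) ≤ b * ∑ i, ‖ξ i‖ := by
  rw [Finset.mul_sum]
  exact Finset.sum_le_sum fun i _ => (real_inner_le_norm _ _).trans
    (mul_le_mul_of_nonneg_right (hb i) (norm_nonneg _))

/-- For large deviations, the quadratic term of the likelihood ratio dominates without any control
of the noise besides its size. -/
theorem logRatio_le_of_large {h ξ : Fin n → E d} {σ t r : ℝ} (hσ : 0 < σ)
    (ht : ∑ i, ‖ξ i‖ ≤ t) (hr : r < ∑ i, ‖h i‖ ^ 2) (htr : 16 * t ^ 2 ≤ r) :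
    logRatio σ h ξ ≤ -(r / 4 / σ ^ 2) := by
  set N := ∑ i, ‖h i‖ ^ 2 with hN
  have ht0 : 0 ≤ t := (Finset.sum_nonneg fun _ _ => norm_nonneg _).trans ht
  have hr0 : 0 ≤ r := (by positivity : (0:ℝ) ≤ 16 * t ^ 2).trans htr
  have hN0 : 0 ≤ N := hr0.trans hr.le
  have h1 : ∑ i, inner ℝ (h i) (ξ i) ≤ √N * ∑ i, ‖ξ i‖ := by
    refine sum_inner_le_sum_norm_mul fun i => Real.le_sqrt_of_sq_le ?_
    exact Finset.single_le_sum (f := fun i => ‖h i‖ ^ 2) (fun _ _ => by positivity)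
      (Finset.mem_univ i)
  have h2 : t ≤ √N / 4 := by
    rw [le_div_iff₀ (by norm_num)]
    refine Real.le_sqrt_of_sq_le ?_
    nlinarith
  have h3 : √N * ∑ i, ‖ξ i‖ ≤ N / 4 := by
    calc _ ≤ √N * (√N / 4) := by gcongr; exact ht.trans h2
      _ = N / 4 := by rw [← mul_div_assoc, Real.mul_self_sqrt hN0]
  rw [logRatio, ← neg_div]
  gcongr
  linarith

/-- The likelihood ratio at a point `h` that is close to a point `h'` at which the noise term is
controlled. -/
theorem logRatio_le_of_close {h h' ξ : Fin n → E d} {σ τ r : ℝ} (hσ : 0 < σ) (hn : 1 ≤ n)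
    (ht : ∑ i, ‖ξ i‖ ≤ τ * n) (hr : r < ∑ i, ‖h i‖ ^ 2)
    (hclose : ∀ i, ‖h i - h' i‖ ≤ 1 / n)
    (hin : ∑ i, inner ℝ (h' i) (ξ i) ≤ (∑ i, ‖h' i‖ ^ 2 + r) / 16) :
    logRatio σ h ξ ≤ -((r / 4 - τ - 1) / σ ^ 2) := by
  have hn0 : (0 : ℝ) < n := by exact_mod_cast hn
  have h1 : ∑ i, inner ℝ (h i) (ξ i) = ∑ i, inner ℝ (h' i) (ξ i) +
      ∑ i, inner ℝ (h i - h' i) (ξ i) := by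
    rw [← Finset.sum_add_distrib]
    exact Finset.sum_congr rfl fun i _ => by rw [← inner_add_left]; congr 1; abel
  have h2 : ∑ i, inner ℝ (h i - h' i) (ξ i) ≤ τ := by
    refine (sum_inner_le_sum_norm_mul hclose).trans ?_
    calc 1 / (n : ℝ) * ∑ i, ‖ξ i‖ ≤ 1 / n * (τ * n) := by gcongr
      _ = τ := by field_simp
  have h3 : ∑ i, ‖h' i‖ ^ 2 ≤ 2 * ∑ i, ‖h i‖ ^ 2 + 2 := by
    have : ∀ i, ‖h' i‖ ^ 2 ≤ 2 * ‖h i‖ ^ 2 + 2 * (1 / n) := fun i => by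
      have a1 : ‖h' i‖ ≤ ‖h i‖ + ‖h i - h' i‖ := by
        have := norm_sub_le (h i) (h i - h' i)
        rwa [sub_sub_cancel] at this
      have a2 : (1 / (n : ℝ)) ≤ 1 := by
        rw [div_le_one hn0]; exact_mod_cast hn
      have a3 : ‖h i - h' i‖ ^ 2 ≤ 1 / n := by nlinarith [hclose i, norm_nonneg (h i - h' i)]
      nlinarith [sq_nonneg (‖h i‖ - ‖h i - h' i‖), norm_nonneg (h' i)]
    refine (Finset.sum_le_sum fun i _ => this i).trans (le_of_eq ?_)
    rw [Finset.sum_add_distrib, ← Finset.mul_sum]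
    simp only [Finset.sum_const, Finset.card_univ, Fintype.card_fin, nsmul_eq_mul]
    field_simp
  rw [logRatio, ← neg_div, h1]
  gcongr
  have hN : 0 ≤ ∑ i, ‖h i‖ ^ 2 := Finset.sum_nonneg fun _ _ => by positivity
  linarith

end NumeratorBounds

/-! ### The spike-and-slab prior -/

namespace Network

section Gaussian

theorem gaussDensity_nonneg (ρ t : ℝ) : 0 ≤ gaussDensity ρ t := by
  unfold gaussDensity; positivity

theorem measurable_gaussDensity (ρ : ℝ) : Measurable (gaussDensity ρ) := by
  unfold gaussDensity; fun_prop

/-- The centred Gaussian measure on `ℝ` with precision `ρ`. -/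
noncomputable def gaussMeasure (ρ : ℝ) : Measure ℝ :=
  volume.withDensity fun t => ENNReal.ofReal (gaussDensity ρ t)

theorem isProbabilityMeasure_gaussMeasure {ρ : ℝ} (hρ : 0 < ρ) :
    IsProbabilityMeasure (gaussMeasure ρ) := by
  constructor
  rw [gaussMeasure, withDensity_apply _ MeasurableSet.univ, Measure.restrict_univ]
  have hv : (Real.toNNReal ρ⁻¹ : ℝ) = ρ⁻¹ := Real.coe_toNNReal _ (by positivity)
  have h := ProbabilityTheory.lintegral_gaussianPDFReal_eq_one 0 (v := Real.toNNReal ρ⁻¹)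
    (by simpa using hρ)
  rw [← h]
  refine lintegral_congr fun t => ?_
  simp only [ProbabilityTheory.gaussianPDFReal_def, gaussDensity, hv, ← Real.sqrt_inv, sub_zero]
  congr 3
  · field_simp
  · field_simp

theorem gaussMeasure_tail_le {b : ℝ} (hb : 0 ≤ b) :
    gaussMeasure 1 {t | b < |t|} ≤ ENNReal.ofReal (2 * Real.exp (-(b ^ 2 / 2))) := by
  have hm : MeasurableSet {t : ℝ | b < |t|} :=
    measurableSet_lt measurable_const measurable_id.abs
  have h1 : ∀ t ∈ {t : ℝ | b < |t|}, ENNReal.ofReal (gaussDensity 1 t) ≤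
      ENNReal.ofReal (Real.exp (-(b ^ 2 / 2))) *
        (ENNReal.ofReal (gaussDensity 1 (t - b)) + ENNReal.ofReal (gaussDensity 1 (t - -b))) := by
    intro t ht
    have ht' : b < |t| := ht
    rw [← ENNReal.ofReal_add (gaussDensity_nonneg _ _) (gaussDensity_nonneg _ _),
      ← ENNReal.ofReal_mul (Real.exp_nonneg _)]
    refine ENNReal.ofReal_le_ofReal ?_
    -- `t² ≥ (t ∓ b)² + b²` for `± t > b`
    have key : ∀ t', b ^ 2 + t' ^ 2 ≤ t ^ 2 →
        gaussDensity 1 t ≤ Real.exp (-(b ^ 2 / 2)) * gaussDensity 1 t' := fun t' h => by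
      unfold gaussDensity
      rw [mul_left_comm, ← Real.exp_add]
      gcongr
      linarith
    have hn : ∀ t', 0 ≤ Real.exp (-(b ^ 2 / 2)) * gaussDensity 1 t' := fun t' =>
      mul_nonneg (Real.exp_nonneg _) (gaussDensity_nonneg _ _)
    rw [mul_add]
    rcases lt_abs.1 ht' with h | h
    · linarith [key (t - b) (by nlinarith), hn (t - -b)]
    · linarith [key (t - -b) (by nlinarith), hn (t - b)]
  have hint : ∫⁻ t, ENNReal.ofReal (gaussDensity 1 t) = 1 := by
    have := (isProbabilityMeasure_gaussMeasure one_pos).measure_univ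
    rwa [gaussMeasure, withDensity_apply _ MeasurableSet.univ, Measure.restrict_univ] at this
  have hgm : Measurable fun t => ENNReal.ofReal (gaussDensity 1 t) :=
    (measurable_gaussDensity 1).ennreal_ofReal
  have hshift : ∀ c, ∫⁻ t, ENNReal.ofReal (gaussDensity 1 (t - c)) = 1 := fun c => by
    rw [← hint]
    exact lintegral_sub_right_eq_self (fun t => ENNReal.ofReal (gaussDensity 1 t)) c
  have hgm' : ∀ c, Measurable fun t => ENNReal.ofReal (gaussDensity 1 (t - c)) := fun c =>
    hgm.comp (measurable_id.sub_const c)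
  rw [gaussMeasure, withDensity_apply _ hm]
  refine (setLIntegral_mono' hm h1).trans ((setLIntegral_le_lintegral _ _).trans ?_)
  have hsum : Measurable fun t => ENNReal.ofReal (gaussDensity 1 (t - b)) +
      ENNReal.ofReal (gaussDensity 1 (t - -b)) := (hgm' b).add (hgm' (-b))
  rw [lintegral_const_mul _ hsum, lintegral_add_left (hgm' b), hshift,
    hshift, mul_comm 2, ENNReal.ofReal_mul (Real.exp_nonneg _)]
  norm_num

theorem gaussMeasure_ball_ge {t₀ η : ℝ} (ht : |t₀| ≤ 1) (hη : η ≤ 1) :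
    ENNReal.ofReal (η / 10) ≤ gaussMeasure 1 {t | |t - t₀| ≤ η} := by
  have hball : {t | |t - t₀| ≤ η} = Metric.closedBall t₀ η := by
    ext t; simp [Real.dist_eq]
  have hm : MeasurableSet {t | |t - t₀| ≤ η} := hball ▸ measurableSet_closedBall
  have h1 : ∀ t ∈ {t | |t - t₀| ≤ η},
      ENNReal.ofReal (1 / 20) ≤ ENNReal.ofReal (gaussDensity 1 t) := by
    intro t (ht' : |t - t₀| ≤ η)
    refine ENNReal.ofReal_le_ofReal ?_
    have ht2 : t ^ 2 ≤ 4 := by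
      have : |t| ≤ 2 := by
        have := abs_add_le (t - t₀) t₀
        rw [sub_add_cancel] at this
        linarith
      nlinarith [abs_le.1 this]
    have hs : (2 / 5 : ℝ) ^ 2 ≥ 1 / (2 * Real.pi) := by
      rw [ge_iff_le, div_le_iff₀ (by positivity)]
      nlinarith [Real.pi_gt_d2]
    have hs' : (39 / 100 : ℝ) ≤ √(1 / (2 * Real.pi)) := by
      refine Real.le_sqrt_of_sq_le ?_
      rw [le_div_iff₀ (by positivity)]
      nlinarith [Real.pi_lt_d2]
    have he : (2 / 15 : ℝ) ≤ Real.exp (-(1 / 2 * t ^ 2)) := by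
      have h2 : Real.exp (-2) ≤ Real.exp (-(1 / 2 * t ^ 2)) := Real.exp_le_exp.2 (by linarith)
      refine le_trans ?_ h2
      rw [Real.exp_neg, show (2 : ℝ) = 1 + 1 by norm_num, Real.exp_add,
        le_inv_comm₀ (by norm_num) (by positivity)]
      nlinarith [Real.exp_one_lt_d9, Real.exp_pos 1]
    unfold gaussDensity
    calc (1 / 20 : ℝ) ≤ 39 / 100 * (2 / 15) := by norm_num
      _ ≤ _ := by gcongr
  rw [gaussMeasure, withDensity_apply _ hm]
  refine le_trans (le_of_eq ?_) (setLIntegral_mono' hm h1)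
  rw [setLIntegral_const, hball, Real.volume_closedBall, ← ENNReal.ofReal_mul (by norm_num)]
  congr 1
  ring

end Gaussian

variable {d : ℕ} {𝒩 : Network d}

/-- The number `‖Λ‖₀` of entries of a support. -/
def supportCard (Λ : 𝒩.Idx → Bool) : ℕ := (Finset.univ.filter fun k => Λ k = true).card

/-- The (unnormalized) spike-and-slab prior, as a measure. -/
noncomputable def priorMeasure (𝒩 : Network d) (u ρ₀ : ℝ) : Measure 𝒩.Theta :=
  𝒩.refMeasure.withDensity fun θ => ENNReal.ofReal (𝒩.priorDensity u ρ₀ θ)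

/-- The prior on the parameters given the support. -/
noncomputable def slabMeasure (ρ₀ : ℝ) (Λ : 𝒩.Idx → Bool) : Measure 𝒩.Param :=
  Measure.pi fun k => gaussMeasure (if Λ k then 1 else ρ₀)

theorem measurable_priorDensity (u ρ₀ : ℝ) : Measurable (𝒩.priorDensity u ρ₀) := by
  refine measurable_from_prod_countable_right fun Λ => ?_
  have h : Measurable fun W : 𝒩.Param => ∏ k, gaussDensity (if Λ k then 1 else ρ₀) (W k) :=
    Finset.measurable_prod _ fun k _ => (measurable_gaussDensity _).comp (measurable_pi_apply k)
  exact h.const_mul ((1 / (𝒩.numParams : ℝ)) ^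
    ((u + 1) * ((Finset.univ.filter fun k => Λ k = true).card : ℝ)))

theorem measurable_mask : Measurable 𝒩.mask := by
  refine measurable_from_prod_countable_right fun Λ => ?_
  unfold mask
  refine measurable_pi_lambda _ fun k => ?_
  by_cases h : Λ k = true
  · simpa [h] using measurable_pi_apply k
  · simp [h]

theorem isProbabilityMeasure_precision {ρ₀ : ℝ} (hρ : 0 < ρ₀) (Λ : 𝒩.Idx → Bool) (k : 𝒩.Idx) :
    IsProbabilityMeasure (gaussMeasure (if Λ k then 1 else ρ₀)) :=
  isProbabilityMeasure_gaussMeasure (by split_ifs <;> [exact one_pos; exact hρ])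

theorem isProbabilityMeasure_slabMeasure {ρ₀ : ℝ} (hρ : 0 < ρ₀) (Λ : 𝒩.Idx → Bool) :
    IsProbabilityMeasure (slabMeasure ρ₀ Λ) := by
  have := isProbabilityMeasure_precision hρ Λ
  unfold slabMeasure
  infer_instance

theorem slabMeasure_eq {ρ₀ : ℝ} (hρ : 0 < ρ₀) (Λ : 𝒩.Idx → Bool) :
    slabMeasure ρ₀ Λ = (volume : Measure 𝒩.Param).withDensity
      fun W => ENNReal.ofReal (∏ k, gaussDensity (if Λ k then 1 else ρ₀) (W k)) := by
  have h1 := isProbabilityMeasure_precision hρ Λ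
  have h2 : ∀ k, SigmaFinite ((volume : Measure ℝ).withDensity
      fun t => ENNReal.ofReal (gaussDensity (if Λ k then 1 else ρ₀) t)) := fun k => by
    have := h1 k
    exact inferInstanceAs (SigmaFinite (gaussMeasure (if Λ k then 1 else ρ₀)))
  refine (pi_withDensity (fun _ : 𝒩.Idx => (volume : Measure ℝ))
    (fun k t => ENNReal.ofReal (gaussDensity (if Λ k then 1 else ρ₀) t))
    fun k => (measurable_gaussDensity _).ennreal_ofReal).trans ?_
  congr 1
  funext W
  exact (ENNReal.ofReal_prod_of_nonneg fun k _ => gaussDensity_nonneg _ _).symm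

/-- The prior weight of a support. -/
noncomputable def supportWeight (u : ℝ) (Λ : 𝒩.Idx → Bool) : ℝ :=
  (1 / (𝒩.numParams : ℝ)) ^ ((u + 1) * (supportCard Λ : ℝ))

theorem supportWeight_nonneg (u : ℝ) (Λ : 𝒩.Idx → Bool) : 0 ≤ supportWeight u Λ := by
  unfold supportWeight; positivity

theorem priorMeasure_apply {u ρ₀ : ℝ} (hρ : 0 < ρ₀) {S : Set 𝒩.Theta} (hS : MeasurableSet S) :
    𝒩.priorMeasure u ρ₀ S = ∑ Λ, ENNReal.ofReal (supportWeight u Λ) *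
      slabMeasure ρ₀ Λ {W | (Λ, W) ∈ S} := by
  have hm : Measurable fun θ : 𝒩.Theta => ENNReal.ofReal (𝒩.priorDensity u ρ₀ θ) :=
    (measurable_priorDensity u ρ₀).ennreal_ofReal
  rw [priorMeasure, withDensity_apply _ hS, ← lintegral_indicator hS, refMeasure,
    lintegral_prod _ (hm.indicator hS).aemeasurable, lintegral_count, tsum_fintype]
  refine Finset.sum_congr rfl fun Λ _ => ?_
  have hSΛ : MeasurableSet {W | (Λ, W) ∈ S} := measurable_prodMk_left hS
  have hmΛ : Measurable fun W : 𝒩.Param =>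
      ENNReal.ofReal (∏ k, gaussDensity (if Λ k then 1 else ρ₀) (W k)) :=
    (Finset.measurable_prod _ fun k _ =>
      (measurable_gaussDensity _).comp (measurable_pi_apply k)).ennreal_ofReal
  rw [slabMeasure_eq hρ, withDensity_apply _ hSΛ, ← lintegral_const_mul _ hmΛ,
    ← lintegral_indicator hSΛ]
  refine lintegral_congr fun W => ?_
  by_cases hW : (Λ, W) ∈ S
  · rw [Set.indicator_of_mem hW, Set.indicator_of_mem (by exact hW),
      ← ENNReal.ofReal_mul (supportWeight_nonneg _ _)]
    rfl
  · rw [Set.indicator_of_notMem hW, Set.indicator_of_notMem (by exact hW)]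

/-- Supports have total mass at most `3` under the weights `q^{-‖Λ‖₀}`. -/
theorem sum_inv_pow_supportCard_le (hq : 1 ≤ 𝒩.numParams) :
    ∑ Λ : 𝒩.Idx → Bool, (1 / (𝒩.numParams : ℝ)) ^ supportCard Λ ≤ 3 := by
  classical
  set x : ℝ := 1 / (𝒩.numParams : ℝ) with hx
  have hq' : (0 : ℝ) < 𝒩.numParams := by exact_mod_cast hq
  have e : ∑ Λ : 𝒩.Idx → Bool, x ^ supportCard Λ = (1 + x) ^ 𝒩.numParams := by
    have h1 := Finset.prod_univ_sum (fun _ : 𝒩.Idx => (Finset.univ : Finset Bool))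
      (fun _ b => if b = true then x else 1)
    rw [Fintype.piFinset_univ] at h1
    rw [← card_idx, ← Finset.card_univ, ← Finset.prod_const]
    refine Eq.trans ?_ (h1.symm.trans ?_)
    · refine Finset.sum_congr rfl fun Λ _ => ?_
      rw [Finset.prod_ite]
      simp [supportCard]
    · simp [add_comm]
  rw [e]
  calc (1 + x) ^ 𝒩.numParams ≤ Real.exp x ^ 𝒩.numParams := by
        gcongr
        linarith [Real.add_one_le_exp x]
    _ = Real.exp 1 := by rw [← Real.exp_nat_mul, hx]; congr 1; field_simp
    _ ≤ 3 := by linarith [Real.exp_one_lt_d9]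

theorem supportWeight_le {u : ℝ} (hu : 1 ≤ u) (hq : 1 ≤ 𝒩.numParams) (Λ : 𝒩.Idx → Bool) :
    supportWeight u Λ ≤ (1 / (𝒩.numParams : ℝ)) ^ supportCard Λ *
      (1 / (𝒩.numParams : ℝ)) ^ supportCard Λ := by
  have hq' : (1 : ℝ) ≤ 𝒩.numParams := by exact_mod_cast hq
  rw [supportWeight, ← pow_add, ← Real.rpow_natCast]
  refine Real.rpow_le_rpow_of_exponent_ge (by positivity) ?_ ?_
  · rw [div_le_one (by linarith)]; exact hq'
  · push_cast
    nlinarith [Nat.cast_nonneg (α := ℝ) (supportCard Λ)]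

theorem pow_supportCard_le_one (hq : 1 ≤ 𝒩.numParams) (Λ : 𝒩.Idx → Bool) :
    (1 / (𝒩.numParams : ℝ)) ^ supportCard Λ ≤ 1 := by
  have hq' : (1 : ℝ) ≤ 𝒩.numParams := by exact_mod_cast hq
  refine pow_le_one₀ (by positivity) ?_
  rw [div_le_one (by linarith)]; exact hq'

theorem sum_supportWeight_le {u : ℝ} (hu : 1 ≤ u) (hq : 1 ≤ 𝒩.numParams) :
    ∑ Λ : 𝒩.Idx → Bool, supportWeight u Λ ≤ 3 :=
  (Finset.sum_le_sum fun Λ _ => (supportWeight_le hu hq Λ).trans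
    (mul_le_of_le_one_left (by positivity) (pow_supportCard_le_one hq Λ))).trans
      (sum_inv_pow_supportCard_le hq)

theorem priorMeasure_univ_le {u ρ₀ : ℝ} (hρ : 0 < ρ₀) (hu : 1 ≤ u) (hq : 1 ≤ 𝒩.numParams) :
    𝒩.priorMeasure u ρ₀ Set.univ ≤ 3 := by
  rw [priorMeasure_apply hρ MeasurableSet.univ]
  have h := isProbabilityMeasure_slabMeasure (𝒩 := 𝒩) hρ
  refine (Finset.sum_le_sum fun Λ _ => mul_le_of_le_one_right' prob_le_one).trans ?_
  rw [← ENNReal.ofReal_sum_of_nonneg fun _ _ => supportWeight_nonneg _ _, ← ENNReal.ofReal_ofNat]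
  exact ENNReal.ofReal_le_ofReal (sum_supportWeight_le hu hq)

/-- The sieve: supports with at most `S` entries, and weights bounded by `b` on the support. -/
def sieve (𝒩 : Network d) (S : ℕ) (b : ℝ) : Set 𝒩.Theta :=
  {θ | supportCard θ.1 ≤ S ∧ ∀ k, θ.1 k = true → |θ.2 k| ≤ b}

theorem measurableSet_of_forall_section {S : Set 𝒩.Theta}
    (h : ∀ Λ, MeasurableSet {W | (Λ, W) ∈ S}) : MeasurableSet S := by
  refine measurableSet_setOfPred.2 (measurable_from_prod_countable_right fun Λ => ?_)
  exact measurableSet_setOfPred.1 (h Λ)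

theorem measurableSet_sieve (S : ℕ) (b : ℝ) : MeasurableSet (𝒩.sieve S b) := by
  refine measurableSet_of_forall_section fun Λ => ?_
  by_cases hΛ : supportCard Λ ≤ S
  · have e : {W : 𝒩.Param | (Λ, W) ∈ 𝒩.sieve S b} =
        ⋂ k : 𝒩.Idx, {W | Λ k = true → |W k| ≤ b} := by
      ext W; simp [sieve, hΛ]
    rw [e]
    refine MeasurableSet.iInter fun k => ?_
    by_cases hk : Λ k = true
    · simp only [hk, forall_const]
      exact measurableSet_le (measurable_pi_apply k).abs measurable_const
    · simp [hk]
  · have e : {W : 𝒩.Param | (Λ, W) ∈ 𝒩.sieve S b} = ∅ := by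
      ext W; simp [sieve, hΛ]
    rw [e]; exact MeasurableSet.empty

theorem slabMeasure_eval {ρ₀ : ℝ} (hρ : 0 < ρ₀) (Λ : 𝒩.Idx → Bool) (k : 𝒩.Idx) (s : Set ℝ)
    (hs : MeasurableSet s) :
    slabMeasure ρ₀ Λ {W | W k ∈ s} = gaussMeasure (if Λ k then 1 else ρ₀) s := by
  have := isProbabilityMeasure_precision hρ Λ
  exact (measurePreserving_eval (fun k => gaussMeasure (if Λ k then 1 else ρ₀)) k).measure_preimage
    hs.nullMeasurableSet

theorem priorMeasure_compl_sieve_le {u ρ₀ : ℝ} (hρ : 0 < ρ₀) (hu : 1 ≤ u)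
    (hq : 1 ≤ 𝒩.numParams) (S : ℕ) {b : ℝ} (hb : 0 ≤ b) :
    𝒩.priorMeasure u ρ₀ (𝒩.sieve S b)ᶜ ≤ ENNReal.ofReal
      (3 * (1 / (𝒩.numParams : ℝ)) ^ S + 6 * 𝒩.numParams * Real.exp (-(b ^ 2 / 2))) := by
  have hprob := isProbabilityMeasure_slabMeasure (𝒩 := 𝒩) hρ
  have hq' : (1 : ℝ) ≤ 𝒩.numParams := by exact_mod_cast hq
  set x : ℝ := 1 / (𝒩.numParams : ℝ) with hx
  have hx0 : 0 ≤ x := by positivity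
  have hx1 : x ≤ 1 := by rw [hx, div_le_one (by linarith)]; exact hq'
  set t : ℝ := 𝒩.numParams * (2 * Real.exp (-(b ^ 2 / 2))) with ht
  have ht0 : 0 ≤ t := by positivity
  have key : ∀ Λ : 𝒩.Idx → Bool, ENNReal.ofReal (supportWeight u Λ) *
      slabMeasure ρ₀ Λ {W | (Λ, W) ∈ (𝒩.sieve S b)ᶜ} ≤
        ENNReal.ofReal (x ^ supportCard Λ * (x ^ S + t)) := fun Λ => by
    have hw := supportWeight_le hu hq Λ
    rw [← hx] at hw
    by_cases hΛ : supportCard Λ ≤ S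
    · have h1 : slabMeasure ρ₀ Λ {W | (Λ, W) ∈ (𝒩.sieve S b)ᶜ} ≤ ENNReal.ofReal t := by
        have hsub : {W | (Λ, W) ∈ (𝒩.sieve S b)ᶜ} ⊆
            ⋃ k : 𝒩.Idx, {W : 𝒩.Param | Λ k = true ∧ b < |W k|} := by
          intro W hW
          by_contra hcon
          refine hW ⟨hΛ, fun k hk => ?_⟩
          by_contra hlt
          exact hcon (Set.mem_iUnion.2 ⟨k, hk, not_le.1 hlt⟩)
        refine (measure_mono hsub).trans ((measure_iUnion_fintype_le _ _).trans ?_)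
        refine (Finset.sum_le_sum (g := fun _ =>
          ENNReal.ofReal (2 * Real.exp (-(b ^ 2 / 2)))) fun k _ => ?_).trans ?_
        · by_cases hk : Λ k = true
          · have h2 := slabMeasure_eval hρ Λ k {t | b < |t|}
              (measurableSet_lt measurable_const measurable_id.abs)
            rw [if_pos hk] at h2
            refine (measure_mono fun W hW => ?_).trans (h2.le.trans (gaussMeasure_tail_le hb))
            exact hW.2
          · simp [hk]
        · rw [Finset.sum_const, Finset.card_univ, card_idx, nsmul_eq_mul, ht,
            ENNReal.ofReal_mul (Nat.cast_nonneg _), ENNReal.ofReal_natCast]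
      refine (mul_le_mul' (ENNReal.ofReal_le_ofReal hw) h1).trans ?_
      rw [← ENNReal.ofReal_mul (by positivity)]
      refine ENNReal.ofReal_le_ofReal ?_
      have : x ^ supportCard Λ ≤ 1 := pow_le_one₀ hx0 hx1
      calc x ^ supportCard Λ * x ^ supportCard Λ * t ≤ x ^ supportCard Λ * 1 * t := by gcongr
        _ ≤ x ^ supportCard Λ * (x ^ S + t) := by
          rw [mul_one]; gcongr; linarith [pow_nonneg hx0 S]
    · refine (mul_le_of_le_one_right' prob_le_one).trans (ENNReal.ofReal_le_ofReal (hw.trans ?_))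
      have : x ^ supportCard Λ ≤ x ^ S := pow_le_pow_of_le_one hx0 hx1 (by omega)
      gcongr
      linarith
  rw [priorMeasure_apply hρ (measurableSet_sieve S b).compl]
  refine (Finset.sum_le_sum fun Λ _ => key Λ).trans ?_
  rw [← ENNReal.ofReal_sum_of_nonneg fun _ _ => by positivity, ← Finset.sum_mul]
  refine ENNReal.ofReal_le_ofReal ?_
  calc _ ≤ 3 * (x ^ S + t) := by gcongr; exact sum_inv_pow_supportCard_le hq
    _ = _ := by rw [ht]; ring

/-- The parameters with support `Λ` that are `η`-close to `W₀` on it. -/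
def supportBall (Λ : 𝒩.Idx → Bool) (W₀ : 𝒩.Param) (η : ℝ) : Set 𝒩.Theta :=
  {θ | θ.1 = Λ ∧ ∀ k, Λ k = true → |θ.2 k - W₀ k| ≤ η}

theorem measurableSet_supportBall (Λ : 𝒩.Idx → Bool) (W₀ : 𝒩.Param) (η : ℝ) :
    MeasurableSet (supportBall Λ W₀ η) := by
  refine measurableSet_of_forall_section fun Λ' => ?_
  by_cases hΛ : Λ' = Λ
  · have e : {W : 𝒩.Param | (Λ', W) ∈ supportBall Λ W₀ η} =
        ⋂ k : 𝒩.Idx, {W | Λ k = true → |W k - W₀ k| ≤ η} := by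
      ext W; simp [supportBall, hΛ]
    rw [e]
    refine MeasurableSet.iInter fun k => ?_
    by_cases hk : Λ k = true
    · simp only [hk, forall_const]
      exact measurableSet_le ((measurable_pi_apply k).sub_const _).abs measurable_const
    · simp [hk]
  · have e : {W : 𝒩.Param | (Λ', W) ∈ supportBall Λ W₀ η} = ∅ := by
      ext W; simp [supportBall, hΛ]
    rw [e]; exact MeasurableSet.empty

theorem priorMeasure_supportBall_ge {u ρ₀ : ℝ} (hρ : 0 < ρ₀) (Λ : 𝒩.Idx → Bool)
    {W₀ : 𝒩.Param} (hW₀ : ∀ k, |W₀ k| ≤ 1) {η : ℝ} (hη0 : 0 ≤ η) (hη : η ≤ 1) :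
    ENNReal.ofReal (supportWeight u Λ * (η / 10) ^ supportCard Λ) ≤
      𝒩.priorMeasure u ρ₀ (supportBall Λ W₀ η) := by
  have := isProbabilityMeasure_precision hρ Λ
  rw [priorMeasure_apply hρ (measurableSet_supportBall Λ W₀ η)]
  refine le_trans ?_ (Finset.single_le_sum (fun _ _ => zero_le) (Finset.mem_univ Λ))
  rw [ENNReal.ofReal_mul (supportWeight_nonneg _ _)]
  refine mul_le_mul_right ?_ _
  have e : {W : 𝒩.Param | (Λ, W) ∈ supportBall Λ W₀ η} =
      Set.univ.pi fun k => {t | Λ k = true → |t - W₀ k| ≤ η} := by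
    ext W; simp [supportBall]
  rw [e, slabMeasure, Measure.pi_pi]
  calc ENNReal.ofReal ((η / 10) ^ supportCard Λ)
      = ∏ k, if Λ k = true then ENNReal.ofReal (η / 10) else 1 := by
        rw [Finset.prod_ite, Finset.prod_const, Finset.prod_const_one, mul_one,
          ENNReal.ofReal_pow (by positivity), supportCard]
    _ ≤ _ := by
        refine Finset.prod_le_prod' fun k _ => ?_
        by_cases hk : Λ k = true
        · simp only [hk, if_true, forall_const]
          exact gaussMeasure_ball_ge (hW₀ k) hη
        · have h1 := (this k).measure_univ
          simp only [hk] at h1 ⊢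
          simpa using h1.ge

/-- The posterior in terms of likelihood ratios with respect to an arbitrary regression vector
`c`. -/
theorem posterior_apply {dy n : ℕ} {P : InverseProblem d dy} (T : ℕ) (σ u ρ₀ : ℝ)
    (D : Fin n → E d × E dy) (c : Fin n → E d)
    (hgdn : ∀ y, Measurable fun W => 𝒩.gdn P T W y) {S : Set 𝒩.Theta} (hS : MeasurableSet S) :
    𝒩.posterior P T σ u ρ₀ D S =
      (∫⁻ θ, ENNReal.ofReal (Real.exp (logRatio σ (fun i => 𝒩.gdn P T (𝒩.mask θ) (D i).2 - c i)
        fun i => (D i).1 - c i)) ∂𝒩.priorMeasure u ρ₀)⁻¹ *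
      ∫⁻ θ in S, ENNReal.ofReal (Real.exp (logRatio σ
        (fun i => 𝒩.gdn P T (𝒩.mask θ) (D i).2 - c i) fun i => (D i).1 - c i))
          ∂𝒩.priorMeasure u ρ₀ := by
  set Z : 𝒩.Theta → ℝ := fun θ => logRatio σ (fun i => 𝒩.gdn P T (𝒩.mask θ) (D i).2 - c i)
        fun i => (D i).1 - c i with hZ
  have hZm : Measurable Z := by
    refine measurable_logRatio (measurable_pi_lambda _ fun i => ?_) measurable_const
    exact ((hgdn _).comp measurable_mask).sub_const _
  have hpm : Measurable fun θ => ENNReal.ofReal (𝒩.priorDensity u ρ₀ θ) :=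
    (measurable_priorDensity u ρ₀).ennreal_ofReal
  have hp0 : ∀ θ, 0 ≤ 𝒩.priorDensity u ρ₀ θ := fun θ => by
    unfold priorDensity
    exact mul_nonneg (by positivity) (Finset.prod_nonneg fun k _ => gaussDensity_nonneg _ _)
  set C : ℝ≥0∞ := ENNReal.ofReal (Real.exp (-(1 / (2 * σ ^ 2) * ∑ i, ‖(D i).1 - c i‖ ^ 2))) with hC
  have hC0 : C ≠ 0 := by simp [hC, Real.exp_pos]
  have hCt : C ≠ ∞ := ENNReal.ofReal_ne_top
  have hpost : ∀ θ, ENNReal.ofReal (𝒩.postDensity P T σ u ρ₀ D θ) =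
      C * (ENNReal.ofReal (𝒩.priorDensity u ρ₀ θ) * ENNReal.ofReal (Real.exp (Z θ))) := fun θ => by
    rw [mul_left_comm, hC, ← ENNReal.ofReal_mul (Real.exp_nonneg _), ← Real.exp_add,
      ← ENNReal.ofReal_mul (hp0 θ), postDensity]
    congr 3
    simp only [hZ, logRatio]
    have e : ∀ i, ‖(D i).1 - 𝒩.gdn P T (𝒩.mask θ) (D i).2‖ ^ 2 = ‖(D i).1 - c i‖ ^ 2 -
        2 * inner ℝ (𝒩.gdn P T (𝒩.mask θ) (D i).2 - c i) ((D i).1 - c i) +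
        ‖𝒩.gdn P T (𝒩.mask θ) (D i).2 - c i‖ ^ 2 := fun i => by
      rw [← real_inner_comm, ← norm_sub_sq_real]; congr 2; abel
    simp_rw [e]
    rw [Finset.sum_add_distrib, Finset.sum_sub_distrib, ← Finset.mul_sum]
    by_cases hσ : σ = 0
    · simp [hσ]
    · field_simp; ring
  have hint : ∀ S : Set 𝒩.Theta, MeasurableSet S →
      ∫⁻ θ in S, ENNReal.ofReal (𝒩.postDensity P T σ u ρ₀ D θ) ∂𝒩.refMeasure =
      C * ∫⁻ θ in S, ENNReal.ofReal (Real.exp (Z θ)) ∂𝒩.priorMeasure u ρ₀ := fun S hS => by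
    simp_rw [hpost]
    have hmm : Measurable fun θ => ENNReal.ofReal (𝒩.priorDensity u ρ₀ θ) *
      ENNReal.ofReal (Real.exp (Z θ)) := by fun_prop
    rw [lintegral_const_mul _ hmm, priorMeasure,
      setLIntegral_withDensity_eq_setLIntegral_mul _ hpm (by fun_prop) hS]
    rfl
  have htot := hint Set.univ MeasurableSet.univ
  rw [Measure.restrict_univ, Measure.restrict_univ] at htot
  rw [posterior, Measure.smul_apply, withDensity_apply _ hS, smul_eq_mul, htot, hint S hS,
    ENNReal.mul_inv (Or.inl hC0) (Or.inl hCt)]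
  rw [mul_mul_mul_comm, ENNReal.inv_mul_cancel hC0 hCt, one_mul]

end Network

/-! ### Contraction for unrolled networks -/

section Errors

variable {dx dy n : ℕ} (P : InverseProblem dx dy)

/-- The errors `xᵢ - E[xᵢ | yᵢ]` of a sample. -/
noncomputable def InverseProblem.errors (D : Fin n → E dx × E dy) : Fin n → E dx :=
  fun i => (D i).1 - P.condMean (D i).2

/-- The law of the sample on the event that the design lies in `B`. -/
noncomputable def InverseProblem.lawOn (B : Set (Fin n → E dy)) :
    Measure (Fin n → E dx × E dy) :=
  (Measure.pi fun _ : Fin n => P.jointLaw).restrict {D | (fun i => (D i).2) ∈ B}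

variable {P}

theorem measurable_design : Measurable fun (D : Fin n → E dx × E dy) i => (D i).2 := by
  fun_prop

theorem InverseProblem.measurable_errors (hR : Measurable P.R)
    (hf : Measurable (Function.uncurry P.f)) : Measurable (P.errors (n := n)) := by
  refine measurable_pi_lambda _ fun i => Measurable.sub ?_ ?_
  · exact measurable_fst.comp (measurable_pi_apply i)
  · exact (measurable_condMean hR hf).comp (measurable_snd.comp (measurable_pi_apply i))

theorem InverseProblem.lawOn_univ (B : Set (Fin n → E dy)) :
    P.lawOn B Set.univ = Measure.pi (fun _ : Fin n => P.jointLaw) {D | (fun i => (D i).2) ∈ B} := by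
  rw [lawOn, Measure.restrict_apply_univ]

theorem InverseProblem.ErrorModel.subGaussianErrors {σbar : ℝ} (hE : P.ErrorModel σbar)
    (hR : Measurable P.R) {B : Set (Fin n → E dy)} (hB : MeasurableSet B) :
    SubGaussianErrors (P.lawOn B) (fun D i => (D i).2) P.errors σbar := fun v hv => by
  rw [lawOn_univ]
  exact hE.setLIntegral_exp_inner_le hR hB hv

end Errors

namespace Network

variable {d dy n : ℕ} {𝒩 : Network d} {P : InverseProblem d dy}

/-- The deviation of the unrolled network from the regression function, at the design points. -/
noncomputable def deviation (P : InverseProblem d dy) (T : ℕ)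
    (p : 𝒩.Theta × (Fin n → E dy)) : Fin n → E d :=
  fun i => 𝒩.gdn P T (𝒩.mask p.1) (p.2 i) - P.condMean (p.2 i)

theorem measurable_deviation (hR : Measurable P.R) (hf : Measurable (Function.uncurry P.f))
    (hd : ∀ y, Differentiable ℝ (P.f y)) (T : ℕ) :
    Measurable (𝒩.deviation P T (n := n)) := by
  refine measurable_pi_lambda _ fun i => Measurable.sub ?_ ?_
  · exact (measurable_gdn hf hd T).comp ((measurable_mask.comp measurable_fst).prodMk
      ((measurable_pi_apply i).comp measurable_snd))
  · exact (InverseProblem.measurable_condMean hR hf).comp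
      ((measurable_pi_apply i).comp measurable_snd)

/-- The support of a parameter vector. -/
noncomputable def support (W : 𝒩.Param) : 𝒩.Idx → Bool := fun k => decide (W k ≠ 0)

theorem supportCard_support (W : 𝒩.Param) : supportCard (support W) = 𝒩.sparsity W := by
  classical
  unfold supportCard sparsity support
  simp only [decide_eq_true_eq]

/-- On the prior neighbourhood `supportBall` of a reference network, unrolled networks are as
accurate as the reference one, up to `1 / n`. -/
theorem norm_gdn_mask_sub_le {L : ℝ} (hP : P.ConvexModel L) (hq : 1 ≤ 𝒩.numParams)
    {W₀ : 𝒩.Param} (hW₀ : ∀ k, |W₀ k| ≤ 1) {η c : ℝ} (hη0 : 0 ≤ η) (hη : η ≤ 1) {T : ℕ}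
    (hηT : T * 𝒩.depth * η * (2 * (𝒩.numParams * 2) ^ 𝒩.depth) ^ T * (‖P.x₀‖ + c) ≤ 1 / n)
    {θ : 𝒩.Theta} (hθ : θ ∈ supportBall (support W₀) W₀ η) {y : E dy}
    (hc : ‖P.gradStep y 0‖ ≤ c) :
    ‖𝒩.gdn P T (𝒩.mask θ) y - 𝒩.gdn P T W₀ y‖ ≤ 1 / n := by
  have hdiff : ∀ k, |𝒩.mask θ k - W₀ k| ≤ η := fun k => by
    rw [mask, hθ.1]
    by_cases hk : W₀ k = 0
    · simp [support, hk, hη0]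
    · have hk' : support W₀ k = true := by simpa [support] using hk
      rw [if_pos hk']
      exact hθ.2 k hk'
  refine (norm_gdn_sub_le hP one_le_two hη0 hq (fun k => ?_) (fun k => (hW₀ k).trans one_le_two)
    hdiff hc T).trans hηT
  have := abs_add_le (𝒩.mask θ k - W₀ k) (W₀ k)
  rw [sub_add_cancel] at this
  linarith [hdiff k, hW₀ k]

/-- What the argument needs of the reference network `W₀`: it is `e₀`-accurate on the designs in
`B`, and its neighbourhood of radius `η` has prior mass at least `exp (-b)` and carries squared
deviations at most `a`. The number `c` bounds the gradient steps from `0`. -/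
structure ReferenceBounds (P : InverseProblem d dy) (B : Set (Fin n → E dy)) (T : ℕ) (u : ℝ)
    (W₀ : 𝒩.Param) (η c e₀ a b : ℝ) : Prop where
  abs_le : ∀ k, |W₀ k| ≤ 1
  radius_nonneg : 0 ≤ η
  radius_le : η ≤ 1
  lipschitz_mul_radius_le :
    T * 𝒩.depth * η * (2 * (𝒩.numParams * 2) ^ 𝒩.depth) ^ T * (‖P.x₀‖ + c) ≤ 1 / n
  gradStep_le : ∀ y ∈ B, ∀ i, ‖P.gradStep (y i) 0‖ ≤ c
  accuracy_le : ∀ y ∈ B, ∀ i, ‖𝒩.gdn P T W₀ (y i) - P.g (y i)‖ ≤ e₀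
  sq_deviation_le : n * (1 / n + e₀) ^ 2 ≤ a
  exp_le_mass : Real.exp (-b) ≤ supportWeight u (support W₀) * (η / 10) ^ 𝒩.sparsity W₀

/-- Contraction of the posterior, given the control of the numerator on the set `Θ₀` of
parameters outside of the event `E₀`. -/
theorem measure_posterior_gt_le_of_numerator {L σbar σ u ρ₀ : ℝ} (hP : P.ConvexModel L)
    (hσbar : 0 < σbar) (hE : P.ErrorModel σbar) (hσ : σbar ≤ σ) (hu : 1 ≤ u) (hρ : 0 < ρ₀)
    (hq : 4 ≤ 𝒩.numParams) {B : Set (Fin n → E dy)} (hB : MeasurableSet B)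
    {W₀ : 𝒩.Param} {η c e₀ a b : ℝ} {T : ℕ} (hW : ReferenceBounds P B T u W₀ η c e₀ a b)
    {Θ₀ : Set 𝒩.Theta} (hΘ₀ : MeasurableSet Θ₀)
    (hΘm : 𝒩.priorMeasure u ρ₀ Θ₀ᶜ ≤ ENNReal.ofReal
      (9 * Real.exp (-(a / σ ^ 2 + b + 5 * Real.log 𝒩.numParams))))
    {r w : ℝ} (hw : a / σ ^ 2 + b + 3 * Real.log 𝒩.numParams ≤ w)
    {E₀ : Set (Fin n → E d × E dy)}
    (hE₀ : P.lawOn B E₀ ≤ 2 * ENNReal.ofReal ((𝒩.numParams : ℝ) ^ 2)⁻¹ * P.lawOn B Set.univ)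
    (hE₀' : ∀ D ∉ E₀, (fun i => (D i).2) ∈ B → ∀ θ ∈ Θ₀,
      r < ∑ i, ‖𝒩.deviation P T (θ, fun i => (D i).2) i‖ ^ 2 →
      logRatio σ (𝒩.deviation P T (θ, fun i => (D i).2)) (P.errors D) ≤ -w) :
    Measure.pi (fun _ : Fin n => P.jointLaw) {D | (fun i => (D i).2) ∈ B ∧
        12 / (𝒩.numParams : ℝ≥0∞) < 𝒩.posterior P T σ u ρ₀ D
          {θ | r < ∑ i, ‖𝒩.gdn P T (𝒩.mask θ) (D i).2 - P.g (D i).2‖ ^ 2}} ≤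
      ENNReal.ofReal (1 / 𝒩.numParams) *
        Measure.pi (fun _ : Fin n => P.jointLaw) {D | (fun i => (D i).2) ∈ B} := by
  obtain ⟨hW₀, hη0, hη, hηT, hc, he₀, ha, hb⟩ := hW
  have hR : Measurable P.R := hP.convex_R.locallyLipschitz.continuous.measurable
  have hq1 : 1 ≤ 𝒩.numParams := by omega
  have hq4 : (4 : ℝ) ≤ 𝒩.numParams := by exact_mod_cast hq
  have hq0 : (0 : ℝ) < 𝒩.numParams := by linarith
  have hprob := hE.isProbabilityMeasure_jointLaw hR
  have hfinP : IsFiniteMeasure (P.lawOn B) := by unfold InverseProblem.lawOn; infer_instance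
  have hπ3 := priorMeasure_univ_le (𝒩 := 𝒩) hρ hu hq1
  have hfinπ : IsFiniteMeasure (𝒩.priorMeasure u ρ₀) := ⟨hπ3.trans_lt (by norm_num)⟩
  have hdev := measurable_deviation (𝒩 := 𝒩) (n := n) hR hE.measurable_f hP.differentiable_f T
  set 𝓑 : Set (Fin n → E dy) := {y | y ∈ B ∧ ∀ i, P.g (y i) = P.condMean (y i)} with h𝓑
  have hBm : MeasurableSet {D : Fin n → E d × E dy | (fun i => (D i).2) ∈ B} :=
    measurable_design hB
  have hgc := hE.condMean_eq n
  have h𝓑ae : ∀ᵐ D ∂P.lawOn B, (fun i => (D i).2) ∈ 𝓑 := by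
    rw [InverseProblem.lawOn]
    filter_upwards [ae_restrict_mem hBm, ae_restrict_of_ae hgc] with D h1 h2
    exact ⟨h1, h2⟩
  set A := supportBall (support W₀) W₀ η with hAdef
  have hApos : ENNReal.ofReal (Real.exp (-b)) ≤ 𝒩.priorMeasure u ρ₀ A := by
    refine (ENNReal.ofReal_le_ofReal hb).trans ?_
    rw [← supportCard_support]
    exact priorMeasure_supportBall_ge hρ _ hW₀ hη0 hη
  have hA0 : 𝒩.priorMeasure u ρ₀ A ≠ 0 := fun h0 => by
    rw [h0, nonpos_iff_eq_zero, ENNReal.ofReal_eq_zero] at hApos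
    exact absurd hApos (not_le.2 (Real.exp_pos _))
  have hAa : ∀ θ ∈ A, ∀ y ∈ 𝓑, ∑ i, ‖𝒩.deviation P T (θ, y) i‖ ^ 2 ≤ a := by
    intro θ hθ y hy
    refine le_trans ?_ ha
    refine (Finset.sum_le_sum (g := fun _ => (1 / (n : ℝ) + e₀) ^ 2) fun i _ => ?_).trans
      (by simp)
    refine pow_le_pow_left₀ (norm_nonneg _) ?_ 2
    have h1 := norm_gdn_mask_sub_le hP hq1 hW₀ hη0 hη hηT hθ (hc y hy.1 i)
    have h2 := norm_add_le (𝒩.gdn P T (𝒩.mask θ) (y i) - 𝒩.gdn P T W₀ (y i))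
      (𝒩.gdn P T W₀ (y i) - P.g (y i))
    rw [sub_add_sub_cancel, hy.2 i] at h2
    have h3 := he₀ y hy.1 i
    rw [hy.2 i] at h3
    exact h2.trans (add_le_add h1 h3)
  set q : ℝ := (𝒩.numParams : ℝ) with hqdef
  have hlog : Real.exp (Real.log q) = q := Real.exp_log hq0
  have hκ : ENNReal.ofReal (q ^ 2 * Real.exp (a / σ ^ 2)) *
      (ENNReal.ofReal (q ^ 2) * ENNReal.ofReal
        (9 * Real.exp (-(a / σ ^ 2 + b + 5 * Real.log q))) +
        ENNReal.ofReal (Real.exp (-w)) * 𝒩.priorMeasure u ρ₀ Set.univ) ≤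
      12 / (𝒩.numParams : ℝ≥0∞) * 𝒩.priorMeasure u ρ₀ A := by
    have e12 : 12 / (𝒩.numParams : ℝ≥0∞) = ENNReal.ofReal (12 / q) := by
      rw [ENNReal.ofReal_div_of_pos hq0, hqdef, ENNReal.ofReal_natCast, ENNReal.ofReal_ofNat]
    rw [e12]
    refine le_trans ?_ (mul_le_mul_right hApos _)
    refine (mul_le_mul_right (add_le_add_right (mul_le_mul_right hπ3 _) _) _).trans ?_
    rw [← ENNReal.ofReal_ofNat 3, ← ENNReal.ofReal_mul (by positivity),
      ← ENNReal.ofReal_mul (by positivity), ← ENNReal.ofReal_add (by positivity) (by positivity),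
      ← ENNReal.ofReal_mul (by positivity), ← ENNReal.ofReal_mul (by positivity)]
    refine ENNReal.ofReal_le_ofReal ?_
    have h5 : Real.exp (-(a / σ ^ 2 + b + 5 * Real.log q)) =
        Real.exp (-(a / σ ^ 2)) * Real.exp (-b) * (q ^ 5)⁻¹ := by
      rw [← Real.exp_log (pow_pos hq0 5), ← Real.exp_neg, ← Real.exp_add, ← Real.exp_add,
        Real.log_pow]
      congr 1; push_cast; ring
    have h3 : Real.exp (-w) ≤ Real.exp (-(a / σ ^ 2)) * Real.exp (-b) * (q ^ 3)⁻¹ := by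
      rw [← Real.exp_log (pow_pos hq0 3), ← Real.exp_neg, ← Real.exp_add, ← Real.exp_add,
        Real.log_pow]
      refine Real.exp_le_exp.2 ?_
      push_cast; linarith
    have h0 : Real.exp (a / σ ^ 2) * Real.exp (-(a / σ ^ 2)) = 1 := by
      rw [← Real.exp_add, add_neg_cancel, Real.exp_zero]
    rw [h5]
    calc _ ≤ q ^ 2 * Real.exp (a / σ ^ 2) * (q ^ 2 * (9 * (Real.exp (-(a / σ ^ 2)) *
          Real.exp (-b) * (q ^ 5)⁻¹)) + Real.exp (-(a / σ ^ 2)) * Real.exp (-b) *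
            (q ^ 3)⁻¹ * 3) := by gcongr
      _ = (Real.exp (a / σ ^ 2) * Real.exp (-(a / σ ^ 2))) * (12 / q * Real.exp (-b)) := by
          field_simp; ring
      _ = _ := by rw [h0, one_mul]
  have hmain := measure_posterior_gt_le (P := P.lawOn B) measurable_design
    (InverseProblem.measurable_errors hR hE.measurable_f) (hE.subGaussianErrors hR hB) hσbar hσ
    hdev h𝓑ae (measurableSet_supportBall _ _ _) hA0 hAa hΘ₀
    (by simp [Real.exp_pos]) ENNReal.ofReal_ne_top hΘm hE₀
    (fun D hD hy => hE₀' D hD hy.1) (pow_pos hq0 2) hκ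
  rw [InverseProblem.lawOn_univ] at hmain
  refine le_trans ?_ (hmain.trans (mul_le_mul_left ?_ _))
  · rw [InverseProblem.lawOn, Measure.restrict_apply' hBm]
    refine measure_mono_ae ?_
    filter_upwards [hgc] with D hD hbad
    refine ⟨?_, hbad.1⟩
    have h2 := hbad.2
    have hS : MeasurableSet
        {θ : 𝒩.Theta | r < ∑ i, ‖𝒩.gdn P T (𝒩.mask θ) (D i).2 - P.g (D i).2‖ ^ 2} := by
      refine measurableSet_lt measurable_const (Finset.measurable_sum _ fun i _ => ?_)
      have h3 : Measurable fun θ : 𝒩.Theta => 𝒩.gdn P T (𝒩.mask θ) (D i).2 :=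
        (measurable_gdn hE.measurable_f hP.differentiable_f T).comp
          (measurable_mask.prodMk measurable_const)
      exact (h3.sub_const _).norm.pow_const 2
    rw [posterior_apply T σ u ρ₀ D (fun i => P.condMean (D i).2)
      (fun y => (measurable_gdn hE.measurable_f hP.differentiable_f T).comp
        (measurable_id.prodMk measurable_const)) hS] at h2
    simp only [hD] at h2
    exact h2
  · have e : (2 : ℝ≥0∞) = ENNReal.ofReal 2 := (ENNReal.ofReal_ofNat 2).symm
    rw [e, ← ENNReal.ofReal_mul (by norm_num), ← ENNReal.ofReal_add (by positivity) (by positivity)]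
    refine ENNReal.ofReal_le_ofReal ?_
    rw [← two_mul, ← mul_assoc, ← div_eq_mul_inv, div_le_div_iff₀ (by positivity) hq0]
    nlinarith

/-! ### Covering the sieve by a grid -/

/-- Index set of the grid: a support with at most `S` entries, and one of `M` values for each entry
of the support. -/
abbrev Grid (𝒩 : Network d) (S M : ℕ) : Type :=
  (Λ : {Λ : 𝒩.Idx → Bool // supportCard Λ ≤ S}) × ({k // Λ.1 k = true} → Fin M)

/-- The parameter vector of a grid point: the values are `-b, -b + η, -b + 2η, …`. -/
noncomputable def gridParam {S M : ℕ} (b η : ℝ) (j : 𝒩.Grid S M) : 𝒩.Param := fun k =>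
  if h : j.1.1 k = true then -b + (j.2 ⟨k, h⟩ : ℕ) * η else 0

theorem card_grid_le (hq : 1 ≤ 𝒩.numParams) (S M : ℕ) (hM : 1 ≤ M) :
    (Fintype.card (𝒩.Grid S M) : ℝ) ≤ 3 * ((𝒩.numParams : ℝ) * M) ^ S := by
  classical
  have hq' : (1 : ℝ) ≤ 𝒩.numParams := by exact_mod_cast hq
  have hM' : (1 : ℝ) ≤ M := by exact_mod_cast hM
  have hcard : ∀ Λ : 𝒩.Idx → Bool,
      (Fintype.card ({k // Λ k = true} → Fin M) : ℝ) = (M : ℝ) ^ supportCard Λ := fun Λ => by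
    rw [Fintype.card_fun, Fintype.card_fin, Fintype.card_subtype, supportCard]
    push_cast; rfl
  have key : ∀ Λ : {Λ : 𝒩.Idx → Bool // supportCard Λ ≤ S}, (M : ℝ) ^ supportCard Λ.1 ≤
      ((𝒩.numParams : ℝ) * M) ^ S * (1 / (𝒩.numParams : ℝ)) ^ supportCard Λ.1 := fun Λ => by
    calc (M : ℝ) ^ supportCard Λ.1 = ((𝒩.numParams : ℝ) * M) ^ supportCard Λ.1 *
          (1 / (𝒩.numParams : ℝ)) ^ supportCard Λ.1 := by
          rw [← mul_pow]; congr 1; field_simp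
      _ ≤ _ := by
          gcongr
          · nlinarith
          · exact Λ.2
  rw [Fintype.card_sigma]
  push_cast
  simp_rw [hcard]
  refine (Finset.sum_le_sum fun Λ _ => key Λ).trans ?_
  rw [← Finset.mul_sum, mul_comm 3]
  gcongr
  refine le_trans ?_ (sum_inv_pow_supportCard_le hq)
  refine (Finset.sum_map Finset.univ (Function.Embedding.subtype _)
    fun Λ : 𝒩.Idx → Bool => (1 / (𝒩.numParams : ℝ)) ^ supportCard Λ).symm.le.trans ?_
  exact Finset.sum_le_sum_of_subset_of_nonneg (Finset.subset_univ _) fun _ _ _ => by positivity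

theorem exists_gridParam_close {S M : ℕ} {b η : ℝ} (hη : 0 < η) (hM : 2 * b / η < M)
    {θ : 𝒩.Theta} (hθ : θ ∈ 𝒩.sieve S b) :
    ∃ j : 𝒩.Grid S M, ∀ k, |𝒩.mask θ k - gridParam b η j k| ≤ η := by
  have hfl : ∀ k : {k // θ.1 k = true}, ⌊(θ.2 k + b) / η⌋₊ < M := fun k => by
    have h1 := abs_le.1 (hθ.2 k.1 k.2)
    have h2 : (⌊(θ.2 k + b) / η⌋₊ : ℝ) ≤ (θ.2 k + b) / η :=
      Nat.floor_le (div_nonneg (by linarith) hη.le)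
    have h3 : (θ.2 k + b) / η ≤ 2 * b / η := by gcongr; linarith
    exact_mod_cast (h2.trans h3).trans_lt hM
  refine ⟨⟨⟨θ.1, hθ.1⟩, fun k => ⟨_, hfl k⟩⟩, fun k => ?_⟩
  by_cases hk : θ.1 k = true
  · have h1 := abs_le.1 (hθ.2 k hk)
    have h2 : (⌊(θ.2 k + b) / η⌋₊ : ℝ) ≤ (θ.2 k + b) / η :=
      Nat.floor_le (div_nonneg (by linarith) hη.le)
    have h3 := Nat.lt_floor_add_one ((θ.2 k + b) / η)
    rw [le_div_iff₀ hη] at h2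
    rw [div_lt_iff₀ hη] at h3
    simp only [mask, gridParam, hk, if_true, dif_pos]
    rw [abs_le]
    constructor <;> linarith
  · simp [mask, gridParam, hk, hη.le]

theorem abs_gridParam_le {S M : ℕ} {b η : ℝ} (hb : 0 ≤ b) (hη : 0 < η)
    (hM : (M : ℝ) ≤ 2 * b / η + 1)
    (j : 𝒩.Grid S M) (k : 𝒩.Idx) : |gridParam b η j k| ≤ b := by
  unfold gridParam
  split_ifs with h
  · have h1 : ((j.2 ⟨k, h⟩ : ℕ) : ℝ) + 1 ≤ M := by exact_mod_cast (j.2 ⟨k, h⟩).2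
    have h2 : ((j.2 ⟨k, h⟩ : ℕ) : ℝ) ≤ 2 * b / η := by linarith
    rw [le_div_iff₀ hη] at h2
    rw [abs_le]
    constructor
    · have : 0 ≤ ((j.2 ⟨k, h⟩ : ℕ) : ℝ) * η := by positivity
      linarith
    · linarith
  · simpa using hb

/-- Contraction at a radius so large that the size of the noise is negligible: no covering is
needed. -/
theorem measure_posterior_gt_le_of_large {L σbar σ u ρ₀ : ℝ} (hd : 1 ≤ d) (hP : P.ConvexModel L)
    (hσbar : 0 < σbar) (hE : P.ErrorModel σbar) (hσ : σbar ≤ σ) (hu : 1 ≤ u) (hρ : 0 < ρ₀)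
    (hq : 4 ≤ 𝒩.numParams) {B : Set (Fin n → E dy)} (hB : MeasurableSet B)
    {W₀ : 𝒩.Param} {η c e₀ a b : ℝ} {T : ℕ} (hW : ReferenceBounds P B T u W₀ η c e₀ a b)
    {τ r : ℝ} (hτ : SubGaussianErrors.expMomentBound d σbar ^ n * Real.exp (-(τ * n)) ≤
      ((𝒩.numParams : ℝ) ^ 2)⁻¹) (hr : 16 * (τ * n) ^ 2 ≤ r)
    (hr' : a / σ ^ 2 + b + 3 * Real.log 𝒩.numParams ≤ r / 4 / σ ^ 2) :
    Measure.pi (fun _ : Fin n => P.jointLaw) {D | (fun i => (D i).2) ∈ B ∧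
        12 / (𝒩.numParams : ℝ≥0∞) < 𝒩.posterior P T σ u ρ₀ D
          {θ | r < ∑ i, ‖𝒩.gdn P T (𝒩.mask θ) (D i).2 - P.g (D i).2‖ ^ 2}} ≤
      ENNReal.ofReal (1 / 𝒩.numParams) *
        Measure.pi (fun _ : Fin n => P.jointLaw) {D | (fun i => (D i).2) ∈ B} := by
  have hR : Measurable P.R := hP.convex_R.locallyLipschitz.continuous.measurable
  refine measure_posterior_gt_le_of_numerator hP hσbar hE hσ hu hρ hq hB hW
    (Θ₀ := Set.univ) MeasurableSet.univ (by simp) hr' (E₀ := {D | τ * n < ∑ i, ‖P.errors D i‖})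
    ?_ fun D hD _ θ _ hlt => ?_
  · refine ((hE.subGaussianErrors hR hB).measure_sum_norm_gt_le
      (InverseProblem.measurable_errors hR hE.measurable_f) hd (τ * n)).trans
        (mul_le_mul_left ((ENNReal.ofReal_le_ofReal hτ).trans ?_) _)
    rw [two_mul]; exact le_self_add
  · exact logRatio_le_of_large (hσbar.trans_le hσ) (not_lt.1 hD) hlt hr

/-- Contraction by covering the sieve by a grid. -/
theorem measure_posterior_gt_le_of_grid {L σbar σ u ρ₀ : ℝ} (hd : 1 ≤ d) (hn : 1 ≤ n)
    (hP : P.ConvexModel L)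
    (hσbar : 0 < σbar) (hE : P.ErrorModel σbar) (hσ : σbar ≤ σ) (hu : 1 ≤ u) (hρ : 0 < ρ₀)
    (hq : 4 ≤ 𝒩.numParams) {B : Set (Fin n → E dy)} (hB : MeasurableSet B)
    {W₀ : 𝒩.Param} {η c e₀ a b : ℝ} {T : ℕ} (hW : ReferenceBounds P B T u W₀ η c e₀ a b)
    {τ r : ℝ} (hτ : SubGaussianErrors.expMomentBound d σbar ^ n * Real.exp (-(τ * n)) ≤
      ((𝒩.numParams : ℝ) ^ 2)⁻¹)
    (hr : a / σ ^ 2 + b + 3 * Real.log 𝒩.numParams ≤ (r / 4 - τ - 1) / σ ^ 2)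
    {S M : ℕ} {b' η' : ℝ} (hb' : 1 ≤ b') (hη' : 0 < η') (hM : 2 * b' / η' < M)
    (hM' : (M : ℝ) ≤ 2 * b' / η' + 1)
    (hηT' : T * 𝒩.depth * η' * (2 * (𝒩.numParams * b') ^ 𝒩.depth) ^ T * (‖P.x₀‖ + c) ≤ 1 / n)
    (hS : a / σ ^ 2 + b + 5 * Real.log 𝒩.numParams ≤ S * Real.log 𝒩.numParams)
    (hbS : a / σ ^ 2 + b + 6 * Real.log 𝒩.numParams ≤ b' ^ 2 / 2)
    (hcov : 3 * ((𝒩.numParams : ℝ) * M) ^ S * Real.exp (-(r / (128 * σbar ^ 2))) ≤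
      ((𝒩.numParams : ℝ) ^ 2)⁻¹) :
    Measure.pi (fun _ : Fin n => P.jointLaw) {D | (fun i => (D i).2) ∈ B ∧
        12 / (𝒩.numParams : ℝ≥0∞) < 𝒩.posterior P T σ u ρ₀ D
          {θ | r < ∑ i, ‖𝒩.gdn P T (𝒩.mask θ) (D i).2 - P.g (D i).2‖ ^ 2}} ≤
      ENNReal.ofReal (1 / 𝒩.numParams) *
        Measure.pi (fun _ : Fin n => P.jointLaw) {D | (fun i => (D i).2) ∈ B} := by
  have hR : Measurable P.R := hP.convex_R.locallyLipschitz.continuous.measurable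
  have hq1 : 1 ≤ 𝒩.numParams := by omega
  have hq0 : (0 : ℝ) < 𝒩.numParams := by exact_mod_cast (by omega : 0 < 𝒩.numParams)
  have hb0 : 0 ≤ b' := by linarith
  have hM1 : 1 ≤ M := by
    have : (0 : ℝ) < M := lt_of_le_of_lt (by positivity) hM
    exact_mod_cast this
  set v : 𝒩.Grid S M → (Fin n → E dy) → Fin n → E d := fun j y i =>
    𝒩.gdn P T (gridParam b' η' j) (y i) - P.condMean (y i) with hv
  have hvm : ∀ j, Measurable (v j) := fun j => by
    refine measurable_pi_lambda _ fun i => Measurable.sub ?_ ?_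
    · exact (measurable_gdn hE.measurable_f hP.differentiable_f T).comp
        (measurable_const.prodMk (measurable_pi_apply i))
    · exact (InverseProblem.measurable_condMean hR hE.measurable_f).comp (measurable_pi_apply i)
  have hSG := hE.subGaussianErrors hR hB
  have herr := InverseProblem.measurable_errors (n := n) hR hE.measurable_f
  let E₁ : Set (Fin n → E d × E dy) := {D | τ * n < ∑ i, ‖P.errors D i‖}
  let E₂ : 𝒩.Grid S M → Set (Fin n → E d × E dy) := fun j =>
    {D | (∑ i, ‖v j (fun i => (D i).2) i‖ ^ 2 + r) / 16 <
      ∑ i, inner ℝ (v j (fun i => (D i).2) i) (P.errors D i)}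
  refine measure_posterior_gt_le_of_numerator hP hσbar hE hσ hu hρ hq hB hW
    (Θ₀ := 𝒩.sieve S b') (measurableSet_sieve S b') ?_ hr (E₀ := E₁ ∪ ⋃ j, E₂ j)
    ?_ fun D hD hDB θ hθ hlt => ?_
  · refine (priorMeasure_compl_sieve_le hρ hu hq1 S hb0).trans (ENNReal.ofReal_le_ofReal ?_)
    have h1 : (1 / (𝒩.numParams : ℝ)) ^ S ≤
        Real.exp (-(a / σ ^ 2 + b + 5 * Real.log 𝒩.numParams)) := by
      rw [← Real.exp_log (by positivity : (0 : ℝ) < (1 / (𝒩.numParams : ℝ)) ^ S), Real.log_pow,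
        one_div, Real.log_inv]
      exact Real.exp_le_exp.2 (by linarith)
    have h2 : 𝒩.numParams * Real.exp (-(b' ^ 2 / 2)) ≤
        Real.exp (-(a / σ ^ 2 + b + 5 * Real.log 𝒩.numParams)) := by
      nth_rewrite 1 [← Real.exp_log hq0]
      rw [← Real.exp_add]
      exact Real.exp_le_exp.2 (by linarith)
    linarith
  · have h1 : P.lawOn B E₁ ≤
        ENNReal.ofReal ((𝒩.numParams : ℝ) ^ 2)⁻¹ * P.lawOn B Set.univ :=
      (hSG.measure_sum_norm_gt_le herr hd (τ * n)).trans
        (mul_le_mul_left (ENNReal.ofReal_le_ofReal hτ) _)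
    have h2 : P.lawOn B (⋃ j, E₂ j) ≤
        ENNReal.ofReal ((𝒩.numParams : ℝ) ^ 2)⁻¹ * P.lawOn B Set.univ := by
      refine (measure_iUnion_fintype_le _ _).trans ((Finset.sum_le_sum fun j _ =>
        hSG.measure_inner_gt_le (hvm j) herr measurable_design hσbar r).trans ?_)
      rw [Finset.sum_const, Finset.card_univ, nsmul_eq_mul, ← mul_assoc,
        ← ENNReal.ofReal_natCast, ← ENNReal.ofReal_mul (Nat.cast_nonneg _)]
      refine mul_le_mul_left (ENNReal.ofReal_le_ofReal (le_trans ?_ hcov)) _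
      gcongr
      exact card_grid_le hq1 S M hM1
    refine (measure_union_le _ _).trans ((add_le_add h1 h2).trans (le_of_eq ?_))
    ring
  · obtain ⟨hD1, hD2⟩ := not_or.1 hD
    obtain ⟨j, hj⟩ := exists_gridParam_close hη' hM hθ
    have hD2j : D ∉ E₂ j := fun hmem => hD2 (Set.mem_iUnion.2 ⟨j, hmem⟩)
    refine logRatio_le_of_close (hσbar.trans_le hσ) hn (not_lt.1 hD1) hlt
      (h' := v j fun i => (D i).2) (fun i => ?_) (not_lt.1 hD2j)
    simp only [hv, deviation, sub_sub_sub_cancel_right]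
    refine (norm_gdn_sub_le hP hb' hη'.le hq1 (fun k => ?_) (abs_gridParam_le hb0 hη' hM' j) hj
      (hW.gradStep_le _ hDB i) T).trans hηT'
    by_cases hk : θ.1 k = true
    · simpa [mask, hk] using hθ.2 k hk
    · simpa [mask, hk] using hb0

end Network

/-! ### Budgets of the reference network -/

namespace Network

variable {d dy n : ℕ} {𝒩 : Network d} {P : InverseProblem d dy}

theorem sqrt_div_accuracy (d : ℕ) (β₂ : ℝ) (n T : ℕ) :
    √(d : ℝ) / accuracy β₂ n T = (2 * √(d : ℝ)) * ((T : ℝ) * (n : ℝ) ^ (1 / (2 + β₂))) := by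
  unfold accuracy
  rw [div_div_eq_mul_div, div_one]
  ring

/-- The budgets of the reference network in terms of the sample size `n` and the unrolling depth
`T`: the depth and the logarithm of the number of parameters are of order `log (max n T)`, and the
sparsity is of order `T ^ β₂ * n ^ (β₂ / (2 + β₂))`. -/
theorem exists_size_bounds {d : ℕ} (hd : 1 ≤ d) (D₀ N₀ s₀ : ℝ) {β₁ β₂ : ℝ} (hβ₁ : 0 ≤ β₁)
    (hβ₂ : 0 ≤ β₂) :
    ∃ c : ℝ, 0 ≤ c ∧ ∀ {dy : ℕ} {P : InverseProblem d dy} {𝒩 : Network d} {W : 𝒩.Param}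
      {n T : ℕ} {Λ : ℝ}, 1 ≤ n → 1 ≤ T → Real.log n ≤ Λ → Real.log T ≤ Λ → 1 / 2 ≤ Λ →
      1 ≤ 𝒩.numParams → 𝒩.Approximates W P D₀ N₀ s₀ β₁ β₂ (accuracy β₂ n T) →
      (𝒩.depth : ℝ) ≤ c * Λ ∧ Real.log 𝒩.numParams ≤ c * Λ ∧
        (𝒩.sparsity W : ℝ) ≤ c * ((T : ℝ) ^ β₂ * (n : ℝ) ^ (β₂ / (2 + β₂))) := by
  have hd' : (1 : ℝ) ≤ √(d : ℝ) := Real.one_le_sqrt.2 (by exact_mod_cast hd)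
  set δ : ℝ := 2 * √(d : ℝ) with hδ
  have hδ1 : 1 ≤ δ := by linarith
  clear_value δ
  have hlδ : 0 ≤ Real.log δ := Real.log_nonneg hδ1
  set c₁ : ℝ := 2 * Real.log δ + 2 with hc₁
  have hc₁0 : 0 ≤ c₁ := by positivity
  set c₂ : ℝ := |D₀| * c₁ with hc₂
  have hc₂0 : 0 ≤ c₂ := by positivity
  have hlN : 0 ≤ Real.log (|N₀| + 1) := Real.log_nonneg (by linarith [abs_nonneg N₀])
  set c₃ : ℝ := c₂ + 4 * Real.log (|N₀| + 1) + 2 * β₁ * c₁ with hc₃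
  have hc₃0 : 0 ≤ c₃ := by positivity
  set c₄ : ℝ := |s₀| * δ ^ β₂ with hc₄
  have hc₄0 : 0 ≤ c₄ := by positivity
  refine ⟨c₂ + c₃ + c₄, by positivity, ?_⟩
  intro dy P 𝒩 W n T Λ hn hT hnΛ hTΛ hΛ hq hA
  have hn1 : (1 : ℝ) ≤ n := by exact_mod_cast hn
  have hT1 : (1 : ℝ) ≤ T := by exact_mod_cast hT
  have hα : 0 ≤ 1 / (2 + β₂) := by positivity
  have hα1 : 1 / (2 + β₂) ≤ 1 := by rw [div_le_one (by linarith)]; linarith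
  have hnα : (1 : ℝ) ≤ (n : ℝ) ^ (1 / (2 + β₂)) := Real.one_le_rpow hn1 hα
  set X : ℝ := √(d : ℝ) / accuracy β₂ n T with hX
  have hXe : X = δ * ((T : ℝ) * (n : ℝ) ^ (1 / (2 + β₂))) := by
    rw [hX, sqrt_div_accuracy, ← hδ]
  have hX1 : 1 ≤ X := by
    rw [hXe]
    exact one_le_mul_of_one_le_of_one_le hδ1 (one_le_mul_of_one_le_of_one_le hT1 hnα)
  have hlX : Real.log X ≤ c₁ * Λ := by
    rw [hXe, Real.log_mul (by positivity) (by positivity), Real.log_mul (by positivity)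
      (by positivity), Real.log_rpow (by positivity)]
    have h1 : 1 / (2 + β₂) * Real.log n ≤ Λ :=
      (mul_le_of_le_one_left (Real.log_nonneg hn1) hα1).trans hnΛ
    rw [hc₁]
    nlinarith
  have hlX0 : 0 ≤ Real.log X := Real.log_nonneg hX1
  have hdepth : (𝒩.depth : ℝ) ≤ c₂ * Λ := by
    calc (𝒩.depth : ℝ) ≤ D₀ * Real.log X := hA.depth_le
      _ ≤ |D₀| * (c₁ * Λ) := mul_le_mul (le_abs_self _) hlX hlX0 (abs_nonneg _)
      _ = c₂ * Λ := by rw [hc₂]; ring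
  have hlog : Real.log 𝒩.numParams ≤ c₃ * Λ := by
    set w : ℝ := (|N₀| + 1) * X ^ β₁ with hw
    have hXβ : 1 ≤ X ^ β₁ := Real.one_le_rpow hX1 hβ₁
    have hw1 : 1 ≤ w := one_le_mul_of_one_le_of_one_le (by linarith [abs_nonneg N₀]) hXβ
    have hwid : ∀ ℓ ≤ 𝒩.depth, (𝒩.width ℓ : ℝ) ≤ w := fun ℓ hℓ =>
      (hA.width_le ℓ hℓ).trans (by rw [hw]; gcongr; linarith [le_abs_self N₀])
    have hqle : (𝒩.numParams : ℝ) ≤ 𝒩.depth * w ^ 2 := by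
      unfold numParams
      push_cast
      refine (Finset.sum_le_sum (g := fun _ => w ^ 2) fun ℓ hℓ => ?_).trans (by simp)
      have hℓ' := Finset.mem_range.1 hℓ
      rw [sq]
      exact mul_le_mul (hwid _ hℓ') (hwid _ hℓ'.le) (Nat.cast_nonneg _) (by linarith)
    have hD1 : (1 : ℝ) ≤ 𝒩.depth := by exact_mod_cast 𝒩.one_le_depth
    have hq0 : (0 : ℝ) < 𝒩.numParams := by exact_mod_cast hq
    have h1 : Real.log 𝒩.numParams ≤ Real.log 𝒩.depth + 2 * Real.log w := by
      refine (Real.log_le_log hq0 hqle).trans (le_of_eq ?_)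
      rw [Real.log_mul (by positivity) (by positivity), Real.log_pow]
      norm_num
    have h2 : Real.log w ≤ Real.log (|N₀| + 1) + β₁ * (c₁ * Λ) := by
      rw [hw, Real.log_mul (by positivity) (by positivity), Real.log_rpow (by linarith)]
      gcongr
    have h3 : Real.log 𝒩.depth ≤ 𝒩.depth := (Real.log_le_sub_one_of_pos (by linarith)).trans
      (by linarith)
    rw [hc₃]
    nlinarith
  have hsp : (𝒩.sparsity W : ℝ) ≤ c₄ * ((T : ℝ) ^ β₂ * (n : ℝ) ^ (β₂ / (2 + β₂))) := by
    have e : X ^ β₂ = δ ^ β₂ * ((T : ℝ) ^ β₂ * (n : ℝ) ^ (β₂ / (2 + β₂))) := by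
      rw [hXe, Real.mul_rpow (by positivity) (by positivity), Real.mul_rpow (by positivity)
        (by positivity), ← Real.rpow_mul (by positivity)]
      congr 3
      ring
    calc (𝒩.sparsity W : ℝ) ≤ s₀ * X ^ β₂ := hA.sparsity_le
      _ ≤ |s₀| * X ^ β₂ := by gcongr; exact le_abs_self _
      _ = _ := by rw [e, hc₄]; ring
  have hNp : 0 ≤ (T : ℝ) ^ β₂ * (n : ℝ) ^ (β₂ / (2 + β₂)) := by positivity
  have hΛ0 : 0 ≤ Λ := by linarith
  refine ⟨hdepth.trans ?_, hlog.trans ?_, hsp.trans ?_⟩ <;> gcongr <;> linarith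

/-- A resolution in parameter space at which unrolled networks with weights bounded by `b` vary by
at most `1 / n`. -/
noncomputable def resolution (𝒩 : Network d) (n T : ℕ) (X b : ℝ) : ℝ :=
  (n * (T * 𝒩.depth * (2 * (𝒩.numParams * b) ^ 𝒩.depth) ^ T * X))⁻¹

section Resolution

variable {T : ℕ} {X b : ℝ}

theorem one_le_two_mul_pow (hq : 1 ≤ 𝒩.numParams) (hb : 1 ≤ b) :
    1 ≤ 2 * (𝒩.numParams * b) ^ 𝒩.depth := by
  have hq' : (1 : ℝ) ≤ 𝒩.numParams := by exact_mod_cast hq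
  have : (1 : ℝ) ≤ (𝒩.numParams * b) ^ 𝒩.depth :=
    one_le_pow₀ (one_le_mul_of_one_le_of_one_le hq' hb)
  linarith

theorem one_le_lipschitz_factor (hT : 1 ≤ T) (hq : 1 ≤ 𝒩.numParams) (hb : 1 ≤ b) (hX : 1 ≤ X) :
    1 ≤ T * 𝒩.depth * (2 * (𝒩.numParams * b) ^ 𝒩.depth) ^ T * X := by
  have hT' : (1 : ℝ) ≤ T := by exact_mod_cast hT
  have hD' : (1 : ℝ) ≤ 𝒩.depth := by exact_mod_cast 𝒩.one_le_depth
  exact one_le_mul_of_one_le_of_one_le (one_le_mul_of_one_le_of_one_le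
    (one_le_mul_of_one_le_of_one_le hT' hD') (one_le_pow₀ (one_le_two_mul_pow hq hb))) hX

theorem resolution_pos (hn : 1 ≤ n) (hT : 1 ≤ T) (hq : 1 ≤ 𝒩.numParams) (hb : 1 ≤ b)
    (hX : 1 ≤ X) : 0 < 𝒩.resolution n T X b := by
  have := one_le_lipschitz_factor hT hq hb hX
  have hn' : (1 : ℝ) ≤ n := by exact_mod_cast hn
  unfold resolution
  positivity

theorem resolution_le_one (hn : 1 ≤ n) (hT : 1 ≤ T) (hq : 1 ≤ 𝒩.numParams) (hb : 1 ≤ b)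
    (hX : 1 ≤ X) : 𝒩.resolution n T X b ≤ 1 := by
  have hn' : (1 : ℝ) ≤ n := by exact_mod_cast hn
  exact inv_le_one_of_one_le₀
    (one_le_mul_of_one_le_of_one_le hn' (one_le_lipschitz_factor hT hq hb hX))

theorem lipschitz_mul_resolution (hn : 1 ≤ n) (hT : 1 ≤ T) (hq : 1 ≤ 𝒩.numParams) (hb : 1 ≤ b)
    (hX : 1 ≤ X) {Y : ℝ} (hY : Y ≤ X) :
    T * 𝒩.depth * 𝒩.resolution n T X b * (2 * (𝒩.numParams * b) ^ 𝒩.depth) ^ T * Y ≤ 1 / n := by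
  have h1 := one_le_lipschitz_factor hT hq hb hX
  have hn' : (1 : ℝ) ≤ n := by exact_mod_cast hn
  have h2 := one_le_two_mul_pow (b := b) hq hb
  have h3 := (resolution_pos hn hT hq hb hX).le
  calc _ ≤ T * 𝒩.depth * 𝒩.resolution n T X b * (2 * (𝒩.numParams * b) ^ 𝒩.depth) ^ T * X := by
        gcongr
    _ = T * 𝒩.depth * (2 * (𝒩.numParams * b) ^ 𝒩.depth) ^ T * X * 𝒩.resolution n T X b := by ring
    _ = 1 / n := by
        unfold resolution
        set F := T * 𝒩.depth * (2 * (𝒩.numParams * b) ^ 𝒩.depth) ^ T * X with hF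
        field_simp

theorem neg_log_resolution_le (hn : 1 ≤ n) (hT : 1 ≤ T) (hq : 1 ≤ 𝒩.numParams) (hb : 1 ≤ b)
    (hX : 1 ≤ X) {c Λ : ℝ} (hc : 0 ≤ c) (hdepth : 𝒩.depth ≤ c * Λ) (hnΛ : Real.log n ≤ Λ)
    (hTΛ : Real.log T ≤ Λ) (hΛ : 1 / 2 ≤ Λ) (hqb : 1 ≤ Real.log (𝒩.numParams * b)) :
    -Real.log (𝒩.resolution n T X b) ≤
      (4 + 2 * c + 2 * Real.log X) * (T * Λ * Real.log (𝒩.numParams * b)) := by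
  have hn' : (1 : ℝ) ≤ n := by exact_mod_cast hn
  have hT' : (1 : ℝ) ≤ T := by exact_mod_cast hT
  have hD' : (1 : ℝ) ≤ 𝒩.depth := by exact_mod_cast 𝒩.one_le_depth
  have hq' : (1 : ℝ) ≤ 𝒩.numParams := by exact_mod_cast hq
  have h2 := one_le_two_mul_pow (b := b) hq hb
  have hqb1 : 1 ≤ 𝒩.numParams * b := one_le_mul_of_one_le_of_one_le hq' hb
  set ℓ := Real.log (𝒩.numParams * b) with hℓ
  have hlX : 0 ≤ Real.log X := Real.log_nonneg hX
  have hlD : Real.log 𝒩.depth ≤ 𝒩.depth := (Real.log_le_sub_one_of_pos (by linarith)).trans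
      (by linarith)
  have hl2 : Real.log 2 ≤ 1 := by linarith [Real.log_two_lt_d9]
  have e : -Real.log (𝒩.resolution n T X b) = Real.log n + (Real.log T + Real.log 𝒩.depth +
      T * (Real.log 2 + 𝒩.depth * ℓ) + Real.log X) := by
    unfold resolution
    rw [Real.log_inv, neg_neg, Real.log_mul (by positivity) (by positivity),
      Real.log_mul (by positivity) (by positivity), Real.log_mul (by positivity) (by positivity),
      Real.log_mul (by positivity) (by positivity), Real.log_pow,
      Real.log_mul (by positivity) (by positivity), Real.log_pow]
  have hΛ0 : 0 ≤ Λ := by linarith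
  have hTℓ : 1 ≤ T * ℓ := one_le_mul_of_one_le_of_one_le hT' hqb
  have hΛT : Λ ≤ T * Λ * ℓ := by nlinarith
  have hT2 : (T : ℝ) ≤ 2 * (T * Λ * ℓ) := by
    have : 1 ≤ 2 * Λ * ℓ := by nlinarith
    nlinarith
  have h1 : 1 ≤ 2 * (T * Λ * ℓ) := hT'.trans hT2
  have hDℓ : (T : ℝ) * (𝒩.depth * ℓ) ≤ c * (T * Λ * ℓ) := by
    calc (T : ℝ) * (𝒩.depth * ℓ) ≤ T * ((c * Λ) * ℓ) := by gcongr
      _ = _ := by ring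
  have hXX : Real.log X ≤ Real.log X * (2 * (T * Λ * ℓ)) := le_mul_of_one_le_right hlX h1
  have hcΛ : c * Λ ≤ c * (T * Λ * ℓ) := mul_le_mul_of_nonneg_left hΛT hc
  have hT1 : (T : ℝ) * Real.log 2 ≤ T := mul_le_of_le_one_right (by linarith) hl2
  rw [e]
  nlinarith

end Resolution

/-- The prior mass of the neighbourhood of the reference network. -/
theorem exp_neg_le_mass {u η b : ℝ} (hq : 1 ≤ 𝒩.numParams) (hη : 0 < η) (W : 𝒩.Param)
    (hb : 𝒩.sparsity W * ((u + 1) * Real.log 𝒩.numParams + (3 - Real.log η)) ≤ b) :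
    Real.exp (-b) ≤ supportWeight u (support W) * (η / 10) ^ 𝒩.sparsity W := by
  have hq0 : (0 : ℝ) < 𝒩.numParams := by exact_mod_cast hq
  have hl10 : Real.log 10 ≤ 3 := by
    rw [Real.log_le_iff_le_exp (by norm_num), show (3 : ℝ) = 1 + 1 + 1 by norm_num, Real.exp_add,
      Real.exp_add]
    have := Real.exp_one_gt_d9
    have h2 : (2.7 : ℝ) ^ 2 ≤ Real.exp 1 * Real.exp 1 := by nlinarith
    nlinarith
  have e : supportWeight u (support W) * (η / 10) ^ 𝒩.sparsity W = Real.exp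
      (-(𝒩.sparsity W * ((u + 1) * Real.log 𝒩.numParams + (Real.log 10 - Real.log η)))) := by
    rw [supportWeight, supportCard_support, one_div, Real.inv_rpow hq0.le,
      ← Real.exp_log (by positivity : 0 < (η / 10) ^ 𝒩.sparsity W), Real.log_pow,
      Real.log_div hη.ne' (by norm_num), Real.rpow_def_of_pos hq0, ← Real.exp_neg, ← Real.exp_add]
    congr 1
    ring
  rw [e]
  refine Real.exp_le_exp.2 (neg_le_neg (le_trans ?_ hb))
  gcongr

theorem pow_le_inv_of_log_div_le {ϱ : ℝ} (h0 : 0 ≤ ϱ) (h1 : ϱ < 1) {n T : ℕ} (hn : 1 ≤ n)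
    (hT : 1 ≤ T) (h : Real.log n / (-Real.log ϱ) ≤ T) : ϱ ^ T ≤ 1 / n := by
  have hn' : (0 : ℝ) < n := by exact_mod_cast hn
  rcases h0.eq_or_lt with rfl | hpos
  · rw [zero_pow (by omega)]; positivity
  · have hlog : 0 < -Real.log ϱ := neg_pos.2 (Real.log_neg hpos h1)
    rw [div_le_iff₀ hlog] at h
    rw [← Real.exp_log (pow_pos hpos T), Real.log_pow, one_div, ← Real.exp_log (inv_pos.2 hn'),
      Real.log_inv]
    exact Real.exp_le_exp.2 (by linarith)

/-- The reference network, as far as the posterior is concerned: its neighbourhood has prior mass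
`exp (-b)` with `b` of order `T ^ (1 + β₂) * n ^ (β₂ / (2 + β₂)) * log (max n T) * log q`, and
carries squared deviations of order `n ^ (β₂ / (2 + β₂))`. -/
theorem exists_referenceBounds {L : ℝ} (hP : P.ConvexModel L) {β₂ : ℝ} (hβ₂ : 0 ≤ β₂) {u : ℝ}
    (hu : 0 ≤ u) (R₀ : ℝ) {c c' : ℝ} (hc : 0 ≤ c) (hc' : 0 ≤ c') :
    ∃ a₀ b₀ : ℝ, 0 ≤ a₀ ∧ 0 ≤ b₀ ∧ ∀ {𝒩 : Network d} {W : 𝒩.Param} {D₀ N₀ s₀ β₁ : ℝ}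
      {n T : ℕ} {Λ : ℝ}, 1 ≤ n → 1 ≤ T → Real.log n ≤ Λ → Real.log T ≤ Λ → 1 / 2 ≤ Λ →
      4 ≤ 𝒩.numParams → 𝒩.Approximates W P D₀ N₀ s₀ β₁ β₂ (accuracy β₂ n T) →
      (𝒩.depth : ℝ) ≤ c * Λ →
      (𝒩.sparsity W : ℝ) ≤ c * ((T : ℝ) ^ β₂ * (n : ℝ) ^ (β₂ / (2 + β₂))) →
      ∀ {B : Set (Fin n → E dy)} {ϱ : ℝ}, 0 ≤ ϱ → ϱ < 1 → (∀ y ∈ B, P.LinearRate R₀ ϱ y) →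
      Real.log n / (-Real.log ϱ) ≤ T → (∀ y ∈ B, ∀ i, ‖P.gradStep (y i) 0‖ ≤ c') →
      ∃ η e₀ : ℝ, ReferenceBounds P B T u W η c' e₀ (a₀ * (n : ℝ) ^ (β₂ / (2 + β₂)))
        (b₀ * ((T : ℝ) ^ β₂ * T * (n : ℝ) ^ (β₂ / (2 + β₂)) * Λ * Real.log 𝒩.numParams)) := by
  set X : ℝ := ‖P.x₀‖ + c' + 1 with hX
  have hX1 : 1 ≤ X := by linarith [norm_nonneg P.x₀]
  have hlX : 0 ≤ Real.log X := Real.log_nonneg hX1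
  set c₅ : ℝ := 4 + 2 * c + 2 * Real.log X with hc₅
  have hc₅0 : 0 ≤ c₅ := by positivity
  refine ⟨(3 / 2 + |R₀|) ^ 2, c * (2 * (u + 1) + 6 + 2 * c₅), by positivity, by positivity, ?_⟩
  intro 𝒩 W D₀ N₀ s₀ β₁ n T Λ hn hT hnΛ hTΛ hΛ hq hA hdepth hsp B ϱ hϱ0 hϱ1 hlin hTϱ hgrad
  have hn1 : (1 : ℝ) ≤ n := by exact_mod_cast hn
  have hT1 : (1 : ℝ) ≤ T := by exact_mod_cast hT
  have hq1 : 1 ≤ 𝒩.numParams := by omega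
  have hq4 : (4 : ℝ) ≤ 𝒩.numParams := by exact_mod_cast hq
  have hlq : 1 ≤ Real.log 𝒩.numParams := by
    rw [Real.le_log_iff_exp_le (by linarith)]
    linarith [Real.exp_one_lt_d9]
  have hα : 0 < 2 + β₂ := by linarith
  have hnα : 0 < (n : ℝ) ^ (1 / (2 + β₂)) := by positivity
  set v : ℝ := ((n : ℝ) ^ (1 / (2 + β₂)))⁻¹ with hv
  have hv0 : 0 < v := inv_pos.2 hnα
  have hnv : 1 / (n : ℝ) ≤ v := by
    rw [hv, one_div]
    refine inv_anti₀ hnα ?_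
    calc (n : ℝ) ^ (1 / (2 + β₂)) ≤ (n : ℝ) ^ (1 : ℝ) :=
          Real.rpow_le_rpow_of_exponent_le hn1 (by rw [div_le_one hα]; linarith)
      _ = n := Real.rpow_one _
  refine ⟨𝒩.resolution n T X 2, (1 / 2 + |R₀|) * v, hA.abs_le,
    (resolution_pos hn hT hq1 one_le_two hX1).le, resolution_le_one hn hT hq1 one_le_two hX1,
    lipschitz_mul_resolution hn hT hq1 one_le_two hX1 (by linarith), hgrad, ?_, ?_, ?_⟩
  · intro y hy i
    have h1 := norm_gdn_sub_proxStep_le hP hA.approx (y i) T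
    have h2 := hlin y hy T hT i
    have h3 := norm_add_le (𝒩.gdn P T W (y i) - (P.proxStep (y i))^[T] P.x₀)
      ((P.proxStep (y i))^[T] P.x₀ - P.g (y i))
    rw [sub_add_sub_cancel] at h3
    have h4 : (T : ℝ) * accuracy β₂ n T = 1 / 2 * v := by
      rw [hv, accuracy]; field_simp
    have h5 : R₀ * ϱ ^ T ≤ |R₀| * v := by
      calc R₀ * ϱ ^ T ≤ |R₀| * ϱ ^ T := by gcongr; exact le_abs_self _
        _ ≤ |R₀| * v := by
          gcongr
          exact (pow_le_inv_of_log_div_le hϱ0 hϱ1 hn hT hTϱ).trans hnv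
    linarith
  · have e : (n : ℝ) * v ^ 2 = (n : ℝ) ^ (β₂ / (2 + β₂)) := by
      rw [hv, ← Real.rpow_neg (by linarith), ← Real.rpow_natCast, ← Real.rpow_mul (by linarith)]
      nth_rewrite 1 [← Real.rpow_one (n : ℝ)]
      rw [← Real.rpow_add (by linarith)]
      congr 1
      field_simp
      push_cast
      ring
    rw [← e]
    have : 1 / (n : ℝ) + (1 / 2 + |R₀|) * v ≤ (3 / 2 + |R₀|) * v := by linarith
    calc (n : ℝ) * (1 / n + (1 / 2 + |R₀|) * v) ^ 2 ≤ n * ((3 / 2 + |R₀|) * v) ^ 2 := by gcongr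
      _ = _ := by ring
  · refine exp_neg_le_mass hq1 (resolution_pos hn hT hq1 one_le_two hX1) W ?_
    set ℓ := Real.log 𝒩.numParams with hℓ
    have hl2q : Real.log (𝒩.numParams * 2) ≤ 2 * ℓ := by
      rw [Real.log_mul (by positivity) (by norm_num)]
      have : Real.log 2 ≤ 1 := by linarith [Real.log_two_lt_d9]
      linarith
    have hl2q1 : 1 ≤ Real.log (𝒩.numParams * 2) := by
      rw [Real.log_mul (by positivity) (by norm_num)]
      linarith [Real.log_pos one_lt_two]
    have h1 := neg_log_resolution_le hn hT hq1 one_le_two hX1 hc hdepth hnΛ hTΛ hΛ hl2q1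
    rw [← hc₅] at h1
    have hΛ0 : 0 ≤ Λ := by linarith
    have h2 : -Real.log (𝒩.resolution n T X 2) ≤ 2 * c₅ * (T * Λ * ℓ) := by
      refine h1.trans ?_
      calc c₅ * (T * Λ * Real.log (𝒩.numParams * 2)) ≤ c₅ * (T * Λ * (2 * ℓ)) := by gcongr
        _ = _ := by ring
    have h3 : ℓ ≤ 2 * (T * Λ * ℓ) := by
      have : 1 ≤ 2 * (T * Λ) := by nlinarith
      nlinarith
    have h4 : (u + 1) * ℓ ≤ (u + 1) * (2 * (T * Λ * ℓ)) := by gcongr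
    have h5 : (u + 1) * ℓ + (3 - Real.log (𝒩.resolution n T X 2)) ≤
        (2 * (u + 1) + 6 + 2 * c₅) * (T * Λ * ℓ) := by linarith
    calc 𝒩.sparsity W * ((u + 1) * ℓ + (3 - Real.log (𝒩.resolution n T X 2)))
        ≤ 𝒩.sparsity W * ((2 * (u + 1) + 6 + 2 * c₅) * (T * Λ * ℓ)) := by gcongr
      _ ≤ c * ((T : ℝ) ^ β₂ * (n : ℝ) ^ (β₂ / (2 + β₂))) *
          ((2 * (u + 1) + 6 + 2 * c₅) * (T * Λ * ℓ)) := by gcongr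
      _ = _ := by ring

end Network

/-! ### Contraction rates -/

namespace Network

variable {d dy : ℕ} {P : InverseProblem d dy}

/-- The squared rate of contraction `T ^ (2 + β₂) * n ^ (-2 / (2 + β₂))`, times the sample size. -/
noncomputable def sqRate (β₂ : ℝ) (n T : ℕ) : ℝ :=
  (T : ℝ) ^ β₂ * (T : ℝ) ^ 2 * (n : ℝ) ^ (β₂ / (2 + β₂))

theorem expMomentBound_pow_mul_exp_le {s σ : ℝ} {q n : ℕ} (hd : 1 ≤ d) (hσ : 0 < σ) (hq : 1 ≤ q)
    (hn : σ ^ 2 * Real.log q ≤ n) :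
    SubGaussianErrors.expMomentBound d s ^ n *
      Real.exp (-((Real.log (SubGaussianErrors.expMomentBound d s) + 2 / σ ^ 2) * n)) ≤
        ((q : ℝ) ^ 2)⁻¹ := by
  have hq0 : (0 : ℝ) < q := by exact_mod_cast hq
  have hd0 : (0 : ℝ) < d := by exact_mod_cast hd
  have hκ : 0 < SubGaussianErrors.expMomentBound d s := by
    unfold SubGaussianErrors.expMomentBound; positivity
  rw [← Real.exp_log (pow_pos hκ n), Real.log_pow, ← Real.exp_add,
    ← Real.exp_log (pow_pos hq0 2), ← Real.exp_neg, Real.log_pow]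
  refine Real.exp_le_exp.2 ?_
  have h : Real.log q ≤ n / σ ^ 2 := by rw [le_div_iff₀ (by positivity)]; linarith
  have e : (2 : ℝ) / σ ^ 2 * n = 2 * (n / σ ^ 2) := by ring
  push_cast
  linarith

theorem half_le_log {n : ℕ} (hn : 2 ≤ n) : 1 / 2 ≤ Real.log n := by
  have h : Real.log 2 ≤ Real.log n := Real.log_le_log (by norm_num) (by exact_mod_cast hn)
  linarith [Real.log_two_gt_d9]

/-- Contraction for unrolling depths that exceed the sample size. The radius is then larger than
the noise, and the entropy of the sieve, which would involve `log T` in place of `log n`, plays no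
role. -/
theorem exists_contraction_of_le {L σbar σ u β₂ a₀ b₀ c : ℝ} (hd : 1 ≤ d) (hP : P.ConvexModel L)
    (hσbar : 0 < σbar) (hE : P.ErrorModel σbar) (hσ : σbar ≤ σ) (hu : 1 ≤ u) (hβ₂ : 0 ≤ β₂)
    (ha₀ : 0 ≤ a₀) (hb₀ : 0 ≤ b₀) (hc : 0 ≤ c) :
    ∃ k₀ : ℝ, 0 ≤ k₀ ∧ ∀ {𝒩 : Network d} {n T : ℕ} {ρ₀ Λ : ℝ} {B : Set (Fin n → E dy)}
      {W : 𝒩.Param} {η c' e₀ k : ℝ}, k₀ ≤ k → 2 ≤ n → n ≤ T → 0 < ρ₀ → 4 ≤ 𝒩.numParams →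
      σ ^ 2 * Real.log 𝒩.numParams ≤ n → MeasurableSet B → Λ = Real.log T →
      Real.log 𝒩.numParams ≤ c * Λ →
      ReferenceBounds P B T u W η c' e₀ (a₀ * (n : ℝ) ^ (β₂ / (2 + β₂)))
        (b₀ * ((T : ℝ) ^ β₂ * T * (n : ℝ) ^ (β₂ / (2 + β₂)) * Λ * Real.log 𝒩.numParams)) →
      Measure.pi (fun _ : Fin n => P.jointLaw) {D | (fun i => (D i).2) ∈ B ∧
        12 / (𝒩.numParams : ℝ≥0∞) < 𝒩.posterior P T σ u ρ₀ D
          {θ | k * (Real.log n ^ 3 * sqRate β₂ n T) <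
            ∑ i, ‖𝒩.gdn P T (𝒩.mask θ) (D i).2 - P.g (D i).2‖ ^ 2}} ≤
      ENNReal.ofReal (1 / 𝒩.numParams) *
        Measure.pi (fun _ : Fin n => P.jointLaw) {D | (fun i => (D i).2) ∈ B} := by
  have hσ0 : 0 < σ := hσbar.trans_le hσ
  set τ : ℝ := Real.log (SubGaussianErrors.expMomentBound d σbar) + 2 / σ ^ 2 with hτ
  set C : ℝ := a₀ / σ ^ 2 + 4 * b₀ * c + 3 * c with hC
  have hC0 : 0 ≤ C := by positivity
  refine ⟨8 * (16 * τ ^ 2) + 8 * (4 * σ ^ 2 * C), by positivity, ?_⟩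
  intro 𝒩 n T ρ₀ Λ B W η c' e₀ k hk hn hnT hρ hq hnq hB hΛ hqΛ hW
  have hn2 : (2 : ℝ) ≤ n := by exact_mod_cast hn
  have hnT' : (n : ℝ) ≤ T := by exact_mod_cast hnT
  have hT1 : (1 : ℝ) ≤ T := by linarith
  have hl := half_le_log hn
  have hα : 0 ≤ β₂ / (2 + β₂) := by positivity
  set p : ℝ := (T : ℝ) ^ β₂ with hp
  set N : ℝ := (n : ℝ) ^ (β₂ / (2 + β₂)) with hN
  have hp1 : 1 ≤ p := Real.one_le_rpow hT1 hβ₂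
  have hN1 : 1 ≤ N := Real.one_le_rpow (by linarith) hα
  have hG : sqRate β₂ n T = p * (T : ℝ) ^ 2 * N := rfl
  rw [hG]
  set G : ℝ := p * (T : ℝ) ^ 2 * N with hG'
  have hTG : (T : ℝ) ^ 2 ≤ G := by
    have h1 : (T : ℝ) ^ 2 ≤ p * (T : ℝ) ^ 2 := le_mul_of_one_le_left (by positivity) hp1
    exact h1.trans (le_mul_of_one_le_right (by positivity) hN1)
  have hG0 : 0 ≤ G := (by positivity : (0 : ℝ) ≤ (T : ℝ) ^ 2).trans hTG
  have hl3 : 1 / 8 ≤ Real.log n ^ 3 := by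
    calc (1 : ℝ) / 8 = (1 / 2) ^ 3 := by norm_num
      _ ≤ _ := by gcongr
  have hk0 : 0 ≤ k := le_trans (by positivity) hk
  have hrG : k / 8 * G ≤ k * (Real.log n ^ 3 * G) := by
    have h1 : 1 / 8 * G ≤ Real.log n ^ 3 * G := by gcongr
    have := mul_le_mul_of_nonneg_left h1 hk0
    linarith
  have hΛ0 : 0 ≤ Λ := by rw [hΛ]; exact Real.log_nonneg hT1
  have hΛT : Λ ≤ T := by
    rw [hΛ]; linarith [Real.log_le_sub_one_of_pos (by linarith : (0 : ℝ) < T)]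
  have hΛ2 : Λ ^ 2 ≤ 4 * T := by
    have h1 : Λ = 2 * Real.log √(T : ℝ) := by rw [hΛ, Real.log_sqrt (by linarith)]; ring
    have h2 : 0 < √(T : ℝ) := Real.sqrt_pos.2 (by linarith)
    have h3 : Λ ≤ 2 * √(T : ℝ) := by linarith [Real.log_le_sub_one_of_pos h2]
    calc Λ ^ 2 ≤ (2 * √(T : ℝ)) ^ 2 := by gcongr
      _ = 4 * (T : ℝ) := by rw [mul_pow, Real.sq_sqrt (by linarith)]; norm_num
  refine measure_posterior_gt_le_of_large (τ := τ) hd hP hσbar hE hσ hu hρ hq hB hW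
    (expMomentBound_pow_mul_exp_le hd hσ0 (by omega) hnq) ?_ ?_
  · have h1 : (τ * n) ^ 2 ≤ τ ^ 2 * G := by
      rw [mul_pow]
      refine mul_le_mul_of_nonneg_left (le_trans ?_ hTG) (sq_nonneg _)
      gcongr
    have h2 : 16 * τ ^ 2 ≤ k / 8 := by
      have : 0 ≤ 8 * (4 * σ ^ 2 * C) := by positivity
      linarith
    have h3 := mul_le_mul_of_nonneg_right h2 hG0
    linarith
  · have h1 : a₀ * N / σ ^ 2 ≤ a₀ / σ ^ 2 * G := by
      have h : N ≤ G := le_mul_of_one_le_left (by linarith)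
        (one_le_mul_of_one_le_of_one_le hp1 (one_le_pow₀ hT1))
      calc a₀ * N / σ ^ 2 = a₀ / σ ^ 2 * N := by ring
        _ ≤ _ := by gcongr
    have h2 : b₀ * (p * T * N * Λ * Real.log 𝒩.numParams) ≤ 4 * b₀ * c * G := by
      calc b₀ * (p * T * N * Λ * Real.log 𝒩.numParams)
          ≤ b₀ * (p * T * N * Λ * (c * Λ)) := by gcongr
        _ = b₀ * c * (p * T * N) * Λ ^ 2 := by ring
        _ ≤ b₀ * c * (p * T * N) * (4 * T) := by gcongr
        _ = _ := by rw [hG']; ring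
    have h3 : Real.log 𝒩.numParams ≤ c * G := by
      refine hqΛ.trans (mul_le_mul_of_nonneg_left (hΛT.trans (le_trans ?_ hTG)) hc)
      exact le_self_pow₀ hT1 (by norm_num)
    have h4 : 4 * σ ^ 2 * C ≤ k / 8 := by
      have : 0 ≤ 8 * (16 * τ ^ 2) := by positivity
      linarith
    have h5 := mul_le_mul_of_nonneg_right h4 hG0
    have h6 : C * G = a₀ / σ ^ 2 * G + 4 * b₀ * c * G + 3 * (c * G) := by rw [hC]; ring
    calc _ ≤ C * G := by linarith
      _ ≤ _ := by
        rw [div_div, le_div_iff₀ (by positivity)]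
        linarith

set_option maxHeartbeats 1000000 in
/-- Contraction for unrolling depths below the sample size. The entropy of the sieve is of order
`log n ^ 3 * sqRate β₂ n T`: its parameters have up to the order of
`T ^ (1 + β₂) * n ^ (β₂ / (2 + β₂)) * log n` non-zero entries, and the logarithm of the inverse
resolution is of order `T * log n ^ 2`, because unrolled networks are Lipschitz with a constant
exponential in `T`. -/
theorem exists_contraction_of_lt {L σbar σ u β₂ a₀ b₀ c c' : ℝ} (hd : 1 ≤ d)
    (hP : P.ConvexModel L) (hσbar : 0 < σbar) (hE : P.ErrorModel σbar) (hσ : σbar ≤ σ)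
    (hu : 1 ≤ u) (hβ₂ : 0 ≤ β₂) (ha₀ : 0 ≤ a₀) (hb₀ : 0 ≤ b₀) (hc : 0 ≤ c) (hc' : 0 ≤ c') :
    ∃ k₀ : ℝ, 0 ≤ k₀ ∧ ∀ {𝒩 : Network d} {n T : ℕ} {ρ₀ Λ : ℝ} {B : Set (Fin n → E dy)}
      {W : 𝒩.Param} {η e₀ k : ℝ}, k₀ ≤ k → 2 ≤ n → 1 ≤ T → T < n → 0 < ρ₀ → 4 ≤ 𝒩.numParams →
      σ ^ 2 * Real.log 𝒩.numParams ≤ n → MeasurableSet B → Λ = Real.log n →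
      (𝒩.depth : ℝ) ≤ c * Λ → Real.log 𝒩.numParams ≤ c * Λ →
      ReferenceBounds P B T u W η c' e₀ (a₀ * (n : ℝ) ^ (β₂ / (2 + β₂)))
        (b₀ * ((T : ℝ) ^ β₂ * T * (n : ℝ) ^ (β₂ / (2 + β₂)) * Λ * Real.log 𝒩.numParams)) →
      Measure.pi (fun _ : Fin n => P.jointLaw) {D | (fun i => (D i).2) ∈ B ∧
        12 / (𝒩.numParams : ℝ≥0∞) < 𝒩.posterior P T σ u ρ₀ D
          {θ | k * (Real.log n ^ 3 * sqRate β₂ n T) <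
            ∑ i, ‖𝒩.gdn P T (𝒩.mask θ) (D i).2 - P.g (D i).2‖ ^ 2}} ≤
      ENNReal.ofReal (1 / 𝒩.numParams) *
        Measure.pi (fun _ : Fin n => P.jointLaw) {D | (fun i => (D i).2) ∈ B} := by
  have hσ0 : 0 < σ := hσbar.trans_le hσ
  set τ : ℝ := Real.log (SubGaussianErrors.expMomentBound d σbar) + 2 / σ ^ 2 with hτ
  set X : ℝ := ‖P.x₀‖ + c' + 1 with hX
  have hX1 : 1 ≤ X := by linarith [norm_nonneg P.x₀]
  have hlX : 0 ≤ Real.log X := Real.log_nonneg hX1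
  set c₅ : ℝ := 4 + 2 * c + 2 * Real.log X with hc₅
  have hc₅0 : 0 ≤ c₅ := by positivity
  set c₁ : ℝ := 2 * a₀ / σ ^ 2 + b₀ + 10 with hc₁
  have hc₁0 : 0 ≤ c₁ := by positivity
  set c₂ : ℝ := 1 + 2 * (c * (c₁ + 2)) with hc₂
  have hc₂1 : 1 ≤ c₂ := by have : 0 ≤ 2 * (c * (c₁ + 2)) := by positivity
                           linarith
  have hlc₂ : 0 ≤ Real.log c₂ := Real.log_nonneg hc₂1
  set c₃ : ℝ := 2 * Real.log c₂ + (β₂ + 4) with hc₃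
  have hc₃0 : 0 ≤ c₃ := by positivity
  set c₄ : ℝ := 2 * (c + 4 + c₃) + c₅ * (c + c₃) with hc₄
  have hc₄0 : 0 ≤ c₄ := by positivity
  set k₁ : ℝ := 128 * σbar ^ 2 * (16 + 8 * c + (c₁ + 2) * c₄) with hk₁
  set k₂ : ℝ := 4 * (8 * |τ + 1| + σ ^ 2 * (2 * (c * (c₁ + 2)))) with hk₂
  have hk₁0 : 0 ≤ k₁ := by positivity
  have hk₂0 : 0 ≤ k₂ := by positivity
  refine ⟨k₁ + k₂, by positivity, ?_⟩
  intro 𝒩 n T ρ₀ Λ B W η e₀ k hk hn hT hTn hρ hq hnq hB hΛ hdepth hqΛ hW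
  have hn2 : (2 : ℝ) ≤ n := by exact_mod_cast hn
  have hn1 : (1 : ℝ) ≤ n := by linarith
  have hTn' : (T : ℝ) ≤ n := by exact_mod_cast hTn.le
  have hT1 : (1 : ℝ) ≤ T := by exact_mod_cast hT
  have hq1 : 1 ≤ 𝒩.numParams := by omega
  have hq4 : (4 : ℝ) ≤ 𝒩.numParams := by exact_mod_cast hq
  have hq0 : (0 : ℝ) < 𝒩.numParams := by linarith
  set ℓ : ℝ := Real.log 𝒩.numParams with hℓ
  have hℓ1 : 1 ≤ ℓ := by
    rw [hℓ, Real.le_log_iff_exp_le hq0]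
    linarith [Real.exp_one_lt_d9]
  have hΛh : 1 / 2 ≤ Λ := hΛ ▸ half_le_log hn
  have hΛ0 : 0 ≤ Λ := by linarith
  have hΛn : Λ ≤ n := by
    rw [hΛ]; linarith [Real.log_le_sub_one_of_pos (by linarith : (0 : ℝ) < n)]
  have hα : 0 ≤ β₂ / (2 + β₂) := by positivity
  set p : ℝ := (T : ℝ) ^ β₂ with hp
  set N : ℝ := (n : ℝ) ^ (β₂ / (2 + β₂)) with hN
  have hp1 : 1 ≤ p := Real.one_le_rpow hT1 hβ₂
  have hN1 : 1 ≤ N := Real.one_le_rpow hn1 hα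
  have hpn : p ≤ (n : ℝ) ^ β₂ := by rw [hp]; gcongr
  have hNn : N ≤ n := by
    calc N ≤ (n : ℝ) ^ (1 : ℝ) := Real.rpow_le_rpow_of_exponent_le hn1
          (by rw [div_le_one (by linarith)]; linarith)
      _ = n := Real.rpow_one _
  -- `G` is the order of the sparsity of the sieve, and `U` the order of its entropy
  set G : ℝ := p * T * N * Λ with hG
  have hpTN : 1 ≤ p * T * N :=
    one_le_mul_of_one_le_of_one_le (one_le_mul_of_one_le_of_one_le hp1 hT1) hN1
  have hGh : 1 / 2 ≤ G := by
    calc (1 : ℝ) / 2 ≤ Λ := hΛh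
      _ ≤ _ := le_mul_of_one_le_left hΛ0 hpTN
  have hG0 : 0 ≤ G := by linarith
  have hUe : Real.log n ^ 3 * sqRate β₂ n T = G * (T * Λ ^ 2) := by
    rw [← hΛ, sqRate, hG]; ring
  rw [hUe]
  set U : ℝ := G * (T * Λ ^ 2) with hU
  have hΛ2 : Λ ≤ 2 * (T * Λ ^ 2) := by
    have h1 : 1 / 2 * Λ ≤ Λ * Λ := mul_le_mul_of_nonneg_right hΛh hΛ0
    have h2 : Λ ^ 2 ≤ T * Λ ^ 2 := le_mul_of_one_le_left (sq_nonneg _) hT1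
    rw [sq] at h2 ⊢
    linarith only [h1, h2]
  have hTΛh : 1 / 4 ≤ T * Λ ^ 2 := by linarith
  have hU8 : 1 / 8 ≤ U := by
    calc (1 : ℝ) / 8 = 1 / 2 * (1 / 4) := by norm_num
      _ ≤ _ := by rw [hU]; gcongr
  have hGΛU : G * Λ ≤ 2 * U := by
    calc G * Λ ≤ G * (2 * (T * Λ ^ 2)) := by gcongr
      _ = _ := by rw [hU]; ring
  have hΛU : Λ ≤ 4 * U := by
    have := mul_le_mul_of_nonneg_right hGh hΛ0
    linarith only [this, hGΛU]
  have hGℓ : G * ℓ ≤ G * (c * Λ) := by gcongr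
  -- `V` is the exponent of the bound for the denominator; all exponents are of order `G * ℓ`
  set V : ℝ := a₀ * N / σ ^ 2 + b₀ * (p * T * N * Λ * ℓ) with hV
  have hℓG : ℓ ≤ 2 * (G * ℓ) := by
    have := mul_le_mul_of_nonneg_right hGh (zero_le_one.trans hℓ1)
    linarith only [this]
  have hNG : N ≤ 2 * (G * ℓ) := by
    have h1 : N ≤ p * T * N := le_mul_of_one_le_left (by linarith)
      (one_le_mul_of_one_le_of_one_le hp1 hT1)
    have h2 : p * T * N * (1 / 2) ≤ G :=
      mul_le_mul_of_nonneg_left hΛh (zero_le_one.trans hpTN)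
    have h3 : G ≤ G * ℓ := le_mul_of_one_le_right hG0 hℓ1
    linarith
  have hVG : V + 5 * ℓ ≤ c₁ * (G * ℓ) := by
    have h1 : a₀ * N / σ ^ 2 ≤ 2 * a₀ / σ ^ 2 * (G * ℓ) := by
      calc a₀ * N / σ ^ 2 ≤ a₀ * (2 * (G * ℓ)) / σ ^ 2 := by gcongr
        _ = _ := by ring
    have h2 : c₁ * (G * ℓ) = 2 * a₀ / σ ^ 2 * (G * ℓ) + b₀ * (p * T * N * Λ * ℓ) +
        10 * (G * ℓ) := by rw [hc₁, hG]; ring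
    rw [hV, h2]
    linarith
  have hVG' : V + 6 * ℓ ≤ (c₁ + 2) * (G * ℓ) := by
    have : (c₁ + 2) * (G * ℓ) = c₁ * (G * ℓ) + 2 * (G * ℓ) := by ring
    linarith
  have hn4 : (n : ℝ) ^ (β₂ + 4) = (n : ℝ) ^ β₂ * n ^ 4 := by
    rw [Real.rpow_add (by linarith)]; norm_cast
  have hVn : V + 6 * ℓ ≤ c * (c₁ + 2) * (n : ℝ) ^ (β₂ + 4) := by
    have h1 : G * Λ ≤ (n : ℝ) ^ (β₂ + 4) := by
      calc G * Λ ≤ (n : ℝ) ^ β₂ * n * n * n * n := by rw [hG]; gcongr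
        _ = _ := by rw [hn4]; ring
    calc V + 6 * ℓ ≤ (c₁ + 2) * (G * ℓ) := hVG'
      _ ≤ (c₁ + 2) * (G * (c * Λ)) := by gcongr
      _ = c * (c₁ + 2) * (G * Λ) := by ring
      _ ≤ _ := by gcongr
  have hn4' : 1 ≤ (n : ℝ) ^ (β₂ + 4) := Real.one_le_rpow hn1 (by linarith)
  -- the bound on the entries in the sieve
  set b' : ℝ := c₂ * (n : ℝ) ^ (β₂ + 4) with hb'
  have hb'1 : 1 ≤ b' := one_le_mul_of_one_le_of_one_le hc₂1 hn4'
  have hlb' : Real.log b' ≤ c₃ * Λ := by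
    rw [hb', Real.log_mul (by positivity) (by positivity), Real.log_rpow (by linarith), ← hΛ]
    have := mul_le_mul_of_nonneg_left hΛh hlc₂
    calc Real.log c₂ + (β₂ + 4) * Λ ≤ 2 * (Real.log c₂ * Λ) + (β₂ + 4) * Λ := by
          linarith only [this]
      _ = _ := by rw [hc₃]; ring
  have hlqb : Real.log (𝒩.numParams * b') = ℓ + Real.log b' :=
    Real.log_mul (by positivity) (by positivity)
  have hlb'0 : 0 ≤ Real.log b' := Real.log_nonneg hb'1
  have hlqb1 : 1 ≤ Real.log (𝒩.numParams * b') := by rw [hlqb]; linarith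
  -- the resolution of the grid, and the number of its values per entry
  set η' : ℝ := 𝒩.resolution n T X b' with hη'
  have hη'0 : 0 < η' := resolution_pos (by omega) hT hq1 hb'1 hX1
  have hη'1 : η' ≤ 1 := resolution_le_one (by omega) hT hq1 hb'1 hX1
  have hlη' : -Real.log η' ≤ c₅ * (c + c₃) * (T * Λ ^ 2) := by
    refine (neg_log_resolution_le (by omega) hT hq1 hb'1 hX1 hc hdepth hΛ.ge
      ((Real.log_le_log (by linarith) hTn').trans hΛ.ge) hΛh hlqb1).trans ?_
    calc c₅ * (T * Λ * Real.log (𝒩.numParams * b')) ≤ c₅ * (T * Λ * ((c + c₃) * Λ)) := by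
          gcongr; rw [hlqb]; linarith
      _ = _ := by ring
  set M : ℕ := ⌊2 * b' / η'⌋₊ + 1 with hMdef
  have hM : 2 * b' / η' < M := by rw [hMdef]; push_cast; exact Nat.lt_floor_add_one _
  have hM' : (M : ℝ) ≤ 2 * b' / η' + 1 := by
    rw [hMdef]; push_cast
    gcongr
    exact Nat.floor_le (by positivity)
  have hM0 : (0 : ℝ) < M := by rw [hMdef]; positivity
  have hlM : Real.log (𝒩.numParams * M) ≤ c₄ * (T * Λ ^ 2) := by
    have h1 : (M : ℝ) ≤ 3 * b' / η' := by
      have : 1 ≤ b' / η' := by rw [one_le_div hη'0]; linarith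
      calc (M : ℝ) ≤ 2 * b' / η' + b' / η' := by linarith
        _ = _ := by ring
    have h2 : Real.log M ≤ Real.log 3 + Real.log b' - Real.log η' := by
      rw [← Real.log_mul (by norm_num) (by positivity), ← Real.log_div (by positivity) hη'0.ne']
      exact Real.log_le_log hM0 h1
    have h3 : Real.log 3 ≤ 2 := by linarith [Real.log_le_sub_one_of_pos (by norm_num : (0:ℝ) < 3)]
    have h4 : (c + 4 + c₃) * Λ ≤ (c + 4 + c₃) * (2 * (T * Λ ^ 2)) := by gcongr
    rw [Real.log_mul (by positivity) (by positivity)]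
    have h5 : c₄ * (T * Λ ^ 2) = (c + 4 + c₃) * (2 * (T * Λ ^ 2)) +
        c₅ * (c + c₃) * (T * Λ ^ 2) := by rw [hc₄]; ring
    linarith
  set S : ℕ := ⌈c₁ * G⌉₊ with hS
  have hSG : (S : ℝ) ≤ (c₁ + 2) * G := by
    have := (Nat.ceil_lt_add_one (by positivity : 0 ≤ c₁ * G)).le
    rw [add_mul]; linarith
  have hkU : k₁ * U + k₂ * U ≤ k * U := by rw [← add_mul]; gcongr
  have hU0 : 0 ≤ U := by linarith
  refine measure_posterior_gt_le_of_grid (τ := τ) (S := S) (M := M) hd (by omega) hP hσbar hE hσ hu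
    hρ hq hB hW (expMomentBound_pow_mul_exp_le hd hσ0 hq1 hnq) ?_ hb'1 hη'0 hM hM'
    (lipschitz_mul_resolution (by omega) hT hq1 hb'1 hX1 (by linarith)) ?_ ?_ ?_
  · rw [le_div_iff₀ (by positivity)]
    have h1 : V + 3 * ℓ ≤ 2 * (c * (c₁ + 2)) * U := by
      calc V + 3 * ℓ ≤ (c₁ + 2) * (G * ℓ) := by linarith
        _ ≤ (c₁ + 2) * (G * (c * Λ)) := by gcongr
        _ = c * (c₁ + 2) * (G * Λ) := by ring
        _ ≤ c * (c₁ + 2) * (2 * U) := by gcongr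
        _ = _ := by ring
    have h2 : τ + 1 ≤ 8 * |τ + 1| * U := by
      calc τ + 1 ≤ |τ + 1| := le_abs_self _
        _ = 8 * |τ + 1| * (1 / 8) := by ring
        _ ≤ _ := by gcongr
    have h3 := mul_le_mul_of_nonneg_right h1 (sq_nonneg σ)
    have h4 : k₂ * U = 4 * (8 * |τ + 1| * U + 2 * (c * (c₁ + 2)) * U * σ ^ 2) := by
      rw [hk₂]; ring
    have h5 : 0 ≤ k₁ * U := by positivity
    linarith
  · calc V + 5 * ℓ ≤ c₁ * (G * ℓ) := hVG
      _ = c₁ * G * ℓ := by ring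
      _ ≤ S * ℓ := by gcongr; exact Nat.le_ceil _
  · have h1 : b' ≤ b' ^ 2 := le_self_pow₀ hb'1 (by norm_num)
    have h2 : b' = (n : ℝ) ^ (β₂ + 4) + 2 * (c * (c₁ + 2) * (n : ℝ) ^ (β₂ + 4)) := by
      rw [hb', hc₂]; ring
    change V + 6 * ℓ ≤ _
    linarith
  · rw [← Real.exp_log (by positivity : 0 < 3 * ((𝒩.numParams : ℝ) * M) ^ S), ← Real.exp_add,
      ← Real.exp_log (pow_pos hq0 2), ← Real.exp_neg, Real.log_pow,
      Real.log_mul (by norm_num) (by positivity), Real.log_pow]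
    refine Real.exp_le_exp.2 ?_
    have h1 : (S : ℝ) * Real.log (𝒩.numParams * M) ≤ (c₁ + 2) * c₄ * U := by
      calc (S : ℝ) * Real.log (𝒩.numParams * M) ≤ S * (c₄ * (T * Λ ^ 2)) := by gcongr
        _ ≤ (c₁ + 2) * G * (c₄ * (T * Λ ^ 2)) := by gcongr
        _ = _ := by rw [hU]; ring
    have h3 : Real.log 3 ≤ 2 := by linarith [Real.log_le_sub_one_of_pos (by norm_num : (0:ℝ) < 3)]
    have h4 : ℓ ≤ 4 * c * U := by
      calc ℓ ≤ c * Λ := hqΛ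
        _ ≤ c * (4 * U) := by gcongr
        _ = _ := by ring
    have h5 : (16 + 8 * c + (c₁ + 2) * c₄) * U ≤ k * U / (128 * σbar ^ 2) := by
      rw [le_div_iff₀ (by positivity)]
      have : 0 ≤ k₂ * U := by positivity
      calc _ = k₁ * U := by rw [hk₁]; ring
        _ ≤ _ := by linarith
    push_cast
    linarith

/-- If the loss `‖h‖ₙ` exceeds the contraction rate, the sum of the squared deviations exceeds
`sqRate`, up to the logarithmic factors. -/
theorem lt_sum_of_lt_empNorm {n T : ℕ} {β₂ K s ℓ : ℝ} (hβ₂ : 0 ≤ β₂) (hn : 2 ≤ n) (hK : 0 ≤ K)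
    (hs : 0 ≤ s) (hℓ : 1 ≤ ℓ) (hT : 1 ≤ T) {y : Fin n → E dy} {h : E dy → E d}
    (hlt : K * ℓ ^ (1 / (2 + β₂)) * Real.log n ^ (3 / 2 : ℝ) * s *
      ((T : ℝ) ^ (1 + β₂ / 2) / (n : ℝ) ^ (1 / (2 + β₂))) < empNorm y h) :
    (K * s) ^ 2 * (Real.log n ^ 3 * sqRate β₂ n T) < ∑ i, ‖h (y i)‖ ^ 2 := by
  have hn0 : (0 : ℝ) < n := by exact_mod_cast (by omega : 0 < n)
  have hT0 : (0 : ℝ) < T := by exact_mod_cast hT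
  have hl : 0 ≤ Real.log n := by linarith [half_le_log hn]
  have hℓ' : 1 ≤ ℓ ^ (1 / (2 + β₂)) := Real.one_le_rpow hℓ (by positivity)
  set w : ℝ := Real.log n ^ (3 / 2 : ℝ) * ((T : ℝ) ^ (1 + β₂ / 2) / (n : ℝ) ^ (1 / (2 + β₂)))
    with hw
  have hw0 : 0 ≤ w := by positivity
  have h1 : K * s * w < empNorm y h := by
    refine lt_of_le_of_lt ?_ hlt
    calc K * s * w = K * s * w * 1 := (mul_one _).symm
      _ ≤ K * s * w * ℓ ^ (1 / (2 + β₂)) := by gcongr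
      _ = _ := by rw [hw]; ring
  have hw2 : n * w ^ 2 = Real.log n ^ 3 * sqRate β₂ n T := by
    have e1 : (Real.log n ^ (3 / 2 : ℝ)) ^ 2 = Real.log n ^ 3 := by
      rw [← Real.rpow_natCast, ← Real.rpow_mul hl, ← Real.rpow_natCast]; norm_num
    have e2 : ((T : ℝ) ^ (1 + β₂ / 2)) ^ 2 = (T : ℝ) ^ β₂ * (T : ℝ) ^ 2 := by
      rw [← Real.rpow_natCast, ← Real.rpow_mul hT0.le, ← Real.rpow_natCast, ← Real.rpow_add hT0]
      congr 1; push_cast; ring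
    have e3 : (n : ℝ) * (((n : ℝ) ^ (1 / (2 + β₂))) ^ 2)⁻¹ = (n : ℝ) ^ (β₂ / (2 + β₂)) := by
      rw [← Real.rpow_natCast, ← Real.rpow_mul hn0.le, ← Real.rpow_neg hn0.le]
      nth_rewrite 1 [← Real.rpow_one (n : ℝ)]
      rw [← Real.rpow_add hn0]
      have : 2 + β₂ ≠ 0 := by linarith
      congr 1; field_simp; push_cast; ring
    rw [hw, mul_pow, div_pow, e1, e2, sqRate, ← e3]
    ring
  unfold empNorm at h1
  rw [Real.lt_sqrt (by positivity), one_div, ← div_eq_inv_mul, lt_div_iff₀ hn0] at h1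
  calc _ = (K * s * w) ^ 2 * n := by rw [← hw2]; ring
    _ < _ := h1

theorem accuracy_pos_and_le_half {β₂ : ℝ} (hβ₂ : 0 ≤ β₂) {n T : ℕ} (hn : 1 ≤ n) (hT : 1 ≤ T) :
    0 < accuracy β₂ n T ∧ accuracy β₂ n T ≤ 1 / 2 := by
  have hn' : (1 : ℝ) ≤ n := by exact_mod_cast hn
  have hT' : (1 : ℝ) ≤ T := by exact_mod_cast hT
  have h := Real.one_le_rpow hn' (by positivity : 0 ≤ 1 / (2 + β₂))
  have h2 := one_le_mul_of_one_le_of_one_le hT' h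
  unfold accuracy
  refine ⟨by positivity, one_div_le_one_div_of_le two_pos ?_⟩
  rw [mul_assoc]
  linarith

end Network

end Unrolling

theorem theorem1 :
    -- absolute constants
    ∃ c₁ : ℝ, 0 < c₁ ∧ ∃ q₀ : ℕ,
    -- the inverse problem, the statistical model and the constants of the assumptions
    ∀ (dx dy : ℕ) (_ : 1 ≤ dx) (P : InverseProblem dx dy) (L σbar σ u : ℝ)
      (D₀ N₀ s₀ β₁ β₂ R₀ R₁ : ℝ),
      P.ConvexModel L → 0 < σbar → P.ErrorModel σbar → σbar ≤ σ → 1 ≤ u → 0 ≤ β₁ → 0 ≤ β₂ →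
    -- constants that do not depend on `n`
    ∃ C K : ℝ, 0 < C ∧ 0 < K ∧
    ∀ (n : ℕ) (_ : 2 ≤ n) (ϱ : ℝ) (_ : 0 ≤ ϱ) (_ : ϱ < 1)
      -- a set of designs on which proximal gradient descent converges at rate `ϱ`
      (B : Set (Fin n → E dy)) (_ : MeasurableSet B) (_ : ∀ y ∈ B, P.LinearRate R₀ ϱ y)
      -- the networks that approximate the proximal map
      (net : ℝ → Network dx) (Wnet : ∀ ε, (net ε).Param)
      (_ : ∀ ε, 0 < ε → ε ≤ 1 / 2 →
        (net ε).Approximates (Wnet ε) P D₀ N₀ s₀ β₁ β₂ ε ∧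
        ∀ y ∈ B, (net ε).StableIterates P (Wnet ε) R₁ y)
      -- the unrolling depth (for `ϱ = 0` the bound reads `0 ≤ T`)
      (T : ℕ) (_ : 1 ≤ T) (_ : C * (Real.log n / (-Real.log ϱ)) ≤ T)
      -- the network class, and its number of parameters
      (𝒩 : Network dx) (_ : 𝒩 = net (accuracy β₂ n T)) (q : ℕ) (_ : q = 𝒩.numParams)
      (_ : q₀ ≤ q) (_ : σ ^ 2 * Real.log q ≤ n) (ρ₀ : ℝ) (_ : 0 < ρ₀),
      -- the posterior contracts, except with small probability given the design
      Measure.pi (fun _ : Fin n => P.jointLaw)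
          {D | (fun i => (D i).2) ∈ B ∧
            12 / (q : ENNReal) <
              𝒩.posterior P T σ u ρ₀ D
                {θ | K * Real.log q ^ (1 / (2 + β₂)) * Real.log n ^ (3 / 2 : ℝ) * σbar *
                      ((T : ℝ) ^ (1 + β₂ / 2) / (n : ℝ) ^ (1 / (2 + β₂))) <
                    empNorm (fun i => (D i).2)
                      (fun y => 𝒩.gdn P T (𝒩.mask θ) y - P.g y)}}
        ≤ ENNReal.ofReal (Real.exp (-(c₁ * n)) + c₁ / q) *
            Measure.pi (fun _ : Fin n => P.jointLaw) {D | (fun i => (D i).2) ∈ B} := by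
  refine ⟨1, one_pos, 4, ?_⟩
  intro dx dy hd P L σbar σ u D₀ N₀ s₀ β₁ β₂ R₀ R₁ hP hσbar hE hσ hu hβ₁ hβ₂
  obtain ⟨c, hc, hsize⟩ := Network.exists_size_bounds hd D₀ N₀ s₀ hβ₁ hβ₂
  obtain ⟨c', hc', hgrad⟩ := Network.exists_gradStep_bound hP R₀ R₁
  obtain ⟨a₀, b₀, ha₀, hb₀, href⟩ :=
    Network.exists_referenceBounds hP hβ₂ (zero_le_one.trans hu) R₀ hc hc'
  obtain ⟨k₁, hk₁0, hk₁⟩ := Network.exists_contraction_of_le (c := c) hd hP hσbar hE hσ hu hβ₂ ha₀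
    hb₀ hc
  obtain ⟨k₂, hk₂0, hk₂⟩ := Network.exists_contraction_of_lt hd hP hσbar hE hσ hu hβ₂ ha₀ hb₀ hc
    hc'
  have hkσ : (1 + k₁ + k₂) / σbar * σbar = 1 + k₁ + k₂ := div_mul_cancel₀ _ hσbar.ne'
  refine ⟨1, (1 + k₁ + k₂) / σbar, one_pos, by positivity, ?_⟩
  intro n hn ϱ hϱ0 hϱ1 B hB hlin net Wnet hnet T hT hTϱ 𝒩 h𝒩 q hqdef hq hnq ρ₀ hρ
  subst h𝒩 hqdef
  rw [one_mul] at hTϱ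
  have hacc := Network.accuracy_pos_and_le_half hβ₂ (by omega : 1 ≤ n) hT
  obtain ⟨hA, hstab⟩ := hnet _ hacc.1 hacc.2
  set 𝒩 := net (accuracy β₂ n T) with h𝒩
  have hgrad' : ∀ y ∈ B, ∀ i, ‖P.gradStep (y i) 0‖ ≤ c' := fun y hy =>
    hgrad 𝒩 _ _ (by linarith [hacc.2]) hA.approx n y ϱ hϱ0 hϱ1 (hlin y hy) (hstab y hy)
  have hn1 : (1 : ℝ) ≤ n := by exact_mod_cast (by omega : 1 ≤ n)
  have hT1 : (1 : ℝ) ≤ T := by exact_mod_cast hT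
  have hq4 : (4 : ℝ) ≤ 𝒩.numParams := by exact_mod_cast hq
  have hlq : 1 ≤ Real.log 𝒩.numParams := by
    rw [Real.le_log_iff_exp_le (by linarith)]
    linarith [Real.exp_one_lt_d9]
  have hk1 : k₁ ≤ (1 + k₁ + k₂) ^ 2 := by nlinarith
  have hk2 : k₂ ≤ (1 + k₁ + k₂) ^ 2 := by nlinarith
  have hmain : Measure.pi (fun _ : Fin n => P.jointLaw) {D | (fun i => (D i).2) ∈ B ∧
        12 / (𝒩.numParams : ENNReal) < 𝒩.posterior P T σ u ρ₀ D
          {θ | (1 + k₁ + k₂) ^ 2 * (Real.log n ^ 3 * Network.sqRate β₂ n T) <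
            ∑ i, ‖𝒩.gdn P T (𝒩.mask θ) (D i).2 - P.g (D i).2‖ ^ 2}} ≤
      ENNReal.ofReal (1 / 𝒩.numParams) *
        Measure.pi (fun _ : Fin n => P.jointLaw) {D | (fun i => (D i).2) ∈ B} := by
    rcases le_or_gt n T with hnT | hTn
    · have hnT' : Real.log n ≤ Real.log T :=
        Real.log_le_log (by linarith) (by exact_mod_cast hnT)
      have hΛ := (Network.half_le_log hn).trans hnT'
      obtain ⟨h1, h2, h3⟩ := hsize (by omega) hT hnT' le_rfl hΛ (le_trans (by norm_num) hq) hA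
      obtain ⟨η, e₀, hW⟩ := href (by omega) hT hnT' le_rfl hΛ hq hA h1 h3 hϱ0 hϱ1 hlin hTϱ hgrad'
      exact hk₁ hk1 hn hnT hρ hq hnq hB rfl h2 hW
    · have hTn' : Real.log T ≤ Real.log n :=
        Real.log_le_log (by linarith) (by exact_mod_cast hTn.le)
      have hΛ := Network.half_le_log hn
      obtain ⟨h1, h2, h3⟩ := hsize (by omega) hT le_rfl hTn' hΛ (le_trans (by norm_num) hq) hA
      obtain ⟨η, e₀, hW⟩ := href (by omega) hT le_rfl hTn' hΛ hq hA h1 h3 hϱ0 hϱ1 hlin hTϱ hgrad'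
      exact hk₂ hk2 hn hT hTn hρ hq hnq hB rfl h1 h2 hW
  refine le_trans (measure_mono ?_) (hmain.trans (mul_le_mul_left (ENNReal.ofReal_le_ofReal ?_) _))
  · rintro D ⟨hDB, hD⟩
    refine ⟨hDB, hD.trans_le (measure_mono fun θ hθ => ?_)⟩
    have h := Network.lt_sum_of_lt_empNorm hβ₂ hn (by positivity) hσbar.le hlq hT hθ
    rwa [hkσ] at h
  · linarith [Real.exp_pos (-(1 * (n : ℝ)))]
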